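/- For a bounded convex set $K\subset\mathbb R^d$ with nonempty interior, $d\ge2$, let $P_1,P_2,\dots$ be random points drawn independently and uniformly from $K$, and for $n\ge3$ let $\varphi_{n,K}$ be the largest angle (with values in $[0,\pi]$) in all the triangles with vertices among $P_1,\dots,P_n$. Let $B^{(d)}$ be the unit ball in $\mathbb R^d$, and for each $d\ge2$ let $K_d$ be an arbitrary bounded convex subset of $\mathbb R^d$ with nonempty interior. (i) For each $d\ge2$, the random variables $n^{3/(d-1)}(\pi-\varphi_{n,B^{(d)}})$ converge in distribution as $n\to\infty$ to a real random variable $W_d$, and $W_d$ converges in distribution as $d\to\infty$ to the constant $\frac{3\sqrt3}{2}$. (ii) For each $d\ge2$, the random variables $n^{3/(d-1)}(\pi-\varphi_{n,K_d})$ converge in distribution as $n\to\infty$ to a real random variable $Z_d$, and the limit superior in distribution of $Z_d$ as $d\to\infty$ is at most $\frac{3\sqrt3}{2}$, that is, for all real $y$, $$\limsup_{d\to\infty}\mathsf P(Z_d\ge y)\le \mathsf P\Big(\frac{3\sqrt3}{2}\ge y\Big),$$ where the right-hand side is $1$ if $y\le\frac{3\sqrt3}{2}$ and $0$ otherwise.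 -/

import Mathlib

open MeasureTheory ProbabilityTheory Filter Topology

noncomputable section

/-- The largest of the three angles (with values in `[0, π]`) of the triangle `x y z`. -/
def largestTriangleAngle {d : ℕ} (x y z : EuclideanSpace ℝ (Fin d)) : ℝ :=
  max (EuclideanGeometry.angle y x z)
    (max (EuclideanGeometry.angle x y z) (EuclideanGeometry.angle x z y))

/-- The three-element subsets of `{0, …, n - 1}`, each listed once, in increasing order. -/
def indexTriples (n : ℕ) : Set (ℕ × ℕ × ℕ) :=
  {t | t.1 < t.2.1 ∧ t.2.1 < t.2.2 ∧ t.2.2 < n}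

/-- The largest angle in all the triangles with vertices among the first `n` points of the
sequence `p` (for `n < 3` there is no triangle and the value is `0` by convention). -/
def maxAngle {d : ℕ} (p : ℕ → EuclideanSpace ℝ (Fin d)) (n : ℕ) : ℝ :=
  ⨆ t : indexTriples n, largestTriangleAngle (p t.1.1) (p t.1.2.1) (p t.1.2.2)

/-- The points `P 0, P 1, …` are drawn independently and uniformly from `K`. -/
structure IsUniformSample {d : ℕ} {Ω : Type*} [MeasurableSpace Ω]
    (P : ℕ → Ω → EuclideanSpace ℝ (Fin d)) (K : Set (EuclideanSpace ℝ (Fin d)))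
    (Pr : Measure Ω) : Prop where
  indep : iIndepFun P Pr
  uniform : ∀ i, pdf.IsUniform (P i) K Pr volume

/-- The random variable `n ^ (3 / (d - 1)) * (π - φ)`, where `φ` is the largest angle in all the
triangles with vertices among the first `n` of the random points `P`. -/
def scaledDeficit {d : ℕ} {Ω : Type*} (P : ℕ → Ω → EuclideanSpace ℝ (Fin d)) (n : ℕ) (ω : Ω) : ℝ :=
  (n : ℝ) ^ ((3 : ℝ) / ((d : ℝ) - 1)) * (Real.pi - maxAngle (fun i => P i ω) n)

/-- For each dimension `d ≥ 2`, the law `ν d` is the limit in distribution as `n → ∞` of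
`n ^ (3 / (d - 1)) * (π - φ)` for the random points `P d`. -/
def IsDlimOverN {Ω : ℕ → Type*} [∀ d, MeasurableSpace (Ω d)] (Pr : ∀ d, Measure (Ω d))
    [∀ d, IsProbabilityMeasure (Pr d)] (P : ∀ d, ℕ → Ω d → EuclideanSpace ℝ (Fin d))
    (ν : ℕ → ProbabilityMeasure ℝ) : Prop :=
  ∀ d, 2 ≤ d → TendstoInDistribution (fun n => scaledDeficit (P d) n) atTop (id : ℝ → ℝ)
    (fun _ => Pr d) (ν d : Measure ℝ)

/-- The limit superior in distribution of real random variables with laws `ν d` is at most a real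
random variable `Y` with law `μ`: the limit superior of the probabilities of `[y, ∞)` under `ν d`
is at most the probability that `Y ≥ y`, for all real `y`. -/
def DlimsupLE (ν : ℕ → ProbabilityMeasure ℝ) (μ : ProbabilityMeasure ℝ) : Prop :=
  ∀ y : ℝ, limsup (fun d => (ν d : Measure ℝ) (Set.Ici y)) atTop ≤ (μ : Measure ℝ) (Set.Ici y)

end

/-!
Write `m = d - 1`. A triangle has an angle larger than `π - t` when one of its vertices lies in the
thin spindle of points that see the opposite side under such an angle. In an open convex set `U` the
spindle over a side of length `r` has volume asymptotic to `spindleConst m * t ^ m * r ^ d`, so for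
`t = y * n ^ (-3 / m)` the expected number of triples of sample points with such an angle tends to
`deficitRate U * y ^ m`, a constant multiple of the distance moment `∫∫ ‖x - y‖ ^ d` over `U × U`.
Given two vertices the third one has probability `O(n ^ (-3))`, so dependence between triples is
negligible and the probability that there is no such triple is that of a Poisson law
(`abs_measureReal_no_triple_sub_exp_le`). The survival function of the rescaled deficit converges
to `exp (-(deficitRate U * y ^ m))` (`tendsto_measureReal_le_scaledDeficit`). A bounded convex set
differs from its interior by a null set, so this settles every fixed dimension.

As the dimension grows only exponential orders matter. Let `C = 8 / (3 * √3)`, let `κ` be the volume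
of the unit ball of `ℝ ^ d`, and let `V` be the volume of `U`. The distance moment of any `U` is at
least `C ^ d * V ^ 3 / κ` up to a factor polynomial in `d` (`le_distanceMoment`), and for the unit
ball this is also an upper bound (`distanceMoment_ball_le`). The lower bound comes from the sharp
reverse Young inequality with exponents `2 / 3`, in dual form
(`reverse_young`): transporting a Gaussian to both densities reduces it to the arithmetic-geometric
mean inequality, and `C` is the value for Gaussians. The upper bound comes from covering the
intersection of two unit balls by a smaller ball. Since `∫ (s * (1 - s)) ^ m` over `[0, 1]` is
`4 ^ (-m)` and the volumes of unit balls in consecutive dimensions are comparable, both again up to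
polynomial factors, `deficitRate * y ^ m` is `(C * y / 4) ^ m` up to such factors for the ball, and
at least this in general. The threshold is therefore `y = 4 / C = 3 * √3 / 2`.
-/

/-! ### Monotone transport on the line -/

/-- The Cauchy-Schwarz inequality, for a function dominated pointwise by a geometric mean. -/
theorem lintegral_sq_le_of_sq_le_mul {α : Type*} [MeasurableSpace α] {μ : Measure α}
    {f g h : α → ENNReal} (hg : AEMeasurable g μ) (hh : AEMeasurable h μ)
    (hfgh : ∀ᵐ x ∂μ, f x ^ 2 ≤ g x * h x) :
    (∫⁻ x, f x ∂μ) ^ 2 ≤ (∫⁻ x, g x ∂μ) * ∫⁻ x, h x ∂μ := by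
  have key : ∫⁻ x, f x ∂μ ≤ (∫⁻ x, g x ∂μ) ^ (1 / 2 : ℝ) * (∫⁻ x, h x ∂μ) ^ (1 / 2 : ℝ) := by
    calc ∫⁻ x, f x ∂μ
        ≤ ∫⁻ x, ((fun x => g x ^ (1 / 2 : ℝ)) * fun x => h x ^ (1 / 2 : ℝ)) x ∂μ := by
          refine lintegral_mono_ae (hfgh.mono fun x hx => ?_)
          have := ENNReal.rpow_le_rpow hx (show (0 : ℝ) ≤ 1 / 2 by norm_num)
          rw [ENNReal.mul_rpow_of_nonneg _ _ (by norm_num), ← ENNReal.rpow_natCast,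
            ← ENNReal.rpow_mul] at this
          simpa using this
      _ ≤ _ := by
          refine (ENNReal.lintegral_mul_le_Lp_mul_Lq μ Real.HolderConjugate.two_two
            (hg.pow_const _) (hh.pow_const _)).trans (le_of_eq ?_)
          have h2 : ∀ x : ENNReal, (x ^ (1 / 2 : ℝ)) ^ (2 : ℝ) = x := fun x => by
            rw [← ENNReal.rpow_mul]; norm_num
          simp only [h2]
  calc (∫⁻ x, f x ∂μ) ^ 2
      ≤ ((∫⁻ x, g x ∂μ) ^ (1 / 2 : ℝ) * (∫⁻ x, h x ∂μ) ^ (1 / 2 : ℝ)) ^ 2 := by gcongr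
    _ = _ := by
      rw [mul_pow, ← ENNReal.rpow_natCast, ← ENNReal.rpow_natCast, ← ENNReal.rpow_mul,
        ← ENNReal.rpow_mul]
      simp

theorem continuous_cdf (μ : Measure ℝ) [IsProbabilityMeasure μ] [NullSingletonClass μ] :
    Continuous (cdf μ) := by
  rw [continuous_iff_continuousAt]
  intro x
  rw [(monotone_cdf μ).continuousAt_iff_leftLim_eq_rightLim, StieltjesFunction.rightLim_eq]
  have h : (cdf μ).measure {x} = 0 := by rw [measure_cdf]; simp
  rw [StieltjesFunction.measure_singleton, ENNReal.ofReal_eq_zero] at h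
  exact le_antisymm ((monotone_cdf μ).leftLim_le le_rfl) (by linarith)

/-- Monotone transport on the line: the quantile function of `μ` after the distribution function of
`γ` pushes `γ` forward to `μ`. -/
theorem exists_monotone_transport (γ μ : Measure ℝ) [IsProbabilityMeasure γ]
    [IsProbabilityMeasure μ] [NullSingletonClass γ] [NullSingletonClass μ]
    (hγ : StrictMono (cdf γ)) :
    ∃ U : ℝ → ℝ, StrictMono U ∧ γ.map U = μ ∧ ∀ a, cdf μ (U a) = cdf γ a := by
  have hpos : ∀ a, 0 < cdf γ a := fun a =>
    (cdf_nonneg γ (a - 1)).trans_lt (hγ (by linarith))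
  have hlt : ∀ a, cdf γ a < 1 := fun a => (hγ (by linarith : a < a + 1)).trans_le (cdf_le_one γ _)
  have hmem : ∀ p : ℝ, 0 < p → p < 1 → ∃ b, cdf γ b = p := fun p h0 h1 => by
    obtain ⟨b, hb⟩ := mem_range_of_exists_le_of_exists_ge (continuous_cdf γ)
      (((tendsto_cdf_atBot γ).eventually_le_const h0).exists)
      (((tendsto_cdf_atTop γ).eventually_const_le h1).exists)
    exact ⟨b, hb⟩
  have hF : ∀ p : ℝ, 0 < p → p < 1 → ∃ b, cdf μ b = p := fun p h0 h1 => by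
    obtain ⟨b, hb⟩ := mem_range_of_exists_le_of_exists_ge (continuous_cdf μ)
      (((tendsto_cdf_atBot μ).eventually_le_const h0).exists)
      (((tendsto_cdf_atTop μ).eventually_const_le h1).exists)
    exact ⟨b, hb⟩
  choose U hU using fun a => hF _ (hpos a) (hlt a)
  have hUm : StrictMono U := fun a b hab => by
    by_contra hcon
    have := monotone_cdf μ (not_lt.1 hcon)
    rw [hU, hU] at this
    exact absurd (hγ hab) (not_lt.2 this)
  refine ⟨U, hUm, ?_, hU⟩
  have hmeas : Measurable U := hUm.monotone.measurable
  have hprob : IsProbabilityMeasure (γ.map U) := Measure.isProbabilityMeasure_map hmeas.aemeasurable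
  refine Measure.eq_of_cdf _ _ ?_
  ext x
  -- `U ⁻¹' (-∞, x]` differs from `{cdf γ ≤ cdf μ x}` by at most one point
  rw [cdf_eq_real, measureReal_def, Measure.map_apply hmeas measurableSet_Iic]
  rcases eq_or_lt_of_le (cdf_nonneg μ x) with h0 | h0
  · have : U ⁻¹' Set.Iic x = ∅ := by
      ext a
      simp only [Set.mem_preimage, Set.mem_Iic, Set.mem_empty_iff_false, iff_false]
      intro h
      have := monotone_cdf μ h
      rw [hU, ← h0] at this
      exact absurd (hpos a) (not_lt.2 this)
    simp [this, ← h0]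
  rcases eq_or_lt_of_le (cdf_le_one μ x) with h1 | h1
  · have : U ⁻¹' Set.Iic x = Set.univ := by
      ext a
      simp only [Set.mem_preimage, Set.mem_Iic, Set.mem_univ, iff_true]
      by_contra h
      have := monotone_cdf μ (not_le.1 h).le
      rw [hU, h1] at this
      exact absurd (hlt a) (not_lt.2 this)
    simp [this, h1]
  · obtain ⟨b, hb⟩ := hmem _ h0 h1
    have e1 : U ⁻¹' Set.Iic x =ᵐ[γ] Set.Iic b := by
      have : ∀ᵐ a ∂γ, a ≠ b := by
        simp [ae_iff]
      filter_upwards [this] with a ha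
      refine propext (?_ : U a ≤ x ↔ a ≤ b)
      constructor
      · intro h
        have := monotone_cdf μ h
        rw [hU, ← hb] at this
        exact hγ.le_iff_le.1 this
      · intro h
        by_contra hcon
        have := monotone_cdf μ (not_le.1 hcon).le
        rw [hU, ← hb] at this
        exact ha (le_antisymm h (hγ.le_iff_le.1 this))
    rw [measure_congr e1, ← hb, cdf_eq_real, measureReal_def]

/-- Monotone transport between densities on the line. The transport map need not be absolutely
continuous, so the Jacobian equation `e = (u ∘ U) * deriv U` is only asserted almost everywhere. -/
theorem exists_transport_of_density {e u : ℝ → ENNReal} (he : Measurable e) (hu : Measurable u)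
    (he0 : ∀ x, e x ≠ 0) (he1 : ∫⁻ x, e x = 1) (hu1 : ∫⁻ x, u x = 1) :
    ∃ U : ℝ → ℝ, StrictMono U ∧
      (volume.withDensity e).map U = volume.withDensity u ∧
      ∀ᵐ a, DifferentiableAt ℝ U a ∧ u (U a) ≠ ⊤ ∧
        e a = u (U a) * ENNReal.ofReal (deriv U a) := by
  have hprob : ∀ {f : ℝ → ENNReal}, ∫⁻ x, f x = 1 →
      IsProbabilityMeasure (volume.withDensity f) := fun {f} hf => ⟨by simpa using hf⟩
  have := hprob he1
  have := hprob hu1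
  have hac : (volume : Measure ℝ) ≪ volume.withDensity e :=
    withDensity_absolutelyContinuous' he.aemeasurable (ae_of_all _ he0)
  have hsm : StrictMono (cdf (volume.withDensity e)) := fun a b hab => by
    have h : 0 < (volume.withDensity e) (Set.Ioc a b) := by
      rw [pos_iff_ne_zero]
      intro h
      have := hac h
      simp only [Real.volume_Ioc, ENNReal.ofReal_eq_zero] at this
      linarith
    have h2 : (volume.withDensity e) (Set.Ioc a b) =
        (cdf (volume.withDensity e)).measure (Set.Ioc a b) := by rw [measure_cdf]
    rw [h2, StieltjesFunction.measure_Ioc, ENNReal.ofReal_pos] at h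
    linarith
  obtain ⟨U, hUm, hmap, hU⟩ := exists_monotone_transport (volume.withDensity e)
    (volume.withDensity u) hsm
  refine ⟨U, hUm, hmap, ?_⟩
  have hmeas : Measurable U := hUm.monotone.measurable
  have hder : ∀ {f : ℝ → ENNReal} (_ : Measurable f) (_ : ∫⁻ x, f x = 1), ∀ᵐ x, f x ≠ ⊤ ∧
      HasDerivAt (cdf (volume.withDensity f)) (f x).toReal x := by
    intro f hf hf1
    have := hprob hf1
    filter_upwards [(cdf (volume.withDensity f)).ae_hasDerivAt,
      Measure.rnDeriv_withDensity (volume : Measure ℝ) hf,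
      ae_lt_top hf (by simp [hf1])] with x hx1 hx2 hx3
    rw [measure_cdf, hx2] at hx1
    exact ⟨hx3.ne, hx1⟩
  -- Since `e` vanishes nowhere, `U` pulls null sets back to null sets, so that almost everywhere
  -- properties of the density `u` can be used at `U a`.
  have hqmp : Measure.QuasiMeasurePreserving U volume volume := by
    refine ⟨hmeas, ?_⟩
    have h1 : volume.map U ≪ (volume.withDensity e).map U := hac.map hmeas
    rw [hmap] at h1
    exact h1.trans (withDensity_absolutelyContinuous _ _)
  filter_upwards [hder he he1, hqmp.ae (hder hu hu1), hUm.monotone.ae_differentiableAt]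
    with a ⟨h1, h2⟩ ⟨h3, h4⟩ h5
  refine ⟨h5, h3, ?_⟩
  -- The Jacobian equation is the derivative of the identity between the distribution functions.
  have h6 := h4.comp a h5.hasDerivAt
  have h7 : (cdf (volume.withDensity u)) ∘ U = cdf (volume.withDensity e) := funext hU
  rw [h7] at h6
  have h8 := h2.unique h6
  rw [← ENNReal.ofReal_toReal h1, h8, ENNReal.ofReal_mul ENNReal.toReal_nonneg,
    ENNReal.ofReal_toReal h3]

/-! ### The sharp reverse Young inequality -/

/-- One half of the change of variables formula: it holds as an inequality for every strictly
monotone map, absolutely continuous or not. -/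
theorem lintegral_comp_mul_deriv_le {z : ℝ → ℝ} (hz : StrictMono z) {k : ℝ → ENNReal} :
    ∫⁻ b in {b | DifferentiableAt ℝ z b}, ENNReal.ofReal (deriv z b) * k (z b) ≤ ∫⁻ t, k t := by
  have hD : MeasurableSet {b | DifferentiableAt ℝ z b} := measurableSet_of_differentiableAt ℝ z
  have h := lintegral_image_eq_lintegral_abs_deriv_mul (f := z) (f' := deriv z) hD
    (fun x hx => (DifferentiableAt.hasDerivAt hx).hasDerivWithinAt) hz.injective.injOn k
  have h2 : ∀ b, |deriv z b| = deriv z b := fun b => abs_of_nonneg hz.monotone.deriv_nonneg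
  simp only [h2] at h
  rw [← h]
  exact setLIntegral_le_lintegral _ _

/-- Weighted arithmetic-geometric mean inequality behind the reverse Young inequality: the product
`(a b) ^ 3` is controlled by any `p, q` and slopes `r, s` with `a = p r`, `b = q s`. -/
theorem ennreal_transport_amgm {a b p q r s : ENNReal} (ha : a = p * r) (hb : b = q * s) :
    (2 ^ (1 / 2 : ℝ) * (a * b) ^ (3 / 4 : ℝ)) ^ 2 ≤
      a * b * (p ^ (1 / 2 : ℝ) * q ^ (1 / 2 : ℝ)) * (r + s) := by
  have h34 : ∀ x : ENNReal, (x ^ (3 / 4 : ℝ)) ^ 2 = x * x ^ (1 / 2 : ℝ) := fun x => by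
    rw [← ENNReal.rpow_natCast, ← ENNReal.rpow_mul]
    conv_rhs => rw [← ENNReal.rpow_one x, ← ENNReal.rpow_mul,
      ← ENNReal.rpow_add_of_nonneg _ _ (by norm_num) (by norm_num)]
    norm_num
  have h12 : ∀ x : ENNReal, (x ^ (1 / 2 : ℝ)) ^ 2 = x := fun x => by
    rw [← ENNReal.rpow_natCast, ← ENNReal.rpow_mul]; norm_num
  have hrs : 2 * (r ^ (1 / 2 : ℝ) * s ^ (1 / 2 : ℝ)) ≤ r + s := by
    have amgm : ∀ x y : ENNReal, 2 * (x * y) ≤ x ^ 2 + y ^ 2 := fun x y => by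
      induction x with
      | top => simp
      | coe x =>
        induction y with
        | top => simp
        | coe y =>
          have := two_mul_le_add_sq x y
          rw [mul_assoc] at this
          exact_mod_cast this
    simpa only [h12] using amgm (r ^ (1 / 2 : ℝ)) (s ^ (1 / 2 : ℝ))
  calc (2 ^ (1 / 2 : ℝ) * (a * b) ^ (3 / 4 : ℝ)) ^ 2
      = 2 * (a * b * (a * b) ^ (1 / 2 : ℝ)) := by rw [mul_pow, h12, h34]
    _ = a * b * (p ^ (1 / 2 : ℝ) * q ^ (1 / 2 : ℝ)) *
        (2 * (r ^ (1 / 2 : ℝ) * s ^ (1 / 2 : ℝ))) := by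
        have : (a * b) ^ (1 / 2 : ℝ) =
          (p ^ (1 / 2 : ℝ) * q ^ (1 / 2 : ℝ)) * (r ^ (1 / 2 : ℝ) * s ^ (1 / 2 : ℝ)) := by
          rw [ha, hb]
          simp only [ENNReal.mul_rpow_of_nonneg _ _ (show (0 : ℝ) ≤ 1 / 2 by norm_num)]
          ring
        rw [this]; ring
    _ ≤ _ := by gcongr

/-- The transport argument for the reverse Young inequality on the line, with an arbitrary nowhere
vanishing reference density `e` in place of the Gaussian, and for normalized `u` and `v`. -/
theorem reverse_young_real_transport {e u v k : ℝ → ENNReal} (he : Measurable e)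
    (hu : Measurable u) (hv : Measurable v) (hk : Measurable k) (he0 : ∀ x, e x ≠ 0)
    (he1 : ∫⁻ x, e x = 1) (hu1 : ∫⁻ x, u x = 1) (hv1 : ∫⁻ x, v x = 1)
    (hk0 : ∀ x, k x ≠ 0) (hk1 : ∫⁻ x, k x ≠ ⊤) :
    ∫⁻ τ, (∫⁻ b, 2 ^ (1 / 2 : ℝ) * (e (b + τ) * e b) ^ (3 / 4 : ℝ)) ^ 2 ≤
      (∫⁻ x, ∫⁻ y, u x ^ (3 / 2 : ℝ) * v y ^ (3 / 2 : ℝ) / k (x + y)) * ∫⁻ t, k t := by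
  obtain ⟨U, hUm, hUmap, hU⟩ := exists_transport_of_density he hu he0 he1 hu1
  obtain ⟨V, hVm, hVmap, hV⟩ := exists_transport_of_density he hv he0 he1 hv1
  have hUmeas : Measurable U := hUm.monotone.measurable
  have hVmeas : Measurable V := hVm.monotone.measurable
  -- `H` is the integrand of the right-hand side after transporting both variables to the density
  -- `e`.
  set H : ℝ → ℝ → ENNReal := fun a b =>
    e a * (e b * (u (U a) ^ (1 / 2 : ℝ) * v (V b) ^ (1 / 2 : ℝ) / k (U a + V b))) with hH
  have hHmeas : Measurable (Function.uncurry H) := by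
    simp only [hH, Function.uncurry_def]
    fun_prop
  have h32 : ∀ x : ENNReal, x ^ (3 / 2 : ℝ) = x * x ^ (1 / 2 : ℝ) := fun x => by
    conv_rhs => rw [← ENNReal.rpow_one x, ← ENNReal.rpow_mul,
      ← ENNReal.rpow_add_of_nonneg _ _ (by norm_num) (by norm_num)]
    norm_num
  have push : ∀ {w : ℝ → ENNReal} {W : ℝ → ℝ} (_ : Measurable w) (_ : Measurable W)
      (_ : (volume.withDensity e).map W = volume.withDensity w) {G : ℝ → ENNReal}
      (_ : Measurable G), ∫⁻ x, w x * G x = ∫⁻ a, e a * G (W a) := by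
    intro w W hw hW hmap G hG
    have h1 := lintegral_withDensity_eq_lintegral_mul volume hw hG
    have h2 := lintegral_withDensity_eq_lintegral_mul volume he (hG.comp hW)
    simp only [Pi.mul_apply, Function.comp_apply] at h1 h2
    rw [← h1, ← h2, ← hmap, lintegral_map hG hW]
  have hRHS : ∫⁻ x, ∫⁻ y, u x ^ (3 / 2 : ℝ) * v y ^ (3 / 2 : ℝ) / k (x + y) =
      ∫⁻ a, ∫⁻ b, H a b := by
    have h1 : ∀ x, ∫⁻ y, u x ^ (3 / 2 : ℝ) * v y ^ (3 / 2 : ℝ) / k (x + y) =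
        u x * ∫⁻ b, e b * (u x ^ (1 / 2 : ℝ) * v (V b) ^ (1 / 2 : ℝ) / k (x + V b)) := by
      intro x
      rw [← push hv hVmeas hVmap
        (G := fun y => u x ^ (1 / 2 : ℝ) * v y ^ (1 / 2 : ℝ) / k (x + y)) (by fun_prop),
        ← lintegral_const_mul _ (by fun_prop)]
      refine lintegral_congr fun y => ?_
      rw [h32, h32]
      simp only [div_eq_mul_inv]
      ring
    simp only [h1]
    rw [push hu hUmeas hUmap (G := fun x => ∫⁻ b, e b *
      (u x ^ (1 / 2 : ℝ) * v (V b) ^ (1 / 2 : ℝ) / k (x + V b)))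
      (Measurable.lintegral_prod_right' (f := fun p : ℝ × ℝ => e p.2 *
      (u p.1 ^ (1 / 2 : ℝ) * v (V p.2) ^ (1 / 2 : ℝ) / k (p.1 + V p.2))) (by fun_prop))]
    refine lintegral_congr fun a => ?_
    rw [← lintegral_const_mul _ (by fun_prop)]
  -- For fixed `τ` the argument of `k` now runs along the monotone curve `U (b + τ) + V b`.
  have hshear : ∫⁻ a, ∫⁻ b, H a b = ∫⁻ τ, ∫⁻ b, H (b + τ) b := by
    rw [lintegral_lintegral_swap hHmeas.aemeasurable]
    have : ∀ b, ∫⁻ a, H a b = ∫⁻ τ, H (b + τ) b := fun b =>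
      (lintegral_add_left_eq_self (fun a => H a b) b).symm
    simp only [this]
    rw [lintegral_lintegral_swap]
    exact (hHmeas.comp (f := fun p : ℝ × ℝ => (p.1 + p.2, p.1)) (by fun_prop)).aemeasurable
  rw [hRHS, hshear, ← lintegral_mul_const' _ _ hk1]
  refine lintegral_mono fun τ => ?_
  set z : ℝ → ℝ := fun b => U (b + τ) + V b with hz
  have hzm : StrictMono z := fun a b hab => add_lt_add (hUm (by linarith)) (hVm hab)
  set D := {b | DifferentiableAt ℝ z b} with hDdef
  have hD : MeasurableSet D := measurableSet_of_differentiableAt ℝ z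
  have hcv := lintegral_comp_mul_deriv_le hzm (k := k)
  have hUτ : ∀ᵐ b, DifferentiableAt ℝ U (b + τ) ∧ u (U (b + τ)) ≠ ⊤ ∧
      e (b + τ) = u (U (b + τ)) * ENNReal.ofReal (deriv U (b + τ)) :=
    (measurePreserving_add_right volume τ).quasiMeasurePreserving.ae hU
  have hDae : ∀ᵐ b, b ∈ D := by
    filter_upwards [hUτ, hV] with b h1 h2
    exact (h1.1.comp b (f := fun b => b + τ) (by fun_prop)).add h2.1
  have hDr : (volume : Measure ℝ).restrict D = volume := by
    exact Measure.restrict_eq_self_of_ae_mem hDae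
  rw [hDr] at hcv
  have hYmeas : Measurable fun b => ENNReal.ofReal (deriv z b) * k (z b) := by
    have : Measurable z := hzm.monotone.measurable
    have := measurable_deriv z
    fun_prop
  have hfin := ae_lt_top hYmeas (ne_top_of_le_ne_top hk1 hcv)
  -- Cauchy-Schwarz in `b`; the second factor is at most `∫ k` by a change of variables along `z`.
  calc _ ≤ (∫⁻ b, H (b + τ) b) * ∫⁻ b, ENNReal.ofReal (deriv z b) * k (z b) := by
        refine lintegral_sq_le_of_sq_le_mul ?_ hYmeas.aemeasurable ?_
        · exact (hHmeas.comp (f := fun b : ℝ => (b + τ, b)) (by fun_prop)).aemeasurable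
        filter_upwards [hUτ, hV, hfin] with b ⟨h1, h2, h3⟩ ⟨h4, h5, h6⟩ h7
        have hdz : deriv z b = deriv U (b + τ) + deriv V b := by
          have h8 : HasDerivAt (fun b => U (b + τ)) (deriv U (b + τ)) b :=
            HasDerivAt.comp_add_const b τ h1.hasDerivAt
          exact (h8.add h4.hasDerivAt).deriv
        have hdU : 0 ≤ deriv U (b + τ) := hUm.monotone.deriv_nonneg
        have hdV : 0 ≤ deriv V b := hVm.monotone.deriv_nonneg
        have hkt : k (z b) ≠ ⊤ := by
          intro hk'
          rw [hk', hdz, ENNReal.ofReal_add hdU hdV] at h7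
          have : ENNReal.ofReal (deriv V b) ≠ 0 := fun h => he0 b (by rw [h6, h, mul_zero])
          rw [ENNReal.mul_top (by simp_all)] at h7
          exact lt_irrefl _ h7
        refine (ennreal_transport_amgm h3 h6).trans (le_of_eq ?_)
        have hkk : (k (z b))⁻¹ * k (z b) = 1 := ENNReal.inv_mul_cancel (hk0 _) hkt
        rw [hdz, ENNReal.ofReal_add hdU hdV]
        change _ = e (b + τ) * (e b * (_ / k (z b))) * _
        rw [ENNReal.div_eq_inv_mul]
        calc _ = e (b + τ) * e b * (u (U (b + τ)) ^ (1 / 2 : ℝ) * v (V b) ^ (1 / 2 : ℝ)) *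
              (ENNReal.ofReal (deriv U (b + τ)) + ENNReal.ofReal (deriv V b)) *
              ((k (z b))⁻¹ * k (z b)) := by rw [hkk, mul_one]
          _ = _ := by ring
    _ ≤ _ := by gcongr

theorem lintegral_gaussian {b : ℝ} (hb : 0 < b) :
    ∫⁻ x : ℝ, ENNReal.ofReal (Real.exp (-b * x ^ 2)) = ENNReal.ofReal (√(Real.pi / b)) := by
  rw [← ofReal_integral_eq_lintegral_ofReal (integrable_exp_neg_mul_sq hb)
    (ae_of_all _ fun x => (Real.exp_pos _).le), integral_gaussian]

/-- The sharp constant `8 / (3 √3)` comes from evaluating the transport bound on a Gaussian. -/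
theorem gaussian_reverse_young_constant :
    ∫⁻ τ : ℝ, (∫⁻ b : ℝ, 2 ^ (1 / 2 : ℝ) * (ENNReal.ofReal (Real.exp (-Real.pi * (b + τ) ^ 2)) *
      ENNReal.ofReal (Real.exp (-Real.pi * b ^ 2))) ^ (3 / 4 : ℝ)) ^ 2 =
      ENNReal.ofReal (8 / (3 * √3)) := by
  have hpi := Real.pi_pos
  have h1 : ∀ τ b : ℝ, (ENNReal.ofReal (Real.exp (-Real.pi * (b + τ) ^ 2)) *
      ENNReal.ofReal (Real.exp (-Real.pi * b ^ 2))) ^ (3 / 4 : ℝ) =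
      ENNReal.ofReal (Real.exp (-(3 * Real.pi / 8) * τ ^ 2)) *
      ENNReal.ofReal (Real.exp (-(3 * Real.pi / 2) * (b + τ / 2) ^ 2)) := by
    intro τ b
    rw [← ENNReal.ofReal_mul (Real.exp_pos _).le, ← ENNReal.ofReal_mul (Real.exp_pos _).le,
      ENNReal.ofReal_rpow_of_pos (by positivity), ← Real.exp_add, ← Real.exp_add, ← Real.exp_mul]
    congr 2
    ring
  have h2 : ∀ τ : ℝ, ∫⁻ b : ℝ, ENNReal.ofReal (Real.exp (-(3 * Real.pi / 2) * (b + τ / 2) ^ 2)) =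
      ENNReal.ofReal (√(2 / 3)) := by
    intro τ
    rw [lintegral_add_right_eq_self
      (fun b : ℝ => ENNReal.ofReal (Real.exp (-(3 * Real.pi / 2) * b ^ 2))) (τ / 2),
      lintegral_gaussian (by positivity)]
    congr 2
    field_simp
  have h3 : ∀ τ : ℝ, (ENNReal.ofReal (Real.exp (-(3 * Real.pi / 8) * τ ^ 2)) ^ 2) =
      ENNReal.ofReal (Real.exp (-(3 * Real.pi / 4) * τ ^ 2)) := fun τ => by
    rw [← ENNReal.ofReal_pow (Real.exp_pos _).le, ← Real.exp_nat_mul]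
    congr 2
    push_cast
    ring
  have h4 : ((2 : ENNReal) ^ (1 / 2 : ℝ)) ^ 2 = ENNReal.ofReal 2 := by
    rw [← ENNReal.rpow_natCast, ← ENNReal.rpow_mul]; norm_num
  simp only [h1]
  have h5 : ∀ τ : ℝ, (∫⁻ b : ℝ, 2 ^ (1 / 2 : ℝ) *
      (ENNReal.ofReal (Real.exp (-(3 * Real.pi / 8) * τ ^ 2)) *
      ENNReal.ofReal (Real.exp (-(3 * Real.pi / 2) * (b + τ / 2) ^ 2)))) ^ 2 =
      ENNReal.ofReal (4 / 3) * ENNReal.ofReal (Real.exp (-(3 * Real.pi / 4) * τ ^ 2)) := by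
    intro τ
    rw [lintegral_const_mul _ (by fun_prop), lintegral_const_mul _ (by fun_prop), h2, mul_pow,
      mul_pow, h3, h4, ← ENNReal.ofReal_pow (Real.sqrt_nonneg _), Real.sq_sqrt (by norm_num),
      mul_comm (ENNReal.ofReal (Real.exp _)), ← mul_assoc, ← ENNReal.ofReal_mul (by norm_num)]
    norm_num
  simp only [h5]
  rw [lintegral_const_mul _ (by fun_prop), lintegral_gaussian (by positivity),
    ← ENNReal.ofReal_mul (by norm_num)]
  congr 1
  have : √(Real.pi / (3 * Real.pi / 4)) = 2 / √3 := by
    rw [show Real.pi / (3 * Real.pi / 4) = 2 ^ 2 / 3 by field_simp; norm_num,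
      Real.sqrt_div (by norm_num), Real.sqrt_sq (by norm_num)]
  rw [this]
  field_simp
  norm_num

/-- The sharp reverse Young inequality on the line, in dual form: duality against `k` turns a lower
bound on a convolution into a lower bound on a double integral. -/
theorem reverse_young_real {u v k : ℝ → ENNReal} (hu : Measurable u) (hv : Measurable v)
    (hk : Measurable k) (hu1 : ∫⁻ x, u x ≠ ⊤) (hv1 : ∫⁻ x, v x ≠ ⊤) (hk0 : ∀ x, k x ≠ 0) :
    ENNReal.ofReal (8 / (3 * √3)) * (∫⁻ x, u x) ^ (3 / 2 : ℝ) * (∫⁻ x, v x) ^ (3 / 2 : ℝ) /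
      (∫⁻ t, k t) ≤ ∫⁻ x, ∫⁻ y, u x ^ (3 / 2 : ℝ) * v y ^ (3 / 2 : ℝ) / k (x + y) := by
  by_cases hk1 : ∫⁻ t, k t = ⊤
  · simp [hk1]
  by_cases hu0 : ∫⁻ x, u x = 0
  · simp [hu0]
  by_cases hv0 : ∫⁻ x, v x = 0
  · simp [hv0]
  have hkne : ∫⁻ t, k t ≠ 0 := by
    rw [ne_eq, lintegral_eq_zero_iff hk]
    intro h
    obtain ⟨x, hx⟩ := h.exists
    exact hk0 x hx
  set A := ∫⁻ x, u x with hA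
  set B := ∫⁻ x, v x with hB
  have hnorm : ∀ {w : ℝ → ENNReal}, Measurable w → ∫⁻ x, w x ≠ 0 → ∫⁻ x, w x ≠ ⊤ →
      ∫⁻ x, w x * (∫⁻ x, w x)⁻¹ = 1 := fun {w} hw h0 h1 => by
    rw [lintegral_mul_const _ hw, ENNReal.mul_inv_cancel h0 h1]
  have h := reverse_young_real_transport
    (e := fun x => ENNReal.ofReal (Real.exp (-Real.pi * x ^ 2))) (by fun_prop)
    (hu.mul_const A⁻¹) (hv.mul_const B⁻¹) hk
    (fun x => by simp [Real.exp_pos]) (by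
      rw [lintegral_gaussian Real.pi_pos, div_self Real.pi_pos.ne']; simp)
    (hnorm hu hu0 hu1) (hnorm hv hv0 hv1) hk0 hk1
  rw [gaussian_reverse_young_constant] at h
  have h32 : (0 : ℝ) ≤ 3 / 2 := by norm_num
  have hAne : A ^ (3 / 2 : ℝ) ≠ 0 := by simp [ENNReal.rpow_eq_zero_iff, hu0, h32]
  have hBne : B ^ (3 / 2 : ℝ) ≠ 0 := by simp [ENNReal.rpow_eq_zero_iff, hv0, h32]
  have hAt : A ^ (3 / 2 : ℝ) ≠ ⊤ := ENNReal.rpow_ne_top_of_nonneg h32 hu1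
  have hBt : B ^ (3 / 2 : ℝ) ≠ ⊤ := ENNReal.rpow_ne_top_of_nonneg h32 hv1
  have hscale : ∫⁻ x, ∫⁻ y, (u x * A⁻¹) ^ (3 / 2 : ℝ) * (v y * B⁻¹) ^ (3 / 2 : ℝ) / k (x + y) =
      (A ^ (3 / 2 : ℝ) * B ^ (3 / 2 : ℝ))⁻¹ *
        ∫⁻ x, ∫⁻ y, u x ^ (3 / 2 : ℝ) * v y ^ (3 / 2 : ℝ) / k (x + y) := by
    have hne : (A ^ (3 / 2 : ℝ) * B ^ (3 / 2 : ℝ))⁻¹ ≠ ⊤ :=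
      ENNReal.inv_ne_top.2 (mul_ne_zero hAne hBne)
    rw [← lintegral_const_mul' _ _ hne]
    refine lintegral_congr fun x => ?_
    rw [← lintegral_const_mul' _ _ hne]
    refine lintegral_congr fun y => ?_
    rw [ENNReal.mul_rpow_of_nonneg _ _ h32, ENNReal.mul_rpow_of_nonneg _ _ h32,
      ENNReal.inv_rpow, ENNReal.inv_rpow, ENNReal.mul_inv (Or.inl hAne) (Or.inl hAt)]
    simp only [ENNReal.div_eq_inv_mul]
    ring
  rw [hscale] at h
  rw [ENNReal.div_le_iff hkne hk1]
  calc _ ≤ (A ^ (3 / 2 : ℝ) * B ^ (3 / 2 : ℝ))⁻¹ *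
        (∫⁻ x, ∫⁻ y, u x ^ (3 / 2 : ℝ) * v y ^ (3 / 2 : ℝ) / k (x + y)) * (∫⁻ t, k t) *
        A ^ (3 / 2 : ℝ) * B ^ (3 / 2 : ℝ) := by gcongr
    _ = ((A ^ (3 / 2 : ℝ) * B ^ (3 / 2 : ℝ))⁻¹ * (A ^ (3 / 2 : ℝ) * B ^ (3 / 2 : ℝ))) *
        ((∫⁻ x, ∫⁻ y, u x ^ (3 / 2 : ℝ) * v y ^ (3 / 2 : ℝ) / k (x + y)) * (∫⁻ t, k t)) := by
        ring
    _ = _ := by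
      rw [ENNReal.inv_mul_cancel (mul_ne_zero hAne hBne) (ENNReal.mul_ne_top hAt hBt), one_mul]

/-- Fubini, with the first coordinate split off. -/
theorem lintegral_fin_cons {n : ℕ} {f : (Fin (n + 1) → ℝ) → ENNReal} (hf : Measurable f) :
    ∫⁻ x, f x = ∫⁻ s : ℝ, ∫⁻ w : Fin n → ℝ, f (Fin.cons s w) := by
  have h := (volume_preserving_piFinSuccAbove (fun _ : Fin (n + 1) => ℝ) 0).symm
  rw [← h.lintegral_comp hf]
  rw [Measure.volume_eq_prod, lintegral_prod _ (by fun_prop)]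
  simp [MeasurableEquiv.piFinSuccAbove_symm_apply, Fin.insertNthEquiv]

/-- The sharp reverse Young inequality on `ℝ ^ n`, in dual form. The inequality tensorizes: the
one-dimensional case is applied to the integrals over slices, and the case of dimension `n` to the
slices. -/
theorem reverse_young (n : ℕ) {u v k : (Fin n → ℝ) → ENNReal} (hu : Measurable u)
    (hv : Measurable v) (hk : Measurable k) (hu1 : ∫⁻ x, u x ≠ ⊤) (hv1 : ∫⁻ x, v x ≠ ⊤)
    (hk0 : ∀ x, k x ≠ 0) :
    ENNReal.ofReal (8 / (3 * √3)) ^ n * (∫⁻ x, u x) ^ (3 / 2 : ℝ) * (∫⁻ x, v x) ^ (3 / 2 : ℝ) /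
      (∫⁻ t, k t) ≤ ∫⁻ x, ∫⁻ y, u x ^ (3 / 2 : ℝ) * v y ^ (3 / 2 : ℝ) / k (x + y) := by
  induction n with
  | zero =>
    have h : (volume : Measure (Fin 0 → ℝ)) = Measure.dirac default :=
      Measure.volume_pi_eq_dirac default
    rw [h]
    simp only [lintegral_dirac, pow_zero, one_mul]
    rw [Subsingleton.elim (default + default) (default : Fin 0 → ℝ)]
  | succ n ih =>
    have hcons : Measurable fun p : ℝ × (Fin n → ℝ) => (Fin.cons p.1 p.2 : Fin (n + 1) → ℝ) := by
      have h := (MeasurableEquiv.piFinSuccAbove (fun _ : Fin (n + 1) => ℝ) 0).symm.measurable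
      simpa [MeasurableEquiv.piFinSuccAbove_symm_apply, Fin.insertNthEquiv] using h
    have hcons1 : ∀ s : ℝ, Measurable fun w : Fin n → ℝ => (Fin.cons s w : Fin (n + 1) → ℝ) :=
      fun s => hcons.comp (by fun_prop : Measurable fun w : Fin n → ℝ => (s, w))
    have hslice : ∀ {f : (Fin (n + 1) → ℝ) → ENNReal}, Measurable f →
        Measurable fun s : ℝ => ∫⁻ w : Fin n → ℝ, f (Fin.cons s w) := fun {f} hf =>
      Measurable.lintegral_prod_right' (f := fun p : ℝ × (Fin n → ℝ) => f (Fin.cons p.1 p.2))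
        (hf.comp hcons)
    have hFmeas : Measurable fun p : (Fin (n + 1) → ℝ) × (Fin (n + 1) → ℝ) =>
        u p.1 ^ (3 / 2 : ℝ) * v p.2 ^ (3 / 2 : ℝ) / k (p.1 + p.2) := by fun_prop
    have hadd : ∀ (s t : ℝ) (w x : Fin n → ℝ), (Fin.cons s w + Fin.cons t x : Fin (n + 1) → ℝ) =
        Fin.cons (s + t) (w + x) := fun s t w x => by
      ext i; refine Fin.cases ?_ (fun i => ?_) i <;> simp
    have hsplit : ∫⁻ x, ∫⁻ y, u x ^ (3 / 2 : ℝ) * v y ^ (3 / 2 : ℝ) / k (x + y) =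
        ∫⁻ s : ℝ, ∫⁻ t : ℝ, ∫⁻ w : Fin n → ℝ, ∫⁻ x : Fin n → ℝ, u (Fin.cons s w) ^ (3 / 2 : ℝ) *
          v (Fin.cons t x) ^ (3 / 2 : ℝ) / k (Fin.cons (s + t) (w + x)) := by
      rw [lintegral_fin_cons (f := fun x => ∫⁻ y, u x ^ (3 / 2 : ℝ) * v y ^ (3 / 2 : ℝ) / k (x + y))
        hFmeas.lintegral_prod_right']
      refine lintegral_congr fun s => ?_
      symm
      rw [lintegral_lintegral_swap]
      · refine lintegral_congr fun w => ?_
        rw [lintegral_fin_cons (by fun_prop)]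
        simp only [hadd]
      · refine (Measurable.lintegral_prod_right' (f := fun q : (ℝ × (Fin n → ℝ)) × (Fin n → ℝ) =>
          u (Fin.cons s q.1.2) ^ (3 / 2 : ℝ) * v (Fin.cons q.1.1 q.2) ^ (3 / 2 : ℝ) /
            k (Fin.cons (s + q.1.1) (q.1.2 + q.2))) ?_).aemeasurable
        have m1 := hcons1 s
        have m2 : Measurable fun q : (ℝ × (Fin n → ℝ)) × (Fin n → ℝ) =>
            (Fin.cons q.1.1 q.2 : Fin (n + 1) → ℝ) :=
          hcons.comp (g := fun p : ℝ × (Fin n → ℝ) => (Fin.cons p.1 p.2 : Fin (n + 1) → ℝ))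
            (f := fun q : (ℝ × (Fin n → ℝ)) × (Fin n → ℝ) => (q.1.1, q.2)) (by fun_prop)
        have m3 : Measurable fun q : (ℝ × (Fin n → ℝ)) × (Fin n → ℝ) =>
            (Fin.cons (s + q.1.1) (q.1.2 + q.2) : Fin (n + 1) → ℝ) :=
          hcons.comp (g := fun p : ℝ × (Fin n → ℝ) => (Fin.cons p.1 p.2 : Fin (n + 1) → ℝ))
            (f := fun q : (ℝ × (Fin n → ℝ)) × (Fin n → ℝ) => (s + q.1.1, q.1.2 + q.2))
            (by fun_prop)
        exact (((hu.comp (m1.comp (by fun_prop))).pow_const _).mul ((hv.comp m2).pow_const _)).div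
          (hk.comp m3)
    have hfin : ∀ {f : (Fin (n + 1) → ℝ) → ENNReal}, Measurable f → ∫⁻ x, f x ≠ ⊤ →
        ∀ᵐ s : ℝ, ∫⁻ w : Fin n → ℝ, f (Fin.cons s w) ≠ ⊤ := fun {f} hf h => by
      rw [lintegral_fin_cons hf] at h
      filter_upwards [ae_lt_top (hslice hf) h] with s hs using hs.ne
    have hpos : ∀ s : ℝ, ∫⁻ w : Fin n → ℝ, k (Fin.cons s w) ≠ 0 := fun s => by
      rw [ne_eq, lintegral_eq_zero_iff (f := fun w : Fin n → ℝ => k (Fin.cons s w))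
        (hk.comp (hcons1 s))]
      intro h
      obtain ⟨x, hx⟩ := h.exists
      exact hk0 _ hx
    rw [hsplit]
    calc _ = ENNReal.ofReal (8 / (3 * √3)) ^ n * (ENNReal.ofReal (8 / (3 * √3)) *
          (∫⁻ s : ℝ, ∫⁻ w : Fin n → ℝ, u (Fin.cons s w)) ^ (3 / 2 : ℝ) *
          (∫⁻ s : ℝ, ∫⁻ w : Fin n → ℝ, v (Fin.cons s w)) ^ (3 / 2 : ℝ) /
          ∫⁻ s : ℝ, ∫⁻ w : Fin n → ℝ, k (Fin.cons s w)) := by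
          rw [lintegral_fin_cons hu, lintegral_fin_cons hv, lintegral_fin_cons hk]
          simp only [ENNReal.div_eq_inv_mul]
          ring
      _ ≤ ENNReal.ofReal (8 / (3 * √3)) ^ n * ∫⁻ s : ℝ, ∫⁻ t : ℝ,
          (∫⁻ w : Fin n → ℝ, u (Fin.cons s w)) ^ (3 / 2 : ℝ) *
          (∫⁻ w : Fin n → ℝ, v (Fin.cons t w)) ^ (3 / 2 : ℝ) /
          ∫⁻ w : Fin n → ℝ, k (Fin.cons (s + t) w) := by
          gcongr
          refine reverse_young_real (hslice hu) (hslice hv) (hslice hk) ?_ ?_ hpos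
          · rwa [← lintegral_fin_cons hu]
          · rwa [← lintegral_fin_cons hv]
      _ = ∫⁻ s : ℝ, ∫⁻ t : ℝ, ENNReal.ofReal (8 / (3 * √3)) ^ n *
          (∫⁻ w : Fin n → ℝ, u (Fin.cons s w)) ^ (3 / 2 : ℝ) *
          (∫⁻ w : Fin n → ℝ, v (Fin.cons t w)) ^ (3 / 2 : ℝ) /
          ∫⁻ w : Fin n → ℝ, k (Fin.cons (s + t) w) := by
          have hne : ENNReal.ofReal (8 / (3 * √3)) ^ n ≠ ⊤ :=
            ENNReal.pow_ne_top ENNReal.ofReal_ne_top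
          rw [← lintegral_const_mul' _ _ hne]
          refine lintegral_congr fun s => ?_
          rw [← lintegral_const_mul' _ _ hne]
          refine lintegral_congr fun t => ?_
          simp only [ENNReal.div_eq_inv_mul]
          ring
      _ ≤ _ := by
          refine lintegral_mono_ae ?_
          filter_upwards [hfin hu hu1] with s hs
          refine lintegral_mono_ae ?_
          filter_upwards [hfin hv hv1] with t ht
          exact ih (hu.comp (hcons1 s)) (hv.comp (hcons1 t)) (hk.comp (hcons1 _)) hs ht
            fun x => hk0 _

/-! ### Poisson approximation for dissociated events -/

theorem abs_pow_add_sub_pow_le {z : ℝ} (hz0 : 0 ≤ z) (hz1 : z ≤ 1) (a b : ℕ) :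
    |z ^ (a + b) - z ^ a| ≤ b := by
  rcases Nat.eq_zero_or_pos b with rfl | hb
  · simp
  · have h1 : z ^ (a + b) ≤ z ^ a := pow_le_pow_of_le_one hz0 hz1 (by omega)
    have h2 : z ^ a ≤ 1 := pow_le_one₀ hz0 hz1
    have h3 : 0 ≤ z ^ (a + b) := by positivity
    have h4 : (1 : ℝ) ≤ b := by exact_mod_cast hb
    rw [abs_le]
    constructor <;> linarith

/-- Poisson approximation of the probability that none of finitely many locally dependent rare
events occurs. Each event `A α` is independent of the number of events that occur outside its
neighbourhood `Nb α`. -/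
theorem abs_measureReal_none_sub_exp_le {Ω ι : Type*} [DecidableEq ι] [MeasurableSpace Ω]
    {P : Measure Ω} [IsProbabilityMeasure P] (I : Finset ι) (Nb : ι → Finset ι)
    (hself : ∀ α ∈ I, α ∈ Nb α) (hNb : ∀ α ∈ I, Nb α ⊆ I) (A : ι → Set Ω)
    (hA : ∀ α, MeasurableSet (A α))
    (hind : ∀ α ∈ I, IndepFun ((A α).indicator (fun _ => (1 : ℕ)))
      (fun ω => ∑ β ∈ I \ Nb α, (A β).indicator (fun _ => (1 : ℕ)) ω) P) :
    |P.real (⋂ α ∈ I, (A α)ᶜ) - Real.exp (-∑ α ∈ I, P.real (A α))| ≤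
      ∑ α ∈ I, (∑ β ∈ Nb α \ {α}, P.real (A α ∩ A β) +
        P.real (A α) * ∑ β ∈ Nb α, P.real (A β)) := by
  set X : ι → Ω → ℕ := fun α => (A α).indicator (fun _ => (1 : ℕ)) with hX
  have hXm : ∀ α, Measurable (X α) := fun α => measurable_const.indicator (hA α)
  have hX1 : ∀ α ω, X α ω ≤ 1 := fun α ω => by
    by_cases h : ω ∈ A α <;> simp [hX, h]
  set S : Finset ι → Ω → ℕ := fun J ω => ∑ β ∈ J, X β ω with hS
  have hSm : ∀ J, Measurable (S J) := fun J => Finset.measurable_sum _ fun i _ => hXm i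
  have hSle : ∀ J ω, S J ω ≤ J.card := fun J ω => by
    simpa using Finset.sum_le_sum (s := J) fun i _ => hX1 i ω
  have hint : ∀ f : Ω → ℝ, Measurable f → ∀ C : ℝ, (∀ ω, |f ω| ≤ C) → Integrable f P :=
    fun f hf C hC => Integrable.of_bound hf.aestronglyMeasurable C (ae_of_all _ hC)
  have hXr : ∀ α, ∫ ω, (X α ω : ℝ) ∂P = P.real (A α) := fun α => by
    have : (fun ω => (X α ω : ℝ)) = (A α).indicator 1 := by
      ext ω; by_cases h : ω ∈ A α <;> simp [hX, h]
    rw [this, integral_indicator_one (hA α)]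
  have hXX : ∀ α β, ∫ ω, (X α ω : ℝ) * X β ω ∂P = P.real (A α ∩ A β) := fun α β => by
    have : (fun ω => (X α ω : ℝ) * X β ω) = (A α ∩ A β).indicator 1 := by
      ext ω
      by_cases h1 : ω ∈ A α <;> by_cases h2 : ω ∈ A β <;> simp [hX, h1, h2]
    rw [this, integral_indicator_one ((hA α).inter (hA β))]
  have hXi : ∀ α, Integrable (fun ω => (X α ω : ℝ)) P := fun α =>
    hint _ (by have := hXm α; fun_prop) 1 fun ω => by
      rw [abs_of_nonneg (by positivity)]; exact_mod_cast hX1 α ω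
  have hXXi : ∀ α β, Integrable (fun ω => (X α ω : ℝ) * X β ω) P := fun α β =>
    hint _ (by have := hXm α; have := hXm β; fun_prop) 1 fun ω => by
      rw [abs_of_nonneg (by positivity)]
      exact_mod_cast Nat.mul_le_mul (hX1 α ω) (hX1 β ω)
  have hpow1 : ∀ {z : ℝ}, 0 ≤ z → z ≤ 1 → ∀ n : ℕ, |z ^ n| ≤ 1 := fun {z} h0 h1 n => by
    rw [abs_of_nonneg (by positivity)]; exact pow_le_one₀ h0 h1
  have hpowm : ∀ (z : ℝ) (f : Ω → ℕ), Measurable f → Measurable fun ω => z ^ f ω := fun z f hf =>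
    (measurable_from_nat (f := fun n : ℕ => z ^ n)).comp hf
  have hpowi : ∀ {z : ℝ}, 0 ≤ z → z ≤ 1 → ∀ f : Ω → ℕ, Measurable f →
      Integrable (fun ω => z ^ f ω) P := fun {z} h0 h1 f hf =>
    hint _ (hpowm z f hf) 1 fun ω => hpow1 h0 h1 _
  -- The probability generating function `G` of the number of events nearly satisfies the
  -- differential equation `deriv G = lam * G` of the Poisson law on `[0, 1]`, with error `ε`; the
  -- comparison of `G 0` with `exp (-lam)` then follows from the mean value inequality.
  set G : ℝ → ℝ := fun z => ∫ ω, z ^ S I ω ∂P with hG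
  set lam := ∑ α ∈ I, P.real (A α) with hlam
  set ε := ∑ α ∈ I, (∑ β ∈ Nb α \ {α}, P.real (A α ∩ A β) +
        P.real (A α) * ∑ β ∈ Nb α, P.real (A β)) with hε
  have hderiv : ∀ z : ℝ, HasDerivAt G (∫ ω, (S I ω : ℝ) * z ^ (S I ω - 1) ∂P) z := by
    intro z
    refine (hasDerivAt_integral_of_dominated_loc_of_deriv_le (μ := P)
      (F := fun z ω => z ^ S I ω) (F' := fun z ω => (S I ω : ℝ) * z ^ (S I ω - 1))
      (bound := fun _ => (I.card : ℝ) * (|z| + 2) ^ I.card) (Metric.ball_mem_nhds z one_pos)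
      (Eventually.of_forall fun w => (hpowm w _ (hSm I)).aestronglyMeasurable) ?_
      ?_ (ae_of_all _ fun ω w hw => ?_) (integrable_const _)
      (ae_of_all _ fun ω w hw => hasDerivAt_pow _ _)).2
    · refine hint _ (hpowm z _ (hSm I)) ((|z| + 2) ^ I.card) fun ω => ?_
      rw [abs_pow]
      exact (pow_le_pow_left₀ (abs_nonneg _) (by linarith [abs_nonneg z]) _).trans
        (pow_le_pow_right₀ (by linarith [abs_nonneg z]) (hSle I ω))
    · exact ((measurable_from_nat (f := fun n : ℕ => (n : ℝ) * z ^ (n - 1))).comp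
        (hSm I)).aestronglyMeasurable
    · rw [norm_mul, norm_pow, Real.norm_eq_abs, Real.norm_eq_abs, Nat.abs_cast]
      have hw' : |w| ≤ |z| + 2 := by
        rw [Metric.mem_ball, Real.dist_eq] at hw
        have := abs_sub_abs_le_abs_sub w z
        linarith
      have : |w| ^ (S I ω - 1) ≤ (|z| + 2) ^ I.card :=
        (pow_le_pow_left₀ (abs_nonneg _) hw' _).trans
        (pow_le_pow_right₀ (by linarith [abs_nonneg z]) ((Nat.sub_le _ _).trans (hSle I ω)))
      have h2 : (S I ω : ℝ) ≤ I.card := by exact_mod_cast hSle I ω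
      gcongr
  have hbound : ∀ z : ℝ, 0 ≤ z → z ≤ 1 →
      |(∫ ω, (S I ω : ℝ) * z ^ (S I ω - 1) ∂P) - lam * G z| ≤ ε := by
    intro z h0 h1
    have hmain : ∀ α ∈ I, |(∫ ω, (X α ω : ℝ) * z ^ (S I ω - 1) ∂P) - P.real (A α) * G z| ≤
        ∑ β ∈ Nb α \ {α}, P.real (A α ∩ A β) + P.real (A α) * ∑ β ∈ Nb α, P.real (A β) := by
      intro α hα
      -- `V` counts the events outside the neighbourhood of `α`, and is independent of `X α`.
      set V := S (I \ Nb α) with hV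
      have hsplit : ∀ ω, S I ω = V ω + S (Nb α) ω := fun ω =>
        (Finset.sum_sdiff (hNb α hα)).symm
      have hsplit' : ∀ ω, S (Nb α) ω = S (Nb α \ {α}) ω + X α ω := fun ω => by
        rw [hS]
        simp only
        rw [← Finset.sum_sdiff (Finset.singleton_subset_iff.2 (hself α hα)), Finset.sum_singleton]
      have hVX : ∫ ω, (X α ω : ℝ) * z ^ V ω ∂P = P.real (A α) * ∫ ω, z ^ V ω ∂P := by
        rw [← hXr α]
        exact ((hind α hα).comp (measurable_from_nat (f := fun n : ℕ => (n : ℝ)))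
          (measurable_from_nat (f := fun n : ℕ => z ^ n))).integral_fun_mul_eq_mul_integral
            ((measurable_from_nat (f := fun n : ℕ => (n : ℝ))).comp (hXm α)).aestronglyMeasurable
            (hpowm z V (hSm _)).aestronglyMeasurable
      have hi : ∀ f : Ω → ℕ, Measurable f → Integrable (fun ω => (X α ω : ℝ) * z ^ f ω) P :=
        fun f hf => hint _ (by
          have := hXm α; have := hpowm z f hf; fun_prop) 1 fun ω => by
          rw [abs_mul]
          have := hpow1 h0 h1 (f ω)
          have h2 : |(X α ω : ℝ)| ≤ 1 := by
            rw [Nat.abs_cast]; exact_mod_cast hX1 α ω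
          exact mul_le_one₀ h2 (abs_nonneg _) this
      have e1 : |(∫ ω, (X α ω : ℝ) * z ^ (S I ω - 1) ∂P) - ∫ ω, (X α ω : ℝ) * z ^ V ω ∂P| ≤
          ∑ β ∈ Nb α \ {α}, P.real (A α ∩ A β) := by
        rw [← integral_sub (hi (fun ω => S I ω - 1)
          ((measurable_from_nat (f := fun n : ℕ => n - 1)).comp (hSm I)))
          (hi _ (hSm _))]
        calc _ ≤ ∫ ω, ∑ β ∈ Nb α \ {α}, (X α ω : ℝ) * X β ω ∂P := by
              refine abs_integral_le_integral_abs.trans (integral_mono_of_nonneg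
                (ae_of_all _ fun _ => abs_nonneg _) (integrable_finsetSum _ fun β _ => hXXi α β)
                (ae_of_all _ fun ω => ?_))
              simp only
              rw [← mul_sub, abs_mul, ← Finset.mul_sum, Nat.abs_cast]
              rcases Nat.eq_zero_or_pos (X α ω) with hz | hz
              · simp [hz]
              · have hx1 : X α ω = 1 := le_antisymm (hX1 α ω) hz
                have : S I ω - 1 = V ω + S (Nb α \ {α}) ω := by
                  have := hsplit ω; have := hsplit' ω; omega
                rw [this, hx1]
                have h3 := abs_pow_add_sub_pow_le h0 h1 (V ω) (S (Nb α \ {α}) ω)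
                simp only [hS] at h3 ⊢
                push_cast at h3 ⊢
                simpa using h3
          _ = _ := by
              rw [integral_finsetSum _ fun β _ => hXXi α β]
              simp only [hXX]
      have e2 : |(∫ ω, z ^ V ω ∂P) - G z| ≤ ∑ β ∈ Nb α, P.real (A β) := by
        rw [hG, ← integral_sub (hpowi h0 h1 _ (hSm _)) (hpowi h0 h1 _ (hSm _))]
        calc _ ≤ ∫ ω, ∑ β ∈ Nb α, (X β ω : ℝ) ∂P := by
              refine abs_integral_le_integral_abs.trans (integral_mono_of_nonneg
                (ae_of_all _ fun _ => abs_nonneg _) (integrable_finsetSum _ fun β _ => hXi β)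
                (ae_of_all _ fun ω => ?_))
              simp only
              rw [hsplit ω, abs_sub_comm]
              have h3 := abs_pow_add_sub_pow_le h0 h1 (V ω) (S (Nb α) ω)
              simp only [hS] at h3 ⊢
              push_cast at h3
              exact h3
          _ = _ := by
              rw [integral_finsetSum _ fun β _ => hXi β]
              simp only [hXr]
      have e3 : (∫ ω, (X α ω : ℝ) * z ^ (S I ω - 1) ∂P) - P.real (A α) * G z =
          ((∫ ω, (X α ω : ℝ) * z ^ (S I ω - 1) ∂P) - ∫ ω, (X α ω : ℝ) * z ^ V ω ∂P) +
          P.real (A α) * ((∫ ω, z ^ V ω ∂P) - G z) := by rw [hVX]; ring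
      rw [e3]
      refine (abs_add_le _ _).trans (add_le_add e1 ?_)
      rw [abs_mul, abs_of_nonneg measureReal_nonneg]
      exact mul_le_mul_of_nonneg_left e2 measureReal_nonneg
    have hexp : ∫ ω, (S I ω : ℝ) * z ^ (S I ω - 1) ∂P =
        ∑ α ∈ I, ∫ ω, (X α ω : ℝ) * z ^ (S I ω - 1) ∂P := by
      rw [← integral_finsetSum]
      · refine integral_congr_ae (ae_of_all _ fun ω => ?_)
        simp only
        rw [← Finset.sum_mul, hS]
        push_cast
        rfl
      · intro α _
        refine hint _ ?_ 1 fun ω => ?_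
        · have := hXm α
          have := hpowm z _ ((measurable_from_nat (f := fun n : ℕ => n - 1)).comp (hSm I))
          simp only [Function.comp_apply] at this
          fun_prop
        · rw [abs_mul]
          have := hpow1 h0 h1 (S I ω - 1)
          have h2 : |(X α ω : ℝ)| ≤ 1 := by
            rw [Nat.abs_cast]; exact_mod_cast hX1 α ω
          exact mul_le_one₀ h2 (abs_nonneg _) this
    rw [hexp, hlam, Finset.sum_mul, ← Finset.sum_sub_distrib]
    exact (Finset.abs_sum_le_sum_abs _ _).trans (Finset.sum_le_sum hmain)
  have hlam0 : 0 ≤ lam := Finset.sum_nonneg fun _ _ => measureReal_nonneg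
  have hε0 : 0 ≤ ε := (abs_nonneg _).trans (hbound 0 le_rfl zero_le_one)
  have hH : ∀ z : ℝ, HasDerivAt (fun z => G z * Real.exp (-lam * z))
      (((∫ ω, (S I ω : ℝ) * z ^ (S I ω - 1) ∂P) - lam * G z) * Real.exp (-lam * z)) z := by
    intro z
    have h2 : HasDerivAt (fun z : ℝ => Real.exp (-lam * z)) (Real.exp (-lam * z) * (-lam)) z := by
      simpa using ((hasDerivAt_id z).const_mul (-lam)).exp
    exact ((hderiv z).fun_mul h2).congr_deriv (by ring)
  have hmv := (convex_Icc (0 : ℝ) 1).norm_image_sub_le_of_norm_hasDerivWithin_le (C := ε)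
    (fun z _ => (hH z).hasDerivWithinAt) (fun z hz => by
      rw [norm_mul, Real.norm_eq_abs, Real.norm_eq_abs, Real.abs_exp]
      have h2 : Real.exp (-lam * z) ≤ 1 := by
        rw [Real.exp_le_one_iff]; nlinarith [hz.1]
      calc _ ≤ ε * 1 := mul_le_mul (hbound z hz.1 hz.2) h2 (Real.exp_pos _).le hε0
        _ = ε := mul_one _) (Set.right_mem_Icc.2 zero_le_one) (Set.left_mem_Icc.2 zero_le_one)
  have hG1 : G 1 = 1 := by simp [hG]
  have hG0 : G 0 = P.real (⋂ α ∈ I, (A α)ᶜ) := by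
    have hm : MeasurableSet (⋂ α ∈ I, (A α)ᶜ) :=
      I.measurableSet_biInter fun α _ => (hA α).compl
    rw [← integral_indicator_one hm, hG]
    refine integral_congr_ae (ae_of_all _ fun ω => ?_)
    by_cases h : ω ∈ ⋂ α ∈ I, (A α)ᶜ
    · have : S I ω = 0 := Finset.sum_eq_zero fun α hα => by
        simp only [Set.mem_iInter] at h
        simpa [hX] using h α hα
      simp [this, Set.indicator_of_mem h]
    · have : S I ω ≠ 0 := fun h0 => h <| by
        simp only [Set.mem_iInter]
        intro α hα hmem
        have := Finset.sum_eq_zero_iff.1 h0 α hα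
        simp [hX, hmem] at this
      simp [this, Set.indicator_of_notMem h]
  simp only [hG1, hG0, one_mul, mul_one, mul_zero, Real.exp_zero] at hmv
  simpa using hmv

/-! ### Triples of independent points -/

/-- The increasing triples of indices below `n`, as a finite set. -/
def triplesFinset (n : ℕ) : Finset (ℕ × ℕ × ℕ) :=
  (Finset.range n ×ˢ Finset.range n ×ˢ Finset.range n).filter
    fun t => t.1 < t.2.1 ∧ t.2.1 < t.2.2

theorem mem_triplesFinset {n : ℕ} {t : ℕ × ℕ × ℕ} :
    t ∈ triplesFinset n ↔ t.1 < t.2.1 ∧ t.2.1 < t.2.2 ∧ t.2.2 < n := by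
  simp only [triplesFinset, Finset.mem_filter, Finset.mem_product, Finset.mem_range]
  omega

theorem card_triplesFinset (n : ℕ) :
    ((triplesFinset n).card : ℝ) = n * (n - 1) * (n - 2) / 6 := by
  have hpairs : ∀ n : ℕ, ((((Finset.range n ×ˢ Finset.range n).filter
      fun t => t.1 < t.2).card : ℕ) : ℝ) = n * (n - 1) / 2 := by
    intro n
    induction n with
    | zero => simp
    | succ n ih =>
      have : (Finset.range (n + 1) ×ˢ Finset.range (n + 1)).filter (fun t => t.1 < t.2) =
          ((Finset.range n ×ˢ Finset.range n).filter fun t => t.1 < t.2) ∪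
          (Finset.range n).image fun i => (i, n) := by
        ext ⟨i, j⟩
        simp only [Finset.mem_filter, Finset.mem_product, Finset.mem_range, Finset.mem_union,
          Finset.mem_image, Prod.mk.injEq]
        constructor
        · intro h
          by_cases hj : j = n
          · exact Or.inr ⟨i, by omega, rfl, hj.symm⟩
          · left; omega
        · rintro (h | ⟨k, h1, h2, h3⟩) <;> omega
      rw [this, Finset.card_union_of_disjoint, Finset.card_image_of_injective _
        fun i j h => (Prod.ext_iff.1 h).1, Finset.card_range]
      · push_cast
        rw [ih]
        ring
      · rw [Finset.disjoint_left]
        rintro ⟨i, j⟩ h1 h2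
        simp only [Finset.mem_filter, Finset.mem_product, Finset.mem_range,
          Finset.mem_image, Prod.mk.injEq] at h1 h2
        obtain ⟨k, hk⟩ := h2
        omega
  induction n with
  | zero => simp [triplesFinset]
  | succ n ih =>
    have : triplesFinset (n + 1) = triplesFinset n ∪
        ((Finset.range n ×ˢ Finset.range n).filter fun t => t.1 < t.2).image
          fun t => (t.1, t.2, n) := by
      ext ⟨i, j, k⟩
      simp only [mem_triplesFinset, Finset.mem_union, Finset.mem_image, Finset.mem_filter,
        Finset.mem_product, Finset.mem_range, Prod.mk.injEq,
        Prod.exists]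
      constructor
      · intro h
        by_cases hk : k = n
        · exact Or.inr ⟨i, j, by omega, rfl, rfl, hk.symm⟩
        · left; omega
      · rintro (h | ⟨a, b, h1, h2, h3, h4⟩) <;> omega
    rw [this, Finset.card_union_of_disjoint, Finset.card_image_of_injective _ fun s t h => by
      simp only [Prod.mk.injEq] at h
      exact Prod.ext h.1 h.2.1]
    · push_cast
      rw [ih, hpairs]
      ring
    · rw [Finset.disjoint_left]
      rintro ⟨i, j, k⟩ h1 h2
      simp only [mem_triplesFinset, Finset.mem_image, Finset.mem_filter,
        Finset.mem_product, Finset.mem_range, Prod.mk.injEq,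
        Prod.exists] at h1 h2
      obtain ⟨a, b, h⟩ := h2
      omega

/-- The set of indices of a triple. -/
def tripleSupport (t : ℕ × ℕ × ℕ) : Finset ℕ := {t.1, t.2.1, t.2.2}

/-- The triples below `n` that share an index with the triple `t`. -/
def triplesMeeting (n : ℕ) (t : ℕ × ℕ × ℕ) : Finset (ℕ × ℕ × ℕ) :=
  (triplesFinset n).filter fun s => ¬ Disjoint (tripleSupport t) (tripleSupport s)

theorem card_triplesMeeting_le (n : ℕ) (t : ℕ × ℕ × ℕ) :
    (triplesMeeting n t).card ≤ 9 * n ^ 2 := by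
  have hsub : triplesMeeting n t ⊆ (tripleSupport t).biUnion fun i =>
      ({i} ×ˢ Finset.range n ×ˢ Finset.range n) ∪
      ((Finset.range n ×ˢ {i} ×ˢ Finset.range n) ∪
      (Finset.range n ×ˢ Finset.range n ×ˢ {i})) := by
    rintro ⟨a, b, c⟩ h
    simp only [triplesMeeting, Finset.mem_filter, mem_triplesFinset, Finset.not_disjoint_iff] at h
    obtain ⟨⟨h1, h2, h3⟩, i, hi, hi'⟩ := h
    simp only [Finset.mem_biUnion, Finset.mem_union, Finset.mem_product, Finset.mem_singleton,
      Finset.mem_range]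
    refine ⟨i, hi, ?_⟩
    simp only [tripleSupport, Finset.mem_insert, Finset.mem_singleton] at hi'
    omega
  refine (Finset.card_le_card hsub).trans ((Finset.card_biUnion_le_card_mul _ _ (3 * n ^ 2)
    fun i _ => ?_).trans ?_)
  · refine (Finset.card_union_le _ _).trans ?_
    refine (Nat.add_le_add_left (Finset.card_union_le _ _) _).trans (le_of_eq ?_)
    simp only [Finset.card_product, Finset.card_singleton, Finset.card_range]
    ring
  · have : (tripleSupport t).card ≤ 3 := Finset.card_le_three
    nlinarith [sq_nonneg n]

theorem exists_mem_tripleSupport_notMem {n : ℕ} {s t : ℕ × ℕ × ℕ} (hs : s ∈ triplesFinset n)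
    (ht : t ∈ triplesFinset n) (hst : s ≠ t) : ∃ l ∈ tripleSupport s, l ∉ tripleSupport t := by
  by_contra! h
  rw [mem_triplesFinset] at hs ht
  obtain ⟨a, b, c⟩ := s
  obtain ⟨x, y, z⟩ := t
  simp only [tripleSupport, Finset.mem_insert, Finset.mem_singleton, forall_eq_or_imp,
    forall_eq] at h hs ht
  refine hst ?_
  simp only [Prod.mk.injEq]
  omega

section
variable {Ω E : Type*} [MeasurableSpace Ω] [MeasurableSpace E]

/-- If every section of `C` has mass at most `q` for the law of `X`, and `X` is independent of `Y`,
then the event `(Y, X) ∈ C` has conditional probability at most `q` given any event about `Y`. -/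
theorem measureReal_inter_le_of_indepFun {T : Type*} [MeasurableSpace T] {Pr : Measure Ω}
    [IsProbabilityMeasure Pr] {μ : Measure E} [IsProbabilityMeasure μ] {X : Ω → E} {Y : Ω → T}
    (hX : Measurable X) (hY : Measurable Y) (hXY : IndepFun Y X Pr) (hlaw : Pr.map X = μ)
    {G : Set T} (hG : MeasurableSet G) {C : Set (T × E)} (hC : MeasurableSet C) {q : ℝ}
    (hq : ∀ y, μ.real {x | (y, x) ∈ C} ≤ q) :
    Pr.real ({ω | Y ω ∈ G} ∩ {ω | (Y ω, X ω) ∈ C}) ≤ q * Pr.real {ω | Y ω ∈ G} := by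
  obtain ⟨ω₀⟩ : Nonempty Ω := Pr.nonempty_of_neZero
  have hq0 : 0 ≤ q := measureReal_nonneg.trans (hq (Y ω₀))
  have hmap : Pr.map (fun ω => (Y ω, X ω)) = (Pr.map Y).prod μ := by
    rw [← hlaw]
    exact (indepFun_iff_map_prod_eq_prod_map_map hY.aemeasurable hX.aemeasurable).1 hXY
  have hD : MeasurableSet ((Prod.fst ⁻¹' G) ∩ C : Set (T × E)) := (measurable_fst hG).inter hC
  have h1 : Pr ({ω | Y ω ∈ G} ∩ {ω | (Y ω, X ω) ∈ C}) ≤ ENNReal.ofReal q * Pr {ω | Y ω ∈ G} := by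
    calc Pr ({ω | Y ω ∈ G} ∩ {ω | (Y ω, X ω) ∈ C})
        = Pr.map (fun ω => (Y ω, X ω)) ((Prod.fst ⁻¹' G) ∩ C) := by
          rw [Measure.map_apply (hY.prodMk hX) hD]; rfl
      _ = ∫⁻ y, μ (Prod.mk y ⁻¹' ((Prod.fst ⁻¹' G) ∩ C)) ∂(Pr.map Y) := by
          rw [hmap, Measure.prod_apply hD]
      _ ≤ ∫⁻ y, G.indicator (fun _ => ENNReal.ofReal q) y ∂(Pr.map Y) := by
          refine lintegral_mono fun y => ?_
          by_cases hy : y ∈ G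
          · rw [Set.indicator_of_mem hy]
            have : Prod.mk y ⁻¹' ((Prod.fst ⁻¹' G) ∩ C) = {x | (y, x) ∈ C} := by
              ext x; simp [hy]
            rw [this, ← ofReal_measureReal]
            exact ENNReal.ofReal_le_ofReal (hq y)
          · have : Prod.mk y ⁻¹' ((Prod.fst ⁻¹' G) ∩ C) = ∅ := by
              ext x; simp [hy]
            simp [this]
      _ = ENNReal.ofReal q * Pr {ω | Y ω ∈ G} := by
          rw [lintegral_indicator_const hG, Measure.map_apply hY hG]; rfl
  calc Pr.real _ ≤ (ENNReal.ofReal q * Pr {ω | Y ω ∈ G}).toReal :=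
        ENNReal.toReal_mono (by finiteness) h1
    _ = _ := by rw [ENNReal.toReal_mul, ENNReal.toReal_ofReal hq0, measureReal_def]

/-- The event that the points indexed by a triple form a configuration in `B`. -/
def tripleEvent (P : ℕ → Ω → E) (B : Set (E × E × E)) (t : ℕ × ℕ × ℕ) : Set Ω :=
  {ω | (P t.1 ω, P t.2.1 ω, P t.2.2 ω) ∈ B}

theorem measurableSet_tripleEvent {P : ℕ → Ω → E} (hP : ∀ i, Measurable (P i))
    {B : Set (E × E × E)} (hB : MeasurableSet B) (t : ℕ × ℕ × ℕ) :
    MeasurableSet (tripleEvent P B t) :=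
  ((hP _).prodMk ((hP _).prodMk (hP _))) hB

/-- Conditionally on the points other than the one with index `l`, an event attached to a triple
through `l` has probability at most `q`. The symmetry of `B` allows `l` to be put in last place. -/
theorem measureReal_inter_tripleEvent_le {Pr : Measure Ω} [IsProbabilityMeasure Pr]
    {μ : Measure E} [IsProbabilityMeasure μ] {P : ℕ → Ω → E} (hP : ∀ i, Measurable (P i))
    (hind : iIndepFun P Pr) (hlaw : ∀ i, Pr.map (P i) = μ) {B : Set (E × E × E)}
    (hB : MeasurableSet B) (h12 : ∀ x y z, (x, y, z) ∈ B → (y, x, z) ∈ B)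
    (h23 : ∀ x y z, (x, y, z) ∈ B → (x, z, y) ∈ B) {q : ℝ}
    (hq : ∀ x y, μ.real {z | (x, y, z) ∈ B} ≤ q) {t : ℕ × ℕ × ℕ} (ht1 : t.1 < t.2.1)
    (ht2 : t.2.1 < t.2.2) {l : ℕ} (hl : l ∈ tripleSupport t) {S : Finset ℕ} (hS : l ∉ S)
    {G : Set (S → E)} (hG : MeasurableSet G) :
    Pr.real ({ω | (fun i : S => P i ω) ∈ G} ∩ tripleEvent P B t) ≤
      q * Pr.real {ω | (fun i : S => P i ω) ∈ G} := by
  obtain ⟨a, b, hal, hbl, hev⟩ : ∃ a b, a ≠ l ∧ b ≠ l ∧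
      tripleEvent P B t = {ω | (P a ω, P b ω, P l ω) ∈ B} := by
    obtain ⟨x, y, z⟩ := t
    simp only [tripleSupport, Finset.mem_insert, Finset.mem_singleton] at hl ht1 ht2
    rcases hl with rfl | rfl | rfl
    · exact ⟨y, z, by omega, by omega, Set.ext fun ω =>
        ⟨fun h => h23 _ _ _ (h12 _ _ _ h), fun h => h12 _ _ _ (h23 _ _ _ h)⟩⟩
    · exact ⟨x, z, by omega, by omega, Set.ext fun ω => ⟨fun h => h23 _ _ _ h,
        fun h => h23 _ _ _ h⟩⟩
    · exact ⟨x, y, by omega, by omega, rfl⟩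
  -- Conditioning also on the two other points of the triple keeps `l` outside the index set.
  set S' : Finset ℕ := insert a (insert b S) with hS'
  have hlS' : l ∉ S' := by
    simp only [hS', Finset.mem_insert, not_or]
    exact ⟨hal.symm, hbl.symm, hS⟩
  have hi := hind.indepFun_finset S' {l} (Finset.disjoint_singleton_right.2 hlS') hP
  have hi2 : IndepFun (fun ω (i : S') => P i ω) (P l) Pr :=
    hi.comp measurable_id
      (measurable_pi_apply (⟨l, Finset.mem_singleton_self l⟩ : ({l} : Finset ℕ)))
  have hY : Measurable fun ω (i : S') => P i ω := measurable_pi_lambda _ fun i => hP i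
  have hsub : S ⊆ S' := (Finset.subset_insert b S).trans (Finset.subset_insert a _)
  have hres : Measurable fun (f : S' → E) (i : S) => f ⟨i, hsub i.2⟩ :=
    measurable_pi_lambda _ fun i => measurable_pi_apply _
  have ha : a ∈ S' := by simp [hS']
  have hb : b ∈ S' := by simp [hS']
  have hC : MeasurableSet {p : (S' → E) × E | (p.1 ⟨a, ha⟩, p.1 ⟨b, hb⟩, p.2) ∈ B} := by
    refine measurableSet_preimage (t := B)
      (f := fun p : (S' → E) × E => (p.1 ⟨a, ha⟩, p.1 ⟨b, hb⟩, p.2)) ?_ hB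
    exact ((measurable_pi_apply _).comp measurable_fst).prodMk
      (((measurable_pi_apply _).comp measurable_fst).prodMk measurable_snd)
  have := measureReal_inter_le_of_indepFun (hP l) hY hi2 (hlaw l) (hres hG) hC
    (fun y => hq (y ⟨a, ha⟩) (y ⟨b, hb⟩))
  rw [hev]
  exact this

/-- Extension of a finite family by a constant value. It makes the coordinates of a triple available
as functions of the restricted family, without proofs that its indices lie in `S`. -/
def extendConst {S : Finset ℕ} (e : E) (f : S → E) (i : ℕ) : E :=
  if h : i ∈ S then f ⟨i, h⟩ else e

theorem measurable_extendConst {S : Finset ℕ} (e : E) (i : ℕ) :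
    Measurable fun f : S → E => extendConst e f i := by
  unfold extendConst
  by_cases h : i ∈ S
  · simp only [h, dite_true]
    exact measurable_pi_apply _
  · simp only [h, dite_false]
    exact measurable_const

/-- Poisson approximation for the number of triples of independent, identically distributed points
that form a configuration in a symmetric set `B`, when all one-point sections of `B` have mass at
most `q`. -/
theorem abs_measureReal_no_triple_sub_exp_le {Pr : Measure Ω} [IsProbabilityMeasure Pr]
    {μ : Measure E} [IsProbabilityMeasure μ] {P : ℕ → Ω → E} (hP : ∀ i, Measurable (P i))
    (hind : iIndepFun P Pr) (hlaw : ∀ i, Pr.map (P i) = μ) {B : Set (E × E × E)}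
    (hB : MeasurableSet B) (h12 : ∀ x y z, (x, y, z) ∈ B → (y, x, z) ∈ B)
    (h23 : ∀ x y z, (x, y, z) ∈ B → (x, z, y) ∈ B) {q : ℝ}
    (hq : ∀ x y, μ.real {z | (x, y, z) ∈ B} ≤ q) (n : ℕ) :
    |Pr.real (⋂ t ∈ triplesFinset n, (tripleEvent P B t)ᶜ) -
      Real.exp (-((triplesFinset n).card * (μ.prod (μ.prod μ)).real B))| ≤ 18 * n ^ 5 * q ^ 2 := by
  obtain ⟨e⟩ : Nonempty E := μ.nonempty_of_neZero
  have hq0 : 0 ≤ q := measureReal_nonneg.trans (hq e e)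
  have hm := measurableSet_tripleEvent hP hB
  have hprob : ∀ t ∈ triplesFinset n, Pr.real (tripleEvent P B t) =
      (μ.prod (μ.prod μ)).real B := by
    intro t ht
    rw [mem_triplesFinset] at ht
    have hjk : Pr.map (fun ω => (P t.2.1 ω, P t.2.2 ω)) = μ.prod μ := by
      have := (indepFun_iff_map_prod_eq_prod_map_map (hP t.2.1).aemeasurable
        (hP t.2.2).aemeasurable).1 (hind.indepFun (by omega))
      rwa [hlaw, hlaw] at this
    have hijk := (indepFun_iff_map_prod_eq_prod_map_map (hP t.1).aemeasurable
        ((hP t.2.1).prodMk (hP t.2.2)).aemeasurable).1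
        (hind.indepFun_prodMk hP t.2.1 t.2.2 t.1 (by omega) (by omega)).symm
    rw [hlaw, hjk] at hijk
    rw [← hijk, measureReal_def, measureReal_def,
      Measure.map_apply ((hP _).prodMk ((hP _).prodMk (hP _))) hB]
    rfl
  have hsingle : ∀ t ∈ triplesFinset n, Pr.real (tripleEvent P B t) ≤ q := by
    intro t ht
    rw [mem_triplesFinset] at ht
    have := measureReal_inter_tripleEvent_le hP hind hlaw hB h12 h23 hq ht.1 ht.2.1
      (l := t.1) (by simp [tripleSupport]) (S := ∅) (by simp) (G := Set.univ) MeasurableSet.univ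
    simpa using this
  -- Of two different triples sharing an index, one has an index that the other lacks; integrating
  -- out that point first gives the bound `q ^ 2`.
  have hpair : ∀ t ∈ triplesFinset n, ∀ s ∈ triplesMeeting n t \ {t},
      Pr.real (tripleEvent P B t ∩ tripleEvent P B s) ≤ q ^ 2 := by
    intro t ht s hs
    simp only [Finset.mem_sdiff, Finset.mem_singleton, triplesMeeting, Finset.mem_filter] at hs
    obtain ⟨l, hl, hlt⟩ := exists_mem_tripleSupport_notMem hs.1.1 ht hs.2
    have hs' := mem_triplesFinset.1 hs.1.1
    have h1 : t.1 ∈ tripleSupport t := by simp [tripleSupport]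
    have h2 : t.2.1 ∈ tripleSupport t := by simp [tripleSupport]
    have h3 : t.2.2 ∈ tripleSupport t := by simp [tripleSupport]
    have := measureReal_inter_tripleEvent_le hP hind hlaw hB h12 h23 hq hs'.1 hs'.2.1 hl hlt
      (G := {f | (f ⟨t.1, h1⟩, f ⟨t.2.1, h2⟩, f ⟨t.2.2, h3⟩) ∈ B})
      (((measurable_pi_apply _).prodMk
        ((measurable_pi_apply _).prodMk (measurable_pi_apply _))) hB)
    calc _ ≤ q * Pr.real (tripleEvent P B t) := this
      _ ≤ q * q := by gcongr; exact hsingle t ht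
      _ = q ^ 2 := (sq q).symm
  have hcount : (triplesFinset n).card ≤ n ^ 3 := by
    refine (Finset.card_filter_le _ _).trans (le_of_eq ?_)
    simp only [Finset.card_product, Finset.card_range]
    ring
  have key := abs_measureReal_none_sub_exp_le (P := Pr) (triplesFinset n) (triplesMeeting n)
    (fun t ht => by
      simp only [triplesMeeting, Finset.mem_filter, ht, true_and, Finset.not_disjoint_iff]
      exact ⟨t.1, by simp [tripleSupport], by simp [tripleSupport]⟩)
    (fun t _ => Finset.filter_subset _ _) (tripleEvent P B) hm (fun t ht => by
      set S := (triplesFinset n \ triplesMeeting n t).biUnion tripleSupport with hS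
      have hdisj : Disjoint (tripleSupport t) S := by
        rw [hS, Finset.disjoint_biUnion_right]
        intro s hs
        simp only [triplesMeeting, Finset.mem_sdiff, Finset.mem_filter, not_and, not_not] at hs
        exact hs.2 hs.1
      have hi := hind.indepFun_finset (tripleSupport t) S hdisj hP
      have hf : ∀ (R : Finset ℕ) (s : ℕ × ℕ × ℕ), Measurable fun f : R → E =>
          B.indicator (fun _ => (1 : ℕ))
            (extendConst e f s.1, extendConst e f s.2.1, extendConst e f s.2.2) := fun R s =>
        (measurable_const.indicator hB).comp ((measurable_extendConst e _).prodMk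
          ((measurable_extendConst e _).prodMk (measurable_extendConst e _)))
      have hval : ∀ (R : Finset ℕ) (s : ℕ × ℕ × ℕ), tripleSupport s ⊆ R → ∀ ω,
          (tripleEvent P B s).indicator (fun _ => (1 : ℕ)) ω = B.indicator (fun _ => (1 : ℕ))
            (extendConst e (fun i : R => P i ω) s.1, extendConst e (fun i : R => P i ω) s.2.1,
              extendConst e (fun i : R => P i ω) s.2.2) := by
        intro R s hs ω
        have h1 : s.1 ∈ R := hs (by simp [tripleSupport])
        have h2 : s.2.1 ∈ R := hs (by simp [tripleSupport])
        have h3 : s.2.2 ∈ R := hs (by simp [tripleSupport])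
        simp only [extendConst, h1, h2, h3, dite_true]
        rfl
      have := hi.comp (hf (tripleSupport t) t)
        (Finset.measurable_sum (triplesFinset n \ triplesMeeting n t) fun s _ => hf S s)
      convert this using 1
      · ext ω
        exact hval _ t (Finset.Subset.refl _) ω
      · ext ω
        simp only [Function.comp_apply]
        exact Finset.sum_congr rfl fun s hs => hval S s
          (Finset.subset_biUnion_of_mem tripleSupport hs) ω)
  rw [Finset.sum_congr rfl hprob, Finset.sum_const, nsmul_eq_mul] at key
  refine key.trans ?_
  calc _ ≤ ∑ t ∈ triplesFinset n, (9 * (n : ℝ) ^ 2 * q ^ 2 + q * (9 * (n : ℝ) ^ 2 * q)) := by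
        have hcm : ∀ t, ((triplesMeeting n t).card : ℝ) ≤ 9 * (n : ℝ) ^ 2 := fun t => by
          exact_mod_cast card_triplesMeeting_le n t
        refine Finset.sum_le_sum fun t ht => add_le_add ?_ ?_
        · refine (Finset.sum_le_card_nsmul _ _ _ (hpair t ht)).trans ?_
          rw [nsmul_eq_mul]
          refine mul_le_mul_of_nonneg_right (le_trans ?_ (hcm t)) (sq_nonneg q)
          exact_mod_cast Finset.card_le_card Finset.sdiff_subset
        · refine mul_le_mul (hsingle t ht) ?_ (Finset.sum_nonneg fun _ _ => measureReal_nonneg) hq0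
          refine (Finset.sum_le_card_nsmul _ _ q fun s hs =>
            hsingle s (Finset.mem_filter.1 hs).1).trans ?_
          rw [nsmul_eq_mul]
          exact mul_le_mul_of_nonneg_right (hcm t) hq0
    _ = (triplesFinset n).card * (18 * (n : ℝ) ^ 2 * q ^ 2) := by
        rw [Finset.sum_const, nsmul_eq_mul]; ring
    _ ≤ (n : ℝ) ^ 3 * (18 * (n : ℝ) ^ 2 * q ^ 2) := by
        gcongr; exact_mod_cast hcount
    _ = _ := by ring

end

/-! ### Coordinates along an axis -/

/-- The point of `ℝ ^ (m + 1)` with first coordinate `s` and remaining coordinates `w`. -/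
def axisPoint {m : ℕ} (s : ℝ) (w : EuclideanSpace ℝ (Fin m)) : EuclideanSpace ℝ (Fin (m + 1)) :=
  WithLp.toLp 2 (Fin.cons s w.ofLp)

theorem inner_axisPoint {m : ℕ} (s t : ℝ) (w x : EuclideanSpace ℝ (Fin m)) :
    inner ℝ (axisPoint s w) (axisPoint t x) = s * t + inner ℝ w x := by
  simp [axisPoint, PiLp.inner_apply, Fin.sum_univ_succ, mul_comm]

theorem norm_axisPoint_sq {m : ℕ} (s : ℝ) (w : EuclideanSpace ℝ (Fin m)) :
    ‖axisPoint s w‖ ^ 2 = s ^ 2 + ‖w‖ ^ 2 := by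
  rw [← real_inner_self_eq_norm_sq, inner_axisPoint, real_inner_self_eq_norm_sq, sq s]

theorem axisPoint_add {m : ℕ} (s t : ℝ) (w x : EuclideanSpace ℝ (Fin m)) :
    axisPoint s w + axisPoint t x = axisPoint (s + t) (w + x) := by
  ext i; refine Fin.cases ?_ (fun i => ?_) i <;> simp [axisPoint]

theorem smul_axisPoint {m : ℕ} (c s : ℝ) (w : EuclideanSpace ℝ (Fin m)) :
    c • axisPoint s w = axisPoint (c * s) (c • w) := by
  ext i; refine Fin.cases ?_ (fun i => ?_) i <;> simp [axisPoint]

theorem norm_axisPoint_zero_left {m : ℕ} (w : EuclideanSpace ℝ (Fin m)) :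
    ‖axisPoint 0 w‖ = ‖w‖ := by
  have := norm_axisPoint_sq 0 w
  rw [zero_pow two_ne_zero, zero_add] at this
  exact (pow_left_inj₀ (norm_nonneg _) (norm_nonneg _) two_ne_zero).1 this

theorem norm_axisPoint_zero_right {m : ℕ} (s : ℝ) :
    ‖axisPoint s (0 : EuclideanSpace ℝ (Fin m))‖ = |s| := by
  have := norm_axisPoint_sq s (0 : EuclideanSpace ℝ (Fin m))
  rw [norm_zero, zero_pow two_ne_zero, add_zero, ← sq_abs s] at this
  exact (pow_left_inj₀ (norm_nonneg _) (abs_nonneg _) two_ne_zero).1 this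

theorem axisPoint_zero_zero {m : ℕ} : axisPoint 0 (0 : EuclideanSpace ℝ (Fin m)) = 0 := by
  rw [← norm_eq_zero, norm_axisPoint_zero_left, norm_zero]

theorem measurable_axisPoint {m : ℕ} :
    Measurable fun p : ℝ × EuclideanSpace ℝ (Fin m) => axisPoint p.1 p.2 := by
  have : Continuous fun p : ℝ × EuclideanSpace ℝ (Fin m) => axisPoint p.1 p.2 := by
    refine (PiLp.continuous_toLp 2 _).comp (continuous_pi fun i => ?_)
    refine Fin.cases ?_ (fun i => ?_) i
    · simpa using continuous_fst
    · simp only [Fin.cons_succ]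
      fun_prop
  exact this.measurable

theorem lintegral_axisPoint {m : ℕ} {f : EuclideanSpace ℝ (Fin (m + 1)) → ENNReal}
    (hf : Measurable f) :
    ∫⁻ x, f x = ∫⁻ s : ℝ, ∫⁻ w : EuclideanSpace ℝ (Fin m), f (axisPoint s w) := by
  rw [← (PiLp.volume_preserving_toLp (Fin (m + 1))).lintegral_comp hf,
    lintegral_fin_cons (f := fun x => f (WithLp.toLp 2 x)) (hf.comp (WithLp.measurable_toLp 2 _))]
  refine lintegral_congr fun s => ?_
  rw [← (PiLp.volume_preserving_toLp (Fin m)).lintegral_comp]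
  · rfl
  · exact hf.comp (measurable_axisPoint.comp (by fun_prop :
      Measurable fun w : EuclideanSpace ℝ (Fin m) => (s, w)))

theorem angle_axisPoint_of_pos {m : ℕ} {s : ℝ} (hs : 0 < s) (w : EuclideanSpace ℝ (Fin m)) :
    InnerProductGeometry.angle (axisPoint 1 0) (axisPoint s w) = Real.arctan (‖w‖ / s) := by
  have h1 : axisPoint s (0 : EuclideanSpace ℝ (Fin m)) + axisPoint 0 w = axisPoint s w := by
    rw [axisPoint_add, add_zero, zero_add]
  have h2 : s • axisPoint 1 (0 : EuclideanSpace ℝ (Fin m)) = axisPoint s 0 := by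
    rw [smul_axisPoint, mul_one, smul_zero]
  rw [← InnerProductGeometry.angle_smul_left_of_pos _ _ hs, h2, ← h1,
    InnerProductGeometry.angle_add_eq_arctan_of_inner_eq_zero]
  · rw [norm_axisPoint_zero_left, norm_axisPoint_zero_right, abs_of_pos hs]
  · rw [inner_axisPoint]; simp
  · rw [← norm_ne_zero_iff, norm_axisPoint_zero_right]; exact (abs_pos.2 hs.ne').ne'

theorem pi_div_two_le_angle_axisPoint {m : ℕ} {s : ℝ} (hs : s ≤ 0)
    (w : EuclideanSpace ℝ (Fin m)) :
    Real.pi / 2 ≤ InnerProductGeometry.angle (axisPoint 1 0) (axisPoint s w) := by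
  rw [InnerProductGeometry.angle, ← Real.arccos_zero]
  refine Real.antitone_arccos ?_
  rw [inner_axisPoint]
  simp only [one_mul, inner_zero_left, add_zero]
  exact div_nonpos_of_nonpos_of_nonneg hs (by positivity)

/-! ### Points seeing a segment under a large angle -/

/-- The points that see the segment `x y` under an angle larger than `π - t`. For small `t` this is
a thin neighbourhood of the segment. -/
def spindle {d : ℕ} (t : ℝ) (x y : EuclideanSpace ℝ (Fin d)) : Set (EuclideanSpace ℝ (Fin d)) :=
  {z | Real.pi - t < EuclideanGeometry.angle x z y}

/-- The angle at the apex exceeds `π - t` if and only if the angles at the base add up to less than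
`t`. -/
theorem axisPoint_mem_spindle_iff_angle {m : ℕ} {t s : ℝ} (w : EuclideanSpace ℝ (Fin m)) :
    axisPoint s w ∈ spindle t 0 (axisPoint 1 0) ↔
      InnerProductGeometry.angle (axisPoint 1 0) (axisPoint s w) +
      InnerProductGeometry.angle (axisPoint 1 0) (axisPoint (1 - s) (-w)) < t := by
  have h0 : axisPoint 1 (0 : EuclideanSpace ℝ (Fin m)) ≠ 0 := by
    rw [← norm_ne_zero_iff, norm_axisPoint_zero_right]; simp
  have hsum := EuclideanGeometry.angle_add_angle_add_angle_eq_pi (axisPoint s w) h0.symm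
  have e1 : EuclideanGeometry.angle (axisPoint 1 0) 0 (axisPoint s w) =
      InnerProductGeometry.angle (axisPoint 1 0) (axisPoint s w) := by
    simp [EuclideanGeometry.angle]
  have e2 : EuclideanGeometry.angle (axisPoint s w) (axisPoint 1 0) 0 =
      InnerProductGeometry.angle (axisPoint 1 0) (axisPoint (1 - s) (-w)) := by
    rw [EuclideanGeometry.angle, ← InnerProductGeometry.angle_neg_neg,
      InnerProductGeometry.angle_comm]
    congr 1
    · simp
    · have : axisPoint (1 - s) (-w) = axisPoint 1 0 + (-1 : ℝ) • axisPoint s w := by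
        rw [smul_axisPoint, axisPoint_add]
        congr 1
        · ring
        · simp
      rw [this]
      simp [sub_eq_add_neg]
  rw [e1, e2] at hsum
  simp only [spindle, Set.mem_ofPred_eq]
  constructor <;> intro h <;> linarith

theorem axisPoint_mem_spindle_iff {m : ℕ} {t s : ℝ} (hs0 : 0 < s) (hs1 : s < 1)
    (w : EuclideanSpace ℝ (Fin m)) :
    axisPoint s w ∈ spindle t 0 (axisPoint 1 0) ↔
      Real.arctan (‖w‖ / s) + Real.arctan (‖w‖ / (1 - s)) < t := by
  rw [axisPoint_mem_spindle_iff_angle, angle_axisPoint_of_pos hs0,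
    angle_axisPoint_of_pos (by linarith), norm_neg]

theorem bounds_of_axisPoint_mem_spindle {m : ℕ} {t s : ℝ} (ht : t < Real.pi / 2)
    {w : EuclideanSpace ℝ (Fin m)} (h : axisPoint s w ∈ spindle t 0 (axisPoint 1 0)) :
    0 < s ∧ s < 1 ∧ ‖w‖ < s * Real.tan t := by
  have h' := (axisPoint_mem_spindle_iff_angle w).1 h
  have hs0 : 0 < s := by
    by_contra hs
    have := pi_div_two_le_angle_axisPoint (not_lt.1 hs) w
    have := InnerProductGeometry.angle_nonneg (axisPoint 1 0) (axisPoint (1 - s) (-w))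
    linarith
  have hs1 : s < 1 := by
    by_contra hs
    have := pi_div_two_le_angle_axisPoint (s := 1 - s) (by linarith) (-w)
    have := InnerProductGeometry.angle_nonneg (axisPoint 1 0) (axisPoint s w)
    linarith
  refine ⟨hs0, hs1, ?_⟩
  rw [axisPoint_mem_spindle_iff hs0 hs1] at h
  have h2 : 0 ≤ Real.arctan (‖w‖ / (1 - s)) :=
    Real.arctan_nonneg.2 (div_nonneg (norm_nonneg _) (by linarith))
  have h3 : 0 ≤ Real.arctan (‖w‖ / s) :=
    Real.arctan_nonneg.2 (div_nonneg (norm_nonneg _) hs0.le)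
  have h4 : Real.tan (Real.arctan (‖w‖ / s)) < Real.tan t :=
    Real.tan_lt_tan_of_nonneg_of_lt_pi_div_two h3 ht (by linarith)
  rw [Real.tan_arctan, div_lt_iff₀ hs0] at h4
  linarith

theorem measurable_euclideanAngle {d : ℕ} :
    Measurable fun p : EuclideanSpace ℝ (Fin d) × EuclideanSpace ℝ (Fin d) ×
      EuclideanSpace ℝ (Fin d) => EuclideanGeometry.angle p.1 p.2.1 p.2.2 := by
  simp only [EuclideanGeometry.angle, InnerProductGeometry.angle, vsub_eq_sub]
  refine Real.measurable_arccos.comp ?_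
  refine Measurable.div ?_ ?_
  · exact Measurable.inner (by fun_prop) (by fun_prop)
  · fun_prop

theorem measurableSet_spindle {d : ℕ} (t : ℝ) (x y : EuclideanSpace ℝ (Fin d)) :
    MeasurableSet (spindle t x y) := by
  have h : Measurable fun z : EuclideanSpace ℝ (Fin d) => (x, z, y) := by fun_prop
  have h2 := measurable_euclideanAngle.comp h
  exact measurableSet_lt measurable_const h2

/-- The constant in `vol (spindle t x y) ~ spindleConst m * t ^ m * dist x y ^ (m + 1)`. -/
noncomputable def spindleConst (m : ℕ) : ENNReal :=
  volume (Metric.ball (0 : EuclideanSpace ℝ (Fin m)) 1) *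
    ∫⁻ s in Set.Ioo (0 : ℝ) 1, ENNReal.ofReal ((s * (1 - s)) ^ m)

theorem tendsto_arctan_mul_div (a : ℝ) :
    Tendsto (fun t : ℝ => Real.arctan (t * a) / t) (𝓝[>] 0) (𝓝 a) := by
  have h : HasDerivAt (fun t : ℝ => Real.arctan (t * a)) a 0 := by
    have h1 : HasDerivAt (fun t : ℝ => t * a) a 0 := by
      simpa using (hasDerivAt_id (0 : ℝ)).mul_const a
    simpa using h1.arctan
  have := h.tendsto_slope_zero_right
  simpa [div_eq_inv_mul] using this

theorem eventually_tan_le : ∀ᶠ t : ℝ in 𝓝[>] 0, Real.tan t ≤ 2 * t := by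
  have h : HasDerivAt Real.tan 1 0 := by simpa using Real.hasDerivAt_tan (x := 0) (by simp)
  have h2 : Tendsto (fun t : ℝ => t⁻¹ * Real.tan t) (𝓝[>] 0) (𝓝 1) := by
    simpa using h.tendsto_slope_zero_right
  filter_upwards [h2.eventually_le_const one_lt_two, self_mem_nhdsWithin] with t ht ht0
  rwa [inv_mul_le_iff₀ ht0, mul_comm] at ht

theorem eventually_lt_of_pos {c : ℝ} (hc : 0 < c) : ∀ᶠ t : ℝ in 𝓝[>] 0, t < c :=
  mem_nhdsWithin_of_mem_nhds (Iio_mem_nhds hc)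

/-- Stretched by `1 / t` orthogonally to its axis, the spindle over the unit segment converges to
the body `‖w‖ < s * (1 - s)`, since the base angles are `t * ‖w‖ / s` and `t * ‖w‖ / (1 - s)` to
first order. -/
theorem eventually_axisPoint_mem_spindle_iff {m : ℕ} {s : ℝ} (hs0 : 0 < s) (hs1 : s < 1)
    {w : EuclideanSpace ℝ (Fin m)} (hw : ‖w‖ ≠ s * (1 - s)) :
    ∀ᶠ t : ℝ in 𝓝[>] 0, (axisPoint s (t • w) ∈ spindle t 0 (axisPoint 1 0) ↔
      ‖w‖ < s * (1 - s)) := by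
  have h1 : 0 < 1 - s := by linarith
  have hlim : Tendsto (fun t : ℝ => Real.arctan (t * (‖w‖ / s)) / t +
      Real.arctan (t * (‖w‖ / (1 - s))) / t) (𝓝[>] 0) (𝓝 (‖w‖ / s + ‖w‖ / (1 - s))) :=
    (tendsto_arctan_mul_div _).add (tendsto_arctan_mul_div _)
  have hsum : ‖w‖ / s + ‖w‖ / (1 - s) = ‖w‖ / (s * (1 - s)) := by field_simp; ring
  rw [hsum] at hlim
  have hiff : ∀ᶠ t : ℝ in 𝓝[>] 0, (axisPoint s (t • w) ∈ spindle t 0 (axisPoint 1 0) ↔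
      Real.arctan (t * (‖w‖ / s)) / t + Real.arctan (t * (‖w‖ / (1 - s))) / t < 1) := by
    filter_upwards [self_mem_nhdsWithin] with t ht
    have ht0 : (0 : ℝ) < t := ht
    rw [axisPoint_mem_spindle_iff hs0 hs1, norm_smul, Real.norm_of_nonneg ht0.le, ← add_div,
      div_lt_one ht0, mul_div_assoc, mul_div_assoc]
  have hp : 0 < s * (1 - s) := by positivity
  rcases lt_or_gt_of_ne hw with hlt | hgt
  · have : ‖w‖ / (s * (1 - s)) < 1 := (div_lt_one hp).2 hlt
    filter_upwards [hiff, hlim.eventually_lt_const this] with t h2 h3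
    rw [h2]; exact ⟨fun _ => hlt, fun _ => h3⟩
  · have : 1 < ‖w‖ / (s * (1 - s)) := (one_lt_div hp).2 hgt
    filter_upwards [hiff, hlim.eventually_const_lt this] with t h2 h3
    rw [h2]; exact ⟨fun h => absurd h (not_lt.2 h3.le), fun h => absurd h (not_lt.2 hgt.le)⟩

theorem lintegral_comp_smul_euclidean {m : ℕ} {t : ℝ} (ht : 0 < t)
    {f : EuclideanSpace ℝ (Fin m) → ENNReal} (hf : Measurable f) :
    ∫⁻ w, f w = ENNReal.ofReal t ^ m * ∫⁻ w, f (t • w) := by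
  have h := Measure.map_addHaar_smul (volume : Measure (EuclideanSpace ℝ (Fin m))) ht.ne'
  have h2 : ∫⁻ w, f (t • w) = ∫⁻ w, f w ∂(Measure.map (t • ·) volume) :=
    (lintegral_map hf (measurable_const_smul t)).symm
  rw [h2, h, lintegral_smul_measure, smul_eq_mul, ← mul_assoc, finrank_euclideanSpace,
    Fintype.card_fin, abs_of_pos (by positivity), ENNReal.ofReal_inv_of_pos (by positivity),
    ENNReal.ofReal_pow ht.le, ENNReal.mul_inv_cancel, one_mul]
  · exact pow_ne_zero _ (by simpa using ht)
  · exact ENNReal.pow_ne_top ENNReal.ofReal_ne_top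

theorem volume_spindle_axis_div {m : ℕ} {t : ℝ} (ht : 0 < t) :
    volume (spindle t 0 (axisPoint 1 (0 : EuclideanSpace ℝ (Fin m)))) / ENNReal.ofReal t ^ m =
      ∫⁻ s : ℝ, ∫⁻ w : EuclideanSpace ℝ (Fin m),
        (spindle t 0 (axisPoint 1 (0 : EuclideanSpace ℝ (Fin m)))).indicator 1
          (axisPoint s (t • w)) := by
  have hS := measurableSet_spindle t 0 (axisPoint 1 (0 : EuclideanSpace ℝ (Fin m)))
  have hm : Measurable ((spindle t 0 (axisPoint 1 (0 : EuclideanSpace ℝ (Fin m)))).indicator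
      (1 : EuclideanSpace ℝ (Fin (m + 1)) → ENNReal)) := measurable_one.indicator hS
  rw [← lintegral_indicator_one hS, lintegral_axisPoint hm]
  have : ∀ s : ℝ, ∫⁻ w : EuclideanSpace ℝ (Fin m),
      (spindle t 0 (axisPoint 1 (0 : EuclideanSpace ℝ (Fin m)))).indicator
        (1 : EuclideanSpace ℝ (Fin (m + 1)) → ENNReal) (axisPoint s w) =
          ENNReal.ofReal t ^ m * ∫⁻ w : EuclideanSpace ℝ (Fin m),
      (spindle t 0 (axisPoint 1 (0 : EuclideanSpace ℝ (Fin m)))).indicator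
        (1 : EuclideanSpace ℝ (Fin (m + 1)) → ENNReal) (axisPoint s (t • w)) := fun s =>
    lintegral_comp_smul_euclidean ht (hm.comp (measurable_axisPoint.comp (by fun_prop :
      Measurable fun w : EuclideanSpace ℝ (Fin m) => (s, w))))
  simp only [this]
  have hne : ENNReal.ofReal t ^ m ≠ ⊤ := ENNReal.pow_ne_top ENNReal.ofReal_ne_top
  rw [lintegral_const_mul' _ _ hne, mul_comm,
    ENNReal.mul_div_cancel_right (pow_ne_zero _ (by simpa using ht)) hne]

/-- Volume asymptotics of the spindle over the unit segment, by dominated convergence. -/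
theorem tendsto_volume_spindle_axis_div {m : ℕ} :
    Tendsto (fun t : ℝ => volume (spindle t 0 (axisPoint 1 (0 : EuclideanSpace ℝ (Fin m)))) /
      ENNReal.ofReal t ^ m) (𝓝[>] 0) (𝓝 (spindleConst m)) := by
  set F : ℝ → ℝ × EuclideanSpace ℝ (Fin m) → ENNReal := fun t p =>
    (spindle t 0 (axisPoint 1 (0 : EuclideanSpace ℝ (Fin m)))).indicator 1
          (axisPoint p.1 (t • p.2)) with hF
  set L : Set (ℝ × EuclideanSpace ℝ (Fin m)) := {p | 0 < p.1 ∧ p.1 < 1 ∧ ‖p.2‖ < p.1 * (1 - p.1)}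
  have hLm : MeasurableSet L := by
    refine (measurableSet_lt measurable_const measurable_fst).inter
      ((measurableSet_lt measurable_fst measurable_const).inter
      (measurableSet_lt (f := fun p : ℝ × EuclideanSpace ℝ (Fin m) => ‖p.2‖)
      (g := fun p => p.1 * (1 - p.1)) (by fun_prop) (by fun_prop)))
  have hFm : ∀ t, Measurable (F t) := fun t =>
    (measurable_one.indicator (measurableSet_spindle _ _ _)).comp
      (measurable_axisPoint.comp (by fun_prop :
        Measurable fun p : ℝ × EuclideanSpace ℝ (Fin m) => (p.1, t • p.2)))
  have hbound : ∀ᶠ t : ℝ in 𝓝[>] 0, ∀ᵐ p : ℝ × EuclideanSpace ℝ (Fin m),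
      F t p ≤ (Set.Icc (0 : ℝ) 1 ×ˢ Metric.closedBall (0 : EuclideanSpace ℝ (Fin m)) 2).indicator
        1 p := by
    filter_upwards [eventually_tan_le, self_mem_nhdsWithin,
      eventually_lt_of_pos (half_pos Real.pi_pos)] with t h1 h2 h3
    refine ae_of_all _ fun p => ?_
    have ht : (0 : ℝ) < t := h2
    by_cases hp : axisPoint p.1 (t • p.2) ∈ spindle t 0 (axisPoint 1 0)
    · obtain ⟨a, b, c⟩ := bounds_of_axisPoint_mem_spindle h3 hp
      have hmem : p ∈ (Set.Icc (0 : ℝ) 1 ×ˢ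
          Metric.closedBall (0 : EuclideanSpace ℝ (Fin m)) 2) := by
        refine ⟨⟨a.le, b.le⟩, ?_⟩
        rw [mem_closedBall_zero_iff]
        rw [norm_smul, Real.norm_of_nonneg ht.le] at c
        have h4 : 0 ≤ Real.tan t := Real.tan_nonneg_of_nonneg_of_le_pi_div_two ht.le h3.le
        have : t * ‖p.2‖ ≤ t * 2 := by nlinarith
        exact le_of_mul_le_mul_left this ht
      rw [Set.indicator_of_mem hmem]
      exact Set.indicator_le_self' (fun _ _ => zero_le_one) _
    · simp [hF, Set.indicator_of_notMem hp]
  have hlim : ∀ᵐ p : ℝ × EuclideanSpace ℝ (Fin m),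
      Tendsto (fun t => F t p) (𝓝[>] 0) (𝓝 (L.indicator 1 p)) := by
    -- The boundary of the limit body is null.
    have hae : ∀ᵐ p : ℝ × EuclideanSpace ℝ (Fin m), p.1 ≠ 0 ∧ p.1 ≠ 1 ∧
        ‖p.2‖ ≠ p.1 * (1 - p.1) := by
      have hmeas : MeasurableSet {p : ℝ × EuclideanSpace ℝ (Fin m) | p.1 ≠ 0 ∧ p.1 ≠ 1 ∧
        ‖p.2‖ ≠ p.1 * (1 - p.1)} := by
        have h1 : MeasurableSet {p : ℝ × EuclideanSpace ℝ (Fin m) | p.1 = 0} :=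
          measurableSet_eq_fun (by fun_prop) (by fun_prop)
        have h2 : MeasurableSet {p : ℝ × EuclideanSpace ℝ (Fin m) | p.1 = 1} :=
          measurableSet_eq_fun (by fun_prop) (by fun_prop)
        have h3 : MeasurableSet {p : ℝ × EuclideanSpace ℝ (Fin m) | ‖p.2‖ = p.1 * (1 - p.1)} :=
          measurableSet_eq_fun (by fun_prop) (by fun_prop)
        exact h1.compl.inter (h2.compl.inter h3.compl)
      rw [Measure.volume_eq_prod, Measure.ae_prod_iff_ae_ae hmeas]
      have hne : ∀ c : ℝ, ∀ᵐ s : ℝ, s ≠ c := fun c => by simp [ae_iff]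
      filter_upwards [hne 0, hne 1] with s h0 h1
      have hc : s * (1 - s) ≠ 0 := mul_ne_zero h0 (sub_ne_zero.2 (Ne.symm h1))
      have : volume (Metric.sphere (0 : EuclideanSpace ℝ (Fin m)) (s * (1 - s))) = 0 :=
        Measure.addHaar_sphere_of_ne_zero _ _ hc
      have h3 : ∀ᵐ w : EuclideanSpace ℝ (Fin m), ‖w‖ ≠ s * (1 - s) := by
        rw [ae_iff]
        convert this using 2
        ext w; simp
      filter_upwards [h3] with w hw using ⟨h0, h1, hw⟩
    filter_upwards [hae] with p ⟨h0, h1, h2⟩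
    refine tendsto_const_nhds.congr' ?_
    by_cases hp : 0 < p.1 ∧ p.1 < 1
    · filter_upwards [eventually_axisPoint_mem_spindle_iff hp.1 hp.2 h2] with t ht
      by_cases hq : ‖p.2‖ < p.1 * (1 - p.1)
      · rw [Set.indicator_of_mem (show p ∈ L from ⟨hp.1, hp.2, hq⟩)]
        simp only [hF]
        rw [Set.indicator_of_mem (ht.2 hq)]
        rfl
      · rw [Set.indicator_of_notMem (show p ∉ L from fun h => hq h.2.2)]
        simp only [hF]
        rw [Set.indicator_of_notMem fun h => hq (ht.1 h)]
    · filter_upwards [eventually_lt_of_pos (half_pos Real.pi_pos)] with t ht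
      rw [Set.indicator_of_notMem (show p ∉ L from fun h => hp ⟨h.1, h.2.1⟩)]
      simp only [hF]
      rw [Set.indicator_of_notMem fun h => hp ?_]
      obtain ⟨a, b, c⟩ := bounds_of_axisPoint_mem_spindle ht h
      exact ⟨a, b⟩
  have hfin : ∫⁻ p : ℝ × EuclideanSpace ℝ (Fin m), (Set.Icc (0 : ℝ) 1 ×ˢ
      Metric.closedBall (0 : EuclideanSpace ℝ (Fin m)) 2).indicator 1 p ≠ ⊤ := by
    rw [lintegral_indicator_one (measurableSet_Icc.prod measurableSet_closedBall),
      Measure.volume_eq_prod, Measure.prod_prod]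
    exact ENNReal.mul_ne_top (by simp) measure_closedBall_lt_top.ne
  have hmain := tendsto_lintegral_filter_of_dominated_convergence _
    (Eventually.of_forall hFm) hbound hfin hlim
  have hval : ∫⁻ p, L.indicator 1 p = spindleConst m := by
    rw [lintegral_indicator_one hLm, Measure.volume_eq_prod, Measure.prod_apply hLm, spindleConst,
      ← lintegral_const_mul _ (by fun_prop), ← lintegral_indicator measurableSet_Ioo]
    refine lintegral_congr fun s => ?_
    by_cases hs : s ∈ Set.Ioo (0 : ℝ) 1
    · rw [Set.indicator_of_mem hs]
      have : Prod.mk s ⁻¹' L = Metric.ball 0 (s * (1 - s)) := by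
        ext w; simp [L, hs.1, hs.2]
      have hpos : 0 < s * (1 - s) := mul_pos hs.1 (sub_pos.2 hs.2)
      rw [this, Measure.addHaar_ball_of_pos _ _ hpos, finrank_euclideanSpace, Fintype.card_fin,
        mul_comm]
    · rw [Set.indicator_of_notMem hs]
      have : Prod.mk s ⁻¹' L = ∅ := by
        ext w
        simp only [L, Set.mem_preimage, Set.mem_ofPred_eq, Set.mem_empty_iff_false, iff_false]
        exact fun h => hs ⟨h.1, h.2.1⟩
      simp [this]
  rw [hval] at hmain
  refine hmain.congr' ?_
  filter_upwards [self_mem_nhdsWithin] with t ht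
  rw [volume_spindle_axis_div ht, Measure.volume_eq_prod, lintegral_prod _ (hFm t).aemeasurable]

theorem exists_linearIsometryEquiv_map_eq {E : Type*} [NormedAddCommGroup E]
    [InnerProductSpace ℝ E] {u v : E} (h : ‖u‖ = ‖v‖) : ∃ L : E ≃ₗᵢ[ℝ] E, L u = v :=
  ⟨(Submodule.span ℝ {u - v})ᗮ.reflection, Submodule.reflection_sub h⟩

/-- A similarity taking the unit segment of the first axis to a given nondegenerate segment. -/
theorem exists_similarity_axis {m : ℕ} {x y : EuclideanSpace ℝ (Fin (m + 1))} (hxy : x ≠ y) :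
    ∃ φ : EuclideanSpace ℝ (Fin (m + 1)) → EuclideanSpace ℝ (Fin (m + 1)),
      Function.Surjective φ ∧ (∀ s : ℝ, φ (axisPoint s 0) = x + s • (y - x)) ∧
      (∀ a b, dist (φ a) (φ b) = dist x y * dist a b) ∧
      (∀ a b c, EuclideanGeometry.angle (φ a) (φ b) (φ c) = EuclideanGeometry.angle a b c) ∧
      ∀ S, MeasurableSet S → volume S = edist x y ^ (m + 1) * volume (φ ⁻¹' S) := by
  have hr : 0 < ‖y - x‖ := norm_pos_iff.2 (sub_ne_zero.2 hxy.symm)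
  have hr2 : dist x y = ‖y - x‖ := by rw [dist_comm, dist_eq_norm]
  obtain ⟨L, hL⟩ := exists_linearIsometryEquiv_map_eq
    (u := axisPoint 1 (0 : EuclideanSpace ℝ (Fin m))) (v := ‖y - x‖⁻¹ • (y - x)) (by
      rw [norm_axisPoint_zero_right, norm_smul, norm_inv, norm_norm, inv_mul_cancel₀ hr.ne',
        abs_one])
  refine ⟨fun z => x + ‖y - x‖ • L z, fun z => ?_, fun s => ?_, fun a b => ?_, fun a b c => ?_,
    fun S hS => ?_⟩
  · refine ⟨L.symm (‖y - x‖⁻¹ • (z - x)), ?_⟩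
    simp [smul_smul, mul_inv_cancel₀ hr.ne']
  · have : axisPoint s (0 : EuclideanSpace ℝ (Fin m)) = s • axisPoint 1 0 := by
      rw [smul_axisPoint, mul_one, smul_zero]
    simp only
    rw [this, map_smul, hL, smul_comm, smul_smul ‖y - x‖, mul_inv_cancel₀ hr.ne', one_smul]
  · simp only
    rw [hr2, dist_add_left, dist_eq_norm, ← smul_sub, ← map_sub, norm_smul, norm_norm,
      L.norm_map, dist_eq_norm]
  · simp only [EuclideanGeometry.angle, vsub_eq_sub, add_sub_add_left_eq_sub, ← smul_sub,
      ← map_sub]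
    rw [InnerProductGeometry.angle_smul_smul hr.ne']
    exact L.toLinearIsometry.angle_map _ _
  · have e1 : (fun z => x + ‖y - x‖ • L z) ⁻¹' S =
        L ⁻¹' ((‖y - x‖ • ·) ⁻¹' ((x + ·) ⁻¹' S)) := rfl
    have hS1 : MeasurableSet ((x + ·) ⁻¹' S) := measurable_const_add x hS
    rw [e1, L.measurePreserving.measure_preimage
      ((measurable_const_smul ‖y - x‖ hS1).nullMeasurableSet),
      Measure.addHaar_preimage_smul _ hr.ne', measure_preimage_add, ← mul_assoc,
      finrank_euclideanSpace, Fintype.card_fin, abs_of_pos (by positivity),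
      ENNReal.ofReal_inv_of_pos (by positivity), edist_dist, hr2, ENNReal.ofReal_pow hr.le,
      ENNReal.mul_inv_cancel, one_mul]
    · exact pow_ne_zero _ (by simpa using hr)
    · exact ENNReal.pow_ne_top ENNReal.ofReal_ne_top

theorem volume_spindle {m : ℕ} {x y : EuclideanSpace ℝ (Fin (m + 1))} (hxy : x ≠ y) (t : ℝ) :
    volume (spindle t x y) = edist x y ^ (m + 1) *
      volume (spindle t 0 (axisPoint 1 (0 : EuclideanSpace ℝ (Fin m)))) := by
  obtain ⟨φ, -, h1, -, h3, h4⟩ := exists_similarity_axis hxy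
  rw [h4 _ (measurableSet_spindle t x y)]
  congr 2
  have hx : φ 0 = x := by rw [← axisPoint_zero_zero, h1]; simp
  have hy : φ (axisPoint 1 0) = y := by rw [h1]; simp
  ext z
  simp only [spindle, Set.mem_preimage, Set.mem_ofPred_eq]
  rw [← hx, ← hy, h3]

theorem exists_axisPoint {m : ℕ} (z : EuclideanSpace ℝ (Fin (m + 1))) :
    ∃ s w, z = axisPoint s w :=
  ⟨z 0, WithLp.toLp 2 fun i => z i.succ, by
    ext i; refine Fin.cases ?_ (fun i => ?_) i <;> simp [axisPoint]⟩

theorem spindle_self {d : ℕ} {t : ℝ} (ht : t < Real.pi / 2) (x : EuclideanSpace ℝ (Fin d)) :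
    spindle t x x = ∅ := by
  ext z
  simp only [spindle, Set.mem_ofPred_eq, Set.mem_empty_iff_false, iff_false, not_lt]
  have := Real.pi_pos
  by_cases h : x = z
  -- By convention the angle is `π / 2` when the apex coincides with an endpoint.
  · rw [h, EuclideanGeometry.angle_self_left]; linarith
  · rw [EuclideanGeometry.angle_self_of_ne h]; linarith

/-- Thin spindles over segments inside an open convex set stay inside the set. -/
theorem eventually_spindle_subset {m : ℕ} {U : Set (EuclideanSpace ℝ (Fin (m + 1)))}
    (hU : IsOpen U) (hUc : Convex ℝ U) {x y : EuclideanSpace ℝ (Fin (m + 1))} (hx : x ∈ U)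
    (hy : y ∈ U) : ∀ᶠ t : ℝ in 𝓝[>] 0, spindle t x y ⊆ U := by
  by_cases hxy : x = y
  · filter_upwards [eventually_lt_of_pos (half_pos Real.pi_pos)] with t ht
    rw [hxy, spindle_self ht]
    exact Set.empty_subset _
  obtain ⟨φ, hsurj, h1, h2, h3, -⟩ := exists_similarity_axis hxy
  have hseg : segment ℝ x y ⊆ U := hUc.segment_subset hx hy
  have hcomp : IsCompact (segment ℝ x y) := by
    rw [segment_eq_image_lineMap]
    exact isCompact_Icc.image AffineMap.lineMap_continuous
  -- The open set contains a neighbourhood of the compact segment, and the spindle lies within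
  -- distance `2 * t * dist x y` of it.
  obtain ⟨δ, hδ, hthick⟩ := hcomp.exists_thickening_subset_open hU hseg
  have hd : 0 < dist x y := dist_pos.2 hxy
  filter_upwards [eventually_lt_of_pos (half_pos Real.pi_pos), eventually_tan_le,
    eventually_lt_of_pos (c := δ / (2 * dist x y)) (by positivity)] with t ht1 ht2 ht3
  intro z hz
  obtain ⟨z, rfl⟩ := hsurj z
  obtain ⟨s, w, rfl⟩ := exists_axisPoint z
  have hx' : φ 0 = x := by rw [← axisPoint_zero_zero, h1]; simp
  have hy' : φ (axisPoint 1 0) = y := by rw [h1]; simp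
  have hz' : axisPoint s w ∈ spindle t 0 (axisPoint 1 0) := by
    simp only [spindle, Set.mem_ofPred_eq] at hz ⊢
    rwa [← hx', ← hy', h3] at hz
  obtain ⟨hs0, hs1, hw⟩ := bounds_of_axisPoint_mem_spindle ht1 hz'
  refine hthick (Metric.mem_thickening_iff.2 ⟨φ (axisPoint s 0), ?_, ?_⟩)
  · rw [h1]
    exact ⟨1 - s, s, by linarith, hs0.le, by ring, by
      rw [smul_sub, sub_smul, one_smul]; abel⟩
  · rw [h2, dist_eq_norm (axisPoint s w)]
    have : axisPoint s w - axisPoint s 0 = axisPoint 0 w := by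
      rw [sub_eq_iff_eq_add, axisPoint_add, zero_add, add_zero]
    rw [this, norm_axisPoint_zero_left]
    rw [lt_div_iff₀ (by positivity)] at ht3
    have hwt : ‖w‖ < 2 * t := by nlinarith [norm_nonneg w]
    nlinarith

/-- Convexity of `U` enters here: the whole spindle over a segment with endpoints in `U` is
eventually contained in `U`, so that no boundary term appears. -/
theorem tendsto_volume_inter_spindle_div {m : ℕ} {U : Set (EuclideanSpace ℝ (Fin (m + 1)))}
    (hU : IsOpen U) (hUc : Convex ℝ U) {x y : EuclideanSpace ℝ (Fin (m + 1))} (hx : x ∈ U)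
    (hy : y ∈ U) :
    Tendsto (fun t : ℝ => volume (U ∩ spindle t x y) / ENNReal.ofReal t ^ m) (𝓝[>] 0)
      (𝓝 (edist x y ^ (m + 1) * spindleConst m)) := by
  by_cases hxy : x = y
  · subst hxy
    simp only [edist_self, ne_eq, Nat.add_eq_zero_iff, one_ne_zero, and_false, not_false_eq_true,
      zero_pow, zero_mul]
    refine tendsto_const_nhds.congr' ?_
    filter_upwards [eventually_lt_of_pos (half_pos Real.pi_pos)] with t ht
    simp [spindle_self ht]
  · have h := ENNReal.Tendsto.const_mul (tendsto_volume_spindle_axis_div (m := m))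
      (a := edist x y ^ (m + 1)) (Or.inr (ENNReal.pow_ne_top (edist_ne_top x y)))
    refine h.congr' ?_
    filter_upwards [eventually_spindle_subset hU hUc hx hy] with t ht
    rw [Set.inter_eq_right.2 ht, volume_spindle hxy, mul_div_assoc]

theorem volume_inter_spindle_le {m : ℕ} (U : Set (EuclideanSpace ℝ (Fin (m + 1))))
    (x y : EuclideanSpace ℝ (Fin (m + 1))) {t : ℝ} (ht : t < Real.pi / 2) :
    volume (U ∩ spindle t x y) ≤ edist x y ^ (m + 1) *
      volume (spindle t 0 (axisPoint 1 (0 : EuclideanSpace ℝ (Fin m)))) := by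
  by_cases hxy : x = y
  · simp [hxy, spindle_self ht]
  · rw [← volume_spindle hxy]
    exact measure_mono Set.inter_subset_right

theorem spindleConst_ne_top (m : ℕ) : spindleConst m ≠ ⊤ := by
  refine ENNReal.mul_ne_top measure_ball_lt_top.ne ?_
  refine ne_top_of_le_ne_top (b := ∫⁻ _ in Set.Ioo (0 : ℝ) 1, 1) (by simp) ?_
  refine setLIntegral_mono measurable_const fun s hs => ?_
  rw [ENNReal.ofReal_le_one]
  exact pow_le_one₀ (mul_nonneg hs.1.le (sub_pos.2 hs.2).le) (by nlinarith [hs.1, hs.2])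

theorem measurableSet_mem_spindle {d : ℕ} (t : ℝ) :
    MeasurableSet {p : EuclideanSpace ℝ (Fin d) × EuclideanSpace ℝ (Fin d) ×
      EuclideanSpace ℝ (Fin d) | p.1 ∈ spindle t p.2.1 p.2.2} := by
  have h : Measurable fun p : EuclideanSpace ℝ (Fin d) × EuclideanSpace ℝ (Fin d) ×
      EuclideanSpace ℝ (Fin d) => (p.2.1, p.1, p.2.2) := by fun_prop
  have h2 := measurable_euclideanAngle.comp h
  exact measurableSet_lt measurable_const h2

/-! ### Flat triangles in a convex set -/

/-- The `d`-th moment integral of the distance of two points of `U ⊆ ℝ ^ d`. -/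
noncomputable def distanceMoment {d : ℕ} (U : Set (EuclideanSpace ℝ (Fin d))) : ENNReal :=
  ∫⁻ p in U ×ˢ U, edist p.1 p.2 ^ d

/-- Averaging the volume of the spindle over its endpoints produces the distance moment. -/
theorem tendsto_lintegral_volume_inter_spindle {m : ℕ}
    {U : Set (EuclideanSpace ℝ (Fin (m + 1)))}
    (hU : IsOpen U) (hUc : Convex ℝ U) (hUb : Bornology.IsBounded U) :
    Tendsto (fun t : ℝ => (∫⁻ p in U ×ˢ U, volume (U ∩ spindle t p.1 p.2)) / ENNReal.ofReal t ^ m)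
      (𝓝[>] 0) (𝓝 (distanceMoment U * spindleConst m)) := by
  have hmeas : ∀ t : ℝ, Measurable fun p : EuclideanSpace ℝ (Fin (m + 1)) ×
      EuclideanSpace ℝ (Fin (m + 1)) => volume (U ∩ spindle t p.1 p.2) := fun t =>
    measurable_measure_prodMk_right (s := {p : EuclideanSpace ℝ (Fin (m + 1)) ×
      EuclideanSpace ℝ (Fin (m + 1)) × EuclideanSpace ℝ (Fin (m + 1)) |
        p.1 ∈ U ∧ p.1 ∈ spindle t p.2.1 p.2.2})
      ((measurable_fst hU.measurableSet).inter (measurableSet_mem_spindle t))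
  have hUU : MeasurableSet (U ×ˢ U) := hU.measurableSet.prod hU.measurableSet
  have hlim : Tendsto (fun t : ℝ => ∫⁻ p in U ×ˢ U,
      volume (U ∩ spindle t p.1 p.2) / ENNReal.ofReal t ^ m) (𝓝[>] 0)
      (𝓝 (∫⁻ p in U ×ˢ U, edist p.1 p.2 ^ (m + 1) * spindleConst m)) := by
    refine tendsto_lintegral_filter_of_dominated_convergence
      (fun _ => ENNReal.ofReal (Metric.diam U) ^ (m + 1) * (spindleConst m + 1))
      (Eventually.of_forall fun t => (hmeas t).div_const _) ?_ ?_ ?_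
    · have h1 := (tendsto_volume_spindle_axis_div (m := m)).eventually_le_const
        (ENNReal.lt_add_right (spindleConst_ne_top m) one_ne_zero)
      filter_upwards [h1, eventually_lt_of_pos (half_pos Real.pi_pos)] with t h1 h2
      rw [ae_restrict_iff' hUU]
      refine ae_of_all _ fun p hp => ?_
      calc _ ≤ edist p.1 p.2 ^ (m + 1) *
          volume (spindle t 0 (axisPoint 1 (0 : EuclideanSpace ℝ (Fin m)))) /
            ENNReal.ofReal t ^ m := by gcongr; exact volume_inter_spindle_le U _ _ h2
        _ ≤ _ := by
          rw [mul_div_assoc]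
          gcongr
          rw [edist_dist]
          exact ENNReal.ofReal_le_ofReal (Metric.dist_le_diam_of_mem hUb hp.1 hp.2)
    · have : volume (U ×ˢ U) ≠ ⊤ := by
        rw [Measure.volume_eq_prod, Measure.prod_prod]
        exact ENNReal.mul_ne_top hUb.measure_lt_top.ne hUb.measure_lt_top.ne
      rw [setLIntegral_const]
      exact ENNReal.mul_ne_top (ENNReal.mul_ne_top (ENNReal.pow_ne_top ENNReal.ofReal_ne_top)
        (ENNReal.add_ne_top.2 ⟨spindleConst_ne_top m, ENNReal.one_ne_top⟩)) this
    · rw [ae_restrict_iff' hUU]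
      exact ae_of_all _ fun p hp => tendsto_volume_inter_spindle_div hU hUc hp.1 hp.2
  rw [lintegral_mul_const' _ _ (spindleConst_ne_top m)] at hlim
  refine hlim.congr fun t => ?_
  simp only [div_eq_mul_inv]
  rw [lintegral_mul_const _ (hmeas t)]

/-- The triples of points of `U` whose triangle has an angle larger than `π - t`. -/
def flatTriples {d : ℕ} (U : Set (EuclideanSpace ℝ (Fin d))) (t : ℝ) :
    Set (EuclideanSpace ℝ (Fin d) × EuclideanSpace ℝ (Fin d) × EuclideanSpace ℝ (Fin d)) :=
  {p | (p.1 ∈ U ∧ p.2.1 ∈ U ∧ p.2.2 ∈ U) ∧ Real.pi - t < largestTriangleAngle p.1 p.2.1 p.2.2}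

theorem lt_largestTriangleAngle_iff {d : ℕ} {t : ℝ} {x y z : EuclideanSpace ℝ (Fin d)} :
    Real.pi - t < largestTriangleAngle x y z ↔
      x ∈ spindle t y z ∨ y ∈ spindle t x z ∨ z ∈ spindle t x y := by
  simp only [largestTriangleAngle, lt_max_iff, spindle, Set.mem_ofPred_eq]

theorem spindle_comm {d : ℕ} (t : ℝ) (x y : EuclideanSpace ℝ (Fin d)) :
    spindle t x y = spindle t y x := by
  ext z; simp only [spindle, Set.mem_ofPred_eq, EuclideanGeometry.angle_comm]

theorem flatTriples_swap_left {d : ℕ} {U : Set (EuclideanSpace ℝ (Fin d))} {t : ℝ}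
    (x y z : EuclideanSpace ℝ (Fin d)) (h : (x, y, z) ∈ flatTriples U t) :
    (y, x, z) ∈ flatTriples U t := by
  simp only [flatTriples, Set.mem_ofPred_eq, lt_largestTriangleAngle_iff] at h ⊢
  rw [spindle_comm t y x]
  tauto

theorem flatTriples_swap_right {d : ℕ} {U : Set (EuclideanSpace ℝ (Fin d))} {t : ℝ}
    (x y z : EuclideanSpace ℝ (Fin d)) (h : (x, y, z) ∈ flatTriples U t) :
    (x, z, y) ∈ flatTriples U t := by
  simp only [flatTriples, Set.mem_ofPred_eq, lt_largestTriangleAngle_iff] at h ⊢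
  rw [spindle_comm t z y]
  tauto

/-- A triangle has at most one obtuse angle. In degenerate triangles this relies on the value
`π / 2` of angles with a vanishing side. -/
theorem notMem_spindle_of_mem_spindle {d : ℕ} {t : ℝ} (ht : t < Real.pi / 2)
    {x y z : EuclideanSpace ℝ (Fin d)} (h : x ∈ spindle t y z) : y ∉ spindle t x z := by
  intro h2
  have hxy : y ≠ x := by
    rintro rfl
    simp only [spindle, Set.mem_ofPred_eq, EuclideanGeometry.angle_self_left] at h
    linarith
  have h3 := EuclideanGeometry.angle_add_angle_add_angle_eq_pi z hxy
  have h4 := EuclideanGeometry.angle_nonneg y z x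
  simp only [spindle, Set.mem_ofPred_eq] at h h2
  rw [EuclideanGeometry.angle_comm] at h
  linarith

/-- The large angle of a flat triangle sits at exactly one of its vertices, whence the factor
`3`. -/
theorem volume_flatTriples {d : ℕ} {U : Set (EuclideanSpace ℝ (Fin d))} (hU : MeasurableSet U)
    {t : ℝ} (ht : t < Real.pi / 2) :
    volume (flatTriples U t) = 3 * ∫⁻ p in U ×ˢ U, volume (U ∩ spindle t p.1 p.2) := by
  set A : Set (EuclideanSpace ℝ (Fin d) × EuclideanSpace ℝ (Fin d) × EuclideanSpace ℝ (Fin d)) :=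
    {p | (p.1 ∈ U ∧ p.2.1 ∈ U ∧ p.2.2 ∈ U) ∧ p.1 ∈ spindle t p.2.1 p.2.2} with hA
  have hAm : MeasurableSet A := by
    refine MeasurableSet.inter ?_ (measurableSet_mem_spindle t)
    exact (measurable_fst hU).inter (((measurable_fst.comp measurable_snd) hU).inter
      ((measurable_snd.comp measurable_snd) hU))
  have hA1 : volume A = ∫⁻ p in U ×ˢ U, volume (U ∩ spindle t p.1 p.2) := by
    rw [Measure.volume_eq_prod, Measure.prod_apply_symm hAm,
      ← lintegral_indicator (hU.prod hU)]
    refine lintegral_congr fun p => ?_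
    by_cases hp : p ∈ U ×ˢ U
    · rw [Set.indicator_of_mem hp]
      congr 1
      ext x
      simp only [hA, Set.mem_preimage, Set.mem_ofPred_eq, Set.mem_inter_iff]
      exact ⟨fun h => ⟨h.1.1, h.2⟩, fun h => ⟨⟨h.1, hp.1, hp.2⟩, h.2⟩⟩
    · rw [Set.indicator_of_notMem hp]
      have : (fun x => (x, p)) ⁻¹' A = ∅ := by
        ext x
        simp only [hA, Set.mem_preimage, Set.mem_ofPred_eq, Set.mem_empty_iff_false, iff_false]
        exact fun h => hp ⟨h.1.2.1, h.1.2.2⟩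
      rw [this, measure_empty]
  have hlin : ∀ S : Set (EuclideanSpace ℝ (Fin d) × EuclideanSpace ℝ (Fin d) ×
      EuclideanSpace ℝ (Fin d)), MeasurableSet S →
      volume S = ∫⁻ x, ∫⁻ y, ∫⁻ z, S.indicator 1 (x, y, z) := fun S hS => by
    have h1 : Measurable (S.indicator (1 : EuclideanSpace ℝ (Fin d) × EuclideanSpace ℝ (Fin d) ×
        EuclideanSpace ℝ (Fin d) → ENNReal)) := measurable_one.indicator hS
    rw [← lintegral_indicator_one hS, Measure.volume_eq_prod, lintegral_prod _ h1.aemeasurable]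
    refine lintegral_congr fun x => ?_
    rw [Measure.volume_eq_prod, lintegral_prod]
    exact (h1.comp (by fun_prop : Measurable fun p : EuclideanSpace ℝ (Fin d) ×
      EuclideanSpace ℝ (Fin d) => (x, p))).aemeasurable
  have hAi : Measurable (A.indicator (1 : EuclideanSpace ℝ (Fin d) × EuclideanSpace ℝ (Fin d) ×
        EuclideanSpace ℝ (Fin d) → ENNReal)) := measurable_one.indicator hAm
  set σ₂ : EuclideanSpace ℝ (Fin d) × EuclideanSpace ℝ (Fin d) × EuclideanSpace ℝ (Fin d) →
    EuclideanSpace ℝ (Fin d) × EuclideanSpace ℝ (Fin d) × EuclideanSpace ℝ (Fin d) :=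
    fun p => (p.2.1, p.1, p.2.2) with hσ₂
  set σ₃ : EuclideanSpace ℝ (Fin d) × EuclideanSpace ℝ (Fin d) × EuclideanSpace ℝ (Fin d) →
    EuclideanSpace ℝ (Fin d) × EuclideanSpace ℝ (Fin d) × EuclideanSpace ℝ (Fin d) :=
    fun p => (p.2.2, p.1, p.2.1) with hσ₃
  have hm₂ : Measurable σ₂ := by fun_prop
  have hm₃ : Measurable σ₃ := by fun_prop
  have hA2 : volume (σ₂ ⁻¹' A) = volume A := by
    rw [hlin _ (hm₂ hAm), hlin _ hAm, lintegral_lintegral_swap]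
    · rfl
    · exact (Measurable.lintegral_prod_right' (f := fun q : (EuclideanSpace ℝ (Fin d) ×
        EuclideanSpace ℝ (Fin d)) × EuclideanSpace ℝ (Fin d) =>
        (σ₂ ⁻¹' A).indicator (1 : EuclideanSpace ℝ (Fin d) × EuclideanSpace ℝ (Fin d) ×
        EuclideanSpace ℝ (Fin d) → ENNReal) (q.1.1, q.1.2, q.2))
        ((measurable_one.indicator (hm₂ hAm)).comp (by fun_prop))).aemeasurable
  have hA3 : volume (σ₃ ⁻¹' A) = volume A := by
    rw [hlin _ (hm₃ hAm), hlin _ hAm]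
    have h1 : ∀ x : EuclideanSpace ℝ (Fin d), ∫⁻ y, ∫⁻ z, (σ₃ ⁻¹' A).indicator
        (1 : EuclideanSpace ℝ (Fin d) × EuclideanSpace ℝ (Fin d) × EuclideanSpace ℝ (Fin d) →
          ENNReal) (x, y, z) = ∫⁻ z, ∫⁻ y, A.indicator 1 (z, x, y) := fun x => by
      rw [lintegral_lintegral_swap]
      · rfl
      · exact ((measurable_one.indicator (hm₃ hAm)).comp (by fun_prop : Measurable
          fun p : EuclideanSpace ℝ (Fin d) × EuclideanSpace ℝ (Fin d) =>
            (x, p.1, p.2))).aemeasurable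
    simp only [h1]
    rw [lintegral_lintegral_swap]
    exact (Measurable.lintegral_prod_right' (f := fun q : (EuclideanSpace ℝ (Fin d) ×
        EuclideanSpace ℝ (Fin d)) × EuclideanSpace ℝ (Fin d) =>
        A.indicator (1 : EuclideanSpace ℝ (Fin d) × EuclideanSpace ℝ (Fin d) ×
        EuclideanSpace ℝ (Fin d) → ENNReal) (q.1.2, q.1.1, q.2))
        (hAi.comp (by fun_prop))).aemeasurable
  have hunion : flatTriples U t = A ∪ (σ₂ ⁻¹' A ∪ σ₃ ⁻¹' A) := by
    ext ⟨x, y, z⟩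
    simp only [flatTriples, lt_largestTriangleAngle_iff, hA, hσ₂, hσ₃, Set.mem_union,
      Set.mem_preimage, Set.mem_ofPred_eq]
    tauto
  have hd12 : Disjoint A (σ₂ ⁻¹' A ∪ σ₃ ⁻¹' A) := by
    rw [Set.disjoint_left]
    rintro ⟨x, y, z⟩ h1 (h2 | h2)
    · exact notMem_spindle_of_mem_spindle ht h1.2 h2.2
    · have h3 : x ∈ spindle t z y := by rw [spindle_comm]; exact h1.2
      exact notMem_spindle_of_mem_spindle ht h3 h2.2
  have hd23 : Disjoint (σ₂ ⁻¹' A) (σ₃ ⁻¹' A) := by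
    rw [Set.disjoint_left]
    rintro ⟨x, y, z⟩ h1 h2
    have h3 : y ∈ spindle t z x := by rw [spindle_comm]; exact h1.2
    have h4 : z ∈ spindle t y x := by rw [spindle_comm]; exact h2.2
    exact notMem_spindle_of_mem_spindle ht h3 h4
  rw [hunion, measure_union hd12 ((hm₂ hAm).union (hm₃ hAm)), measure_union hd23 (hm₃ hAm), hA2,
    hA3, hA1]
  ring

theorem measurableSet_flatTriples {d : ℕ} {U : Set (EuclideanSpace ℝ (Fin d))}
    (hU : MeasurableSet U) (t : ℝ) : MeasurableSet (flatTriples U t) := by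
  refine MeasurableSet.inter ((measurable_fst hU).inter (((measurable_fst.comp measurable_snd)
    hU).inter ((measurable_snd.comp measurable_snd) hU))) ?_
  have h1 : Measurable fun p : EuclideanSpace ℝ (Fin d) × EuclideanSpace ℝ (Fin d) ×
      EuclideanSpace ℝ (Fin d) => (p.2.1, p.1, p.2.2) := by fun_prop
  have h2 : Measurable fun p : EuclideanSpace ℝ (Fin d) × EuclideanSpace ℝ (Fin d) ×
      EuclideanSpace ℝ (Fin d) => (p.1, p.2.2, p.2.1) := by fun_prop
  exact measurableSet_lt measurable_const ((measurable_euclideanAngle.comp h1).max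
    (measurable_euclideanAngle.max (measurable_euclideanAngle.comp h2)))

/-- Given two vertices in a set of diameter at most `D`, the third vertex of a flat triangle lies
in a cylinder of radius `D t` about the line through them. -/
theorem volume_flatTriples_section_le {m : ℕ} {U : Set (EuclideanSpace ℝ (Fin (m + 1)))}
    (hU : MeasurableSet U) {D : ℝ} (hD : ∀ x ∈ U, ∀ y ∈ U, dist x y ≤ D) {t : ℝ} (ht0 : 0 < t)
    (ht : t < Real.pi / 2) (x y : EuclideanSpace ℝ (Fin (m + 1))) :
    volume {z | (x, y, z) ∈ flatTriples U t} ≤ ENNReal.ofReal (2 * D) *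
      (volume (Metric.closedBall (0 : EuclideanSpace ℝ (Fin m)) 1) *
        ENNReal.ofReal (D * t) ^ m) := by
  by_cases hUxy : x ∈ U ∧ y ∈ U
  swap
  · have : {z | (x, y, z) ∈ flatTriples U t} = ∅ := by
      ext z
      simp only [flatTriples, Set.mem_ofPred_eq, Set.mem_empty_iff_false, iff_false]
      exact fun h => hUxy ⟨h.1.1, h.1.2.1⟩
    rw [this, measure_empty]
    exact zero_le
  have hpi := Real.pi_pos
  by_cases hxy : x = y
  · have : {z | (x, y, z) ∈ flatTriples U t} = ∅ := by
      ext z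
      simp only [flatTriples, Set.mem_ofPred_eq, Set.mem_empty_iff_false, iff_false, hxy,
        lt_largestTriangleAngle_iff, spindle_self ht]
      simp only [spindle, Set.mem_ofPred_eq, EuclideanGeometry.angle_self_left]
      rintro ⟨-, h | h | h⟩
      · linarith
      · linarith
      · exact h
    rw [this, measure_empty]
    exact zero_le
  have hr : 0 < dist x y := dist_pos.2 hxy
  have hD0 : 0 < D := hr.trans_le (hD x hUxy.1 y hUxy.2)
  obtain ⟨φ, -, h1, h2, h3, h4⟩ := exists_similarity_axis hxy
  have hx' : φ 0 = x := by rw [← axisPoint_zero_zero, h1]; simp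
  have hy' : φ (axisPoint 1 0) = y := by rw [h1]; simp
  set C : Set (EuclideanSpace ℝ (Fin (m + 1))) := {z | ∃ s w, z = axisPoint s w ∧
    |s| ≤ D / dist x y ∧ ‖w‖ ≤ D * t / dist x y} with hC
  have hsub : φ ⁻¹' {z | (x, y, z) ∈ flatTriples U t} ⊆ C := by
    intro z hz
    obtain ⟨s, w, rfl⟩ := exists_axisPoint z
    simp only [flatTriples, Set.mem_preimage, Set.mem_ofPred_eq, lt_largestTriangleAngle_iff] at hz
    obtain ⟨⟨-, -, hzU⟩, hz⟩ := hz
    -- In the coordinates in which `x` is the origin and `y` the unit point of the axis, the third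
    -- vertex is within `D / dist x y` of the origin, and its direction makes an angle `θ` with the
    -- axis which is within `t` of `0` or `π`.
    have hnorm : ‖axisPoint s w‖ ≤ D / dist x y := by
      rw [le_div_iff₀ hr]
      have := hD _ hzU x hUxy.1
      rw [← hx', h2, dist_zero_right] at this
      linarith
    have hs : |s| ≤ ‖axisPoint s w‖ := by
      refine abs_le_of_sq_le_sq ?_ (norm_nonneg _)
      rw [norm_axisPoint_sq]; nlinarith [sq_nonneg ‖w‖]
    refine ⟨s, w, rfl, hs.trans hnorm, ?_⟩
    set θ := InnerProductGeometry.angle (axisPoint 1 (0 : EuclideanSpace ℝ (Fin m)))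
      (axisPoint s w) with hθ
    have hθe : EuclideanGeometry.angle y x (φ (axisPoint s w)) = θ := by
      rw [← hx', ← hy', h3]
      simp [EuclideanGeometry.angle, hθ]
    have hθ0 : 0 ≤ θ := InnerProductGeometry.angle_nonneg _ _
    have hθpi : θ ≤ Real.pi := InnerProductGeometry.angle_le_pi _ _
    have hsum := EuclideanGeometry.angle_add_angle_add_angle_eq_pi (φ (axisPoint s w)) (Ne.symm hxy)
    rw [EuclideanGeometry.angle_comm _ x y, hθe] at hsum
    have hn1 := EuclideanGeometry.angle_nonneg x y (φ (axisPoint s w))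
    have hn2 := EuclideanGeometry.angle_nonneg y (φ (axisPoint s w)) x
    have hsin : Real.sin θ ≤ t := by
      simp only [spindle, Set.mem_ofPred_eq, hθe] at hz
      rcases hz with hz | hz | hz
      · rw [← Real.sin_pi_sub]
        exact (Real.sin_le (by linarith)).trans (by linarith)
      · exact (Real.sin_le hθ0).trans (by linarith)
      · rw [EuclideanGeometry.angle_comm] at hz
        exact (Real.sin_le hθ0).trans (by linarith)
    have hw : ‖w‖ = Real.sin θ * ‖axisPoint s w‖ := by
      have h5 := InnerProductGeometry.sin_angle_mul_norm_mul_norm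
        (axisPoint 1 (0 : EuclideanSpace ℝ (Fin m))) (axisPoint s w)
      simp only [inner_axisPoint, norm_axisPoint_zero_right, inner_zero_left,
        real_inner_self_eq_norm_sq, abs_one, one_mul, add_zero] at h5
      rw [← hθ] at h5
      have h6 : 1 ^ 2 * ‖axisPoint s w‖ ^ 2 - s * s = ‖w‖ ^ 2 := by rw [norm_axisPoint_sq]; ring
      rw [h5, h6, Real.sqrt_sq (norm_nonneg _)]
    rw [hw]
    calc Real.sin θ * ‖axisPoint s w‖ ≤ t * (D / dist x y) := by gcongr
      _ = D * t / dist x y := by ring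
  have hSm : MeasurableSet {z | (x, y, z) ∈ flatTriples U t} :=
    (by fun_prop : Measurable fun z : EuclideanSpace ℝ (Fin (m + 1)) => (x, y, z))
      (measurableSet_flatTriples hU t)
  have hCvol : volume C ≤ ENNReal.ofReal (2 * (D / dist x y)) *
      (volume (Metric.closedBall (0 : EuclideanSpace ℝ (Fin m)) 1) *
        ENNReal.ofReal (D * t / dist x y) ^ m) := by
    have hCm : MeasurableSet C := by
      have : C = {z : EuclideanSpace ℝ (Fin (m + 1)) | |z 0| ≤ D / dist x y ∧
          ‖(WithLp.toLp 2 fun i : Fin m => z i.succ : EuclideanSpace ℝ (Fin m))‖ ≤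
            D * t / dist x y} := by
        ext z
        simp only [hC, Set.mem_ofPred_eq]
        constructor
        · rintro ⟨s, w, rfl, h5, h6⟩
          simpa [axisPoint] using ⟨h5, h6⟩
        · rintro ⟨h5, h6⟩
          refine ⟨z 0, _, ?_, h5, h6⟩
          ext i; refine Fin.cases ?_ (fun i => ?_) i <;> simp [axisPoint]
      rw [this]
      refine (IsClosed.inter ?_ ?_).measurableSet
      · have hc : Continuous fun z : EuclideanSpace ℝ (Fin (m + 1)) => |z 0| := by fun_prop
        exact isClosed_le hc continuous_const
      · refine isClosed_le (continuous_norm.comp ?_) continuous_const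
        exact (PiLp.continuous_toLp 2 _).comp (continuous_pi fun i => by fun_prop)
    have hCiff : ∀ s w, axisPoint s w ∈ C ↔ |s| ≤ D / dist x y ∧ ‖w‖ ≤ D * t / dist x y := by
      intro s w
      constructor
      · rintro ⟨s', w', h5, h6⟩
        have h7 : s = s' := by simpa [axisPoint] using congrArg (fun z => z 0) h5
        have h8 : w = w' := by
          ext i
          simpa [axisPoint] using congrArg (fun z => z i.succ) h5
        rw [h7, h8]; exact h6
      · exact fun h => ⟨s, w, rfl, h⟩
    rw [← lintegral_indicator_one hCm, lintegral_axisPoint (measurable_one.indicator hCm)]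
    have h5 : ∀ s : ℝ, ∫⁻ w : EuclideanSpace ℝ (Fin m),
        C.indicator (1 : EuclideanSpace ℝ (Fin (m + 1)) → ENNReal) (axisPoint s w) =
          (Set.Icc (-(D / dist x y)) (D / dist x y)).indicator
          (fun _ => volume (Metric.closedBall (0 : EuclideanSpace ℝ (Fin m)) (D * t / dist x y)))
          s := by
      intro s
      rw [← lintegral_indicator_one Metric.isClosed_closedBall.measurableSet]
      by_cases hs : s ∈ Set.Icc (-(D / dist x y)) (D / dist x y)
      · rw [Set.indicator_of_mem hs]
        refine lintegral_congr fun w => ?_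
        by_cases hw : w ∈ Metric.closedBall (0 : EuclideanSpace ℝ (Fin m)) (D * t / dist x y)
        · rw [Set.indicator_of_mem hw, Set.indicator_of_mem]; · rfl
          exact (hCiff s w).2 ⟨abs_le.2 hs, by simpa using hw⟩
        · rw [Set.indicator_of_notMem hw, Set.indicator_of_notMem]
          exact fun h => hw (by simpa using ((hCiff s w).1 h).2)
      · rw [Set.indicator_of_notMem hs]
        refine (lintegral_congr fun w => ?_).trans lintegral_zero
        rw [Set.indicator_of_notMem]
        exact fun h => hs (abs_le.1 ((hCiff s w).1 h).1)
    simp only [h5]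
    rw [lintegral_indicator_const measurableSet_Icc, Real.volume_Icc,
      Measure.addHaar_closedBall' _ _ (by positivity), finrank_euclideanSpace, Fintype.card_fin,
      mul_comm, ENNReal.ofReal_pow (by positivity), mul_comm (ENNReal.ofReal _ ^ m)]
    apply le_of_eq
    congr 2
    ring
  rw [h4 _ hSm]
  calc _ ≤ edist x y ^ (m + 1) * volume C := by gcongr
    _ ≤ edist x y ^ (m + 1) * (ENNReal.ofReal (2 * (D / dist x y)) *
      (volume (Metric.closedBall (0 : EuclideanSpace ℝ (Fin m)) 1) *
        ENNReal.ofReal (D * t / dist x y) ^ m)) := by gcongr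
    _ = (edist x y * ENNReal.ofReal (2 * (D / dist x y))) *
      (volume (Metric.closedBall (0 : EuclideanSpace ℝ (Fin m)) 1) *
        (edist x y * ENNReal.ofReal (D * t / dist x y)) ^ m) := by
        rw [mul_pow]; ring
    _ = _ := by
        have e1 : dist x y * (2 * (D / dist x y)) = 2 * D := by field_simp
        have e2 : dist x y * (D * t / dist x y) = D * t := by field_simp
        rw [edist_dist, ← ENNReal.ofReal_mul hr.le, ← ENNReal.ofReal_mul hr.le, e1, e2]

/-! ### The limit law in a fixed dimension -/

/-- The uniform distribution on a set of finite positive volume. -/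
noncomputable def uniformLaw {d : ℕ} (U : Set (EuclideanSpace ℝ (Fin d))) :
    Measure (EuclideanSpace ℝ (Fin d)) :=
  (volume U)⁻¹ • volume.restrict U

theorem isProbabilityMeasure_uniformLaw {d : ℕ} {U : Set (EuclideanSpace ℝ (Fin d))}
    (h0 : volume U ≠ 0) (h1 : volume U ≠ ⊤) : IsProbabilityMeasure (uniformLaw U) :=
  ⟨by simp [uniformLaw, ENNReal.inv_mul_cancel h0 h1]⟩

theorem uniformLaw_prod_flatTriples {d : ℕ} {U : Set (EuclideanSpace ℝ (Fin d))}
    (hU : MeasurableSet U) (h0 : volume U ≠ 0) (h1 : volume U ≠ ⊤) {t : ℝ}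
    (ht : t < Real.pi / 2) :
    (uniformLaw U).prod ((uniformLaw U).prod (uniformLaw U)) (flatTriples U t) =
      (volume U)⁻¹ ^ 3 * (3 * ∫⁻ p in U ×ˢ U, volume (U ∩ spindle t p.1 p.2)) := by
  have hne : (volume U)⁻¹ ≠ ⊤ := ENNReal.inv_ne_top.2 h0
  have : SFinite ((volume U)⁻¹ • volume.restrict U) := by
    have := isProbabilityMeasure_uniformLaw h0 h1
    change SFinite (uniformLaw U)
    infer_instance
  rw [← volume_flatTriples hU ht]
  simp only [uniformLaw]
  rw [Measure.prod_smul_left, Measure.prod_smul_left, Measure.prod_smul_right,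
    Measure.prod_smul_right, Measure.prod_smul_right,
    Measure.prod_restrict, Measure.prod_restrict]
  simp only [Measure.smul_apply, smul_eq_mul]
  rw [Measure.restrict_apply (measurableSet_flatTriples hU t), Set.inter_eq_left.2]
  · simp only [Measure.volume_eq_prod]; ring
  · rintro ⟨x, y, z⟩ h
    exact ⟨h.1.1, h.1.2.1, h.1.2.2⟩

/-- The rate `c` in the limit law `exp (-(c * y ^ m))` of the rescaled deficit in dimension `m + 1`.
It is the limit of the expected number of triples with an angle larger than `π - n ^ (-3 / m)`:
about `n ^ 3 / 6` triples, three possible apices, and probability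
`distanceMoment U * spindleConst m * n ^ (-3) / vol U ^ 3` for each of them. -/
noncomputable def deficitRate {m : ℕ} (U : Set (EuclideanSpace ℝ (Fin (m + 1)))) : ℝ :=
  (distanceMoment U * spindleConst m).toReal / (2 * volume.real U ^ 3)

theorem distanceMoment_ne_top {d : ℕ} {U : Set (EuclideanSpace ℝ (Fin d))}
    (hU : MeasurableSet U) (hUb : Bornology.IsBounded U) : distanceMoment U ≠ ⊤ := by
  have h : volume (U ×ˢ U) ≠ ⊤ := by
    rw [Measure.volume_eq_prod, Measure.prod_prod]
    exact ENNReal.mul_ne_top hUb.measure_lt_top.ne hUb.measure_lt_top.ne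
  refine ne_top_of_le_ne_top (b := ∫⁻ _ in U ×ˢ U, ENNReal.ofReal (Metric.diam U) ^ d) ?_ ?_
  · rw [setLIntegral_const]
    exact ENNReal.mul_ne_top (ENNReal.pow_ne_top ENNReal.ofReal_ne_top) h
  · refine setLIntegral_mono' (hU.prod hU) fun p hp => ?_
    gcongr
    rw [edist_dist]
    exact ENNReal.ofReal_le_ofReal (Metric.dist_le_diam_of_mem hUb hp.1 hp.2)

/-- The probability of having no flat triangle at scale `y * n ^ (-3 / m)`, for independent uniform
points of an open convex set. -/
theorem tendsto_measureReal_no_flatTriples {m : ℕ} (hm : m ≠ 0)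
    {U : Set (EuclideanSpace ℝ (Fin (m + 1)))} (hU : IsOpen U) (hUc : Convex ℝ U)
    (hUb : Bornology.IsBounded U) (hUne : U.Nonempty) {Ω : Type*} [MeasurableSpace Ω]
    {Pr : Measure Ω} [IsProbabilityMeasure Pr] {P : ℕ → Ω → EuclideanSpace ℝ (Fin (m + 1))}
    (hP : ∀ i, Measurable (P i)) (hind : iIndepFun P Pr)
    (hlaw : ∀ i, Pr.map (P i) = uniformLaw U) {y : ℝ} (hy : 0 < y) :
    Tendsto (fun n : ℕ => Pr.real (⋂ s ∈ triplesFinset n,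
      (tripleEvent P (flatTriples U (y * (n : ℝ) ^ (-(3 / m : ℝ)))) s)ᶜ)) atTop
      (𝓝 (Real.exp (-(deficitRate U * y ^ m)))) := by
  have h0 : volume U ≠ 0 := (hU.measure_pos volume hUne).ne'
  have h1 : volume U ≠ ⊤ := hUb.measure_lt_top.ne
  have hV : 0 < volume.real U := ENNReal.toReal_pos h0 h1
  have := isProbabilityMeasure_uniformLaw h0 h1
  have hmpos : (0 : ℝ) < m := by exact_mod_cast Nat.pos_of_ne_zero hm
  set t : ℕ → ℝ := fun n => y * (n : ℝ) ^ (-(3 / m : ℝ)) with ht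
  -- With this choice of scale the number of triples times `t n ^ m` converges.
  have htpow : ∀ n : ℕ, n ≠ 0 → t n ^ m = y ^ m / (n : ℝ) ^ 3 := fun n hn => by
    have : ((n : ℝ) ^ (-(3 / m : ℝ))) ^ m = ((n : ℝ) ^ 3)⁻¹ := by
      rw [← Real.rpow_natCast, ← Real.rpow_mul (Nat.cast_nonneg n),
        show -(3 / m : ℝ) * m = -(3 : ℕ) by field_simp; norm_num,
        Real.rpow_neg (Nat.cast_nonneg n), Real.rpow_natCast]
    rw [ht, mul_pow, this, div_eq_mul_inv]
  have htpos : ∀ n : ℕ, n ≠ 0 → 0 < t n := fun n hn => by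
    have : (0 : ℝ) < n := by exact_mod_cast Nat.pos_of_ne_zero hn
    positivity
  have ht0 : Tendsto t atTop (𝓝[>] 0) := by
    refine tendsto_nhdsWithin_iff.2 ⟨?_, ?_⟩
    · have := ((tendsto_rpow_neg_atTop (y := 3 / (m : ℝ)) (by positivity)).comp
        tendsto_natCast_atTop_atTop).const_mul y
      simpa using this
    · filter_upwards [eventually_ne_atTop 0] with n hn using htpos n hn
  have htsmall : ∀ᶠ n in atTop, t n < Real.pi / 2 :=
    ht0.eventually (eventually_lt_of_pos (half_pos Real.pi_pos))
  set D := Metric.diam U with hD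
  set κ := volume (Metric.closedBall (0 : EuclideanSpace ℝ (Fin m)) 1) with hκ
  have hκt : κ ≠ ⊤ := measure_closedBall_lt_top.ne
  set Q : ℝ := (volume.real U)⁻¹ * (2 * D * (κ.toReal * D ^ m)) with hQ
  have hD0 : 0 ≤ D := Metric.diam_nonneg
  have hq : ∀ n : ℕ, n ≠ 0 → t n < Real.pi / 2 → ∀ x z,
      (uniformLaw U).real {w | (x, z, w) ∈ flatTriples U (t n)} ≤ Q * t n ^ m := by
    intro n hn hts x z
    have hle := volume_flatTriples_section_le hU.measurableSet
      (fun a ha b hb => Metric.dist_le_diam_of_mem hUb ha hb) (htpos n hn) hts x z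
    have hle2 : uniformLaw U {w | (x, z, w) ∈ flatTriples U (t n)} ≤ (volume U)⁻¹ *
        (ENNReal.ofReal (2 * D) * (κ * ENNReal.ofReal (D * t n) ^ m)) := by
      rw [uniformLaw, Measure.smul_apply, smul_eq_mul]
      gcongr
      exact (Measure.restrict_apply_le _ _).trans hle
    calc _ ≤ ((volume U)⁻¹ *
        (ENNReal.ofReal (2 * D) * (κ * ENNReal.ofReal (D * t n) ^ m))).toReal :=
          ENNReal.toReal_mono (by finiteness) hle2
      _ = _ := by
        have := htpos n hn
        rw [ENNReal.toReal_mul, ENNReal.toReal_mul, ENNReal.toReal_mul, ENNReal.toReal_pow,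
          ENNReal.toReal_inv, ENNReal.toReal_ofReal (by positivity),
          ENNReal.toReal_ofReal (by positivity), hQ, measureReal_def]
        ring
  -- One-point sections have mass of order `n ^ (-3)`, so the error is of order `n ^ 5 * n ^ (-6)`.
  have herr : Tendsto (fun n : ℕ => 18 * (n : ℝ) ^ 5 * (Q * t n ^ m) ^ 2) atTop (𝓝 0) := by
    have h2 : Tendsto (fun n : ℕ => (18 * Q ^ 2 * (y ^ m) ^ 2) * (n : ℝ)⁻¹) atTop (𝓝 0) := by
      simpa using (tendsto_natCast_atTop_atTop (R := ℝ)).inv_tendsto_atTop.const_mul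
        (18 * Q ^ 2 * (y ^ m) ^ 2)
    refine h2.congr' ?_
    filter_upwards [eventually_ne_atTop 0] with n hn
    have hn' : (n : ℝ) ≠ 0 := by exact_mod_cast hn
    rw [htpow n hn]
    field_simp
  set J : ℝ → ENNReal := fun t =>
    (∫⁻ p in U ×ˢ U, volume (U ∩ spindle t p.1 p.2)) / ENNReal.ofReal t ^ m with hJ
  have hJlim : Tendsto (fun n => (J (t n)).toReal) atTop
      (𝓝 (distanceMoment U * spindleConst m).toReal) :=
    (ENNReal.tendsto_toReal (ENNReal.mul_ne_top (distanceMoment_ne_top hU.measurableSet hUb)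
      (spindleConst_ne_top m))).comp ((tendsto_lintegral_volume_inter_spindle hU hUc hUb).comp ht0)
  have hp : ∀ n : ℕ, n ≠ 0 → t n < Real.pi / 2 →
      ((uniformLaw U).prod ((uniformLaw U).prod (uniformLaw U))).real (flatTriples U (t n)) =
        3 * (J (t n)).toReal * t n ^ m / volume.real U ^ 3 := by
    intro n hn hts
    rw [measureReal_def, uniformLaw_prod_flatTriples hU.measurableSet h0 h1 hts]
    have hpos := htpos n hn
    have hJe : (∫⁻ p in U ×ˢ U, volume (U ∩ spindle (t n) p.1 p.2)) =
        J (t n) * ENNReal.ofReal (t n) ^ m := by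
      rw [hJ, ENNReal.div_mul_cancel]
      · exact pow_ne_zero _ (by simpa using hpos)
      · exact ENNReal.pow_ne_top ENNReal.ofReal_ne_top
    rw [hJe, ENNReal.toReal_mul, ENNReal.toReal_mul, ENNReal.toReal_mul, ENNReal.toReal_pow,
      ENNReal.toReal_pow, ENNReal.toReal_inv, ENNReal.toReal_ofReal hpos.le, measureReal_def,
      inv_pow]
    simp only [ENNReal.toReal_ofNat]
    ring
  have hlam : Tendsto (fun n : ℕ => ((triplesFinset n).card : ℝ) *
      ((uniformLaw U).prod ((uniformLaw U).prod (uniformLaw U))).real (flatTriples U (t n))) atTop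
      (𝓝 (deficitRate U * y ^ m)) := by
    have hinv : Tendsto (fun n : ℕ => (n : ℝ)⁻¹) atTop (𝓝 0) :=
      (tendsto_natCast_atTop_atTop (R := ℝ)).inv_tendsto_atTop
    have h2 : Tendsto (fun n : ℕ => (1 - (n : ℝ)⁻¹) * (1 - 2 * (n : ℝ)⁻¹) * (y ^ m / 2) *
        ((J (t n)).toReal / volume.real U ^ 3)) atTop
        (𝓝 ((1 - 0) * (1 - 2 * 0) * (y ^ m / 2) *
          ((distanceMoment U * spindleConst m).toReal / volume.real U ^ 3))) :=
      (((hinv.const_sub 1).mul ((hinv.const_mul 2).const_sub 1)).mul_const _).mul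
        (hJlim.div_const _)
    have h3 : (1 - 0) * (1 - 2 * 0) * (y ^ m / 2) *
          ((distanceMoment U * spindleConst m).toReal / volume.real U ^ 3) =
          deficitRate U * y ^ m := by
      rw [deficitRate]; field_simp; ring
    rw [h3] at h2
    refine h2.congr' ?_
    filter_upwards [eventually_ne_atTop 0, htsmall] with n hn hts
    have hn' : (n : ℝ) ≠ 0 := by exact_mod_cast hn
    rw [hp n hn hts, card_triplesFinset, htpow n hn]
    field_simp
    ring
  have hexp := (Real.continuous_exp.tendsto _).comp hlam.neg
  have hdiff : Tendsto (fun n : ℕ => Pr.real (⋂ s ∈ triplesFinset n,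
      (tripleEvent P (flatTriples U (t n)) s)ᶜ) - Real.exp (-(((triplesFinset n).card : ℝ) *
      ((uniformLaw U).prod ((uniformLaw U).prod (uniformLaw U))).real (flatTriples U (t n)))))
      atTop (𝓝 0) := by
    rw [tendsto_zero_iff_abs_tendsto_zero]
    refine squeeze_zero' (Eventually.of_forall fun n => abs_nonneg _) ?_ herr
    filter_upwards [eventually_ne_atTop 0, htsmall] with n hn hts
    exact abs_measureReal_no_triple_sub_exp_le hP hind hlaw
      (measurableSet_flatTriples hU.measurableSet _) flatTriples_swap_left
      flatTriples_swap_right (hq n hn hts) n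
  have := hdiff.add hexp
  simpa using this

theorem largestTriangleAngle_le_pi {d : ℕ} (x y z : EuclideanSpace ℝ (Fin d)) :
    largestTriangleAngle x y z ≤ Real.pi :=
  max_le (EuclideanGeometry.angle_le_pi _ _ _)
    (max_le (EuclideanGeometry.angle_le_pi _ _ _) (EuclideanGeometry.angle_le_pi _ _ _))

theorem maxAngle_le_iff {d : ℕ} (p : ℕ → EuclideanSpace ℝ (Fin d)) {n : ℕ} (hn : 3 ≤ n) (a : ℝ) :
    maxAngle p n ≤ a ↔
      ∀ s ∈ triplesFinset n, largestTriangleAngle (p s.1) (p s.2.1) (p s.2.2) ≤ a := by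
  have : Nonempty (indexTriples n) := ⟨⟨(0, 1, 2), by simp [indexTriples]; omega⟩⟩
  rw [maxAngle, ciSup_le_iff]
  · constructor
    · exact fun h s hs => h ⟨s, mem_triplesFinset.1 hs⟩
    · exact fun h s => h s.1 (mem_triplesFinset.2 s.2)
  · refine ⟨Real.pi, ?_⟩
    rintro _ ⟨s, rfl⟩
    exact largestTriangleAngle_le_pi _ _ _

theorem aemeasurable_scaledDeficit {d : ℕ} {Ω : Type*} [MeasurableSpace Ω] {Pr : Measure Ω}
    {P : ℕ → Ω → EuclideanSpace ℝ (Fin d)} (hP : ∀ i, AEMeasurable (P i) Pr) (n : ℕ) :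
    AEMeasurable (scaledDeficit P n) Pr := by
  have hang := fun i j k =>
    (measurable_euclideanAngle (d := d)).comp_aemeasurable ((hP i).prodMk ((hP j).prodMk (hP k)))
  have h : AEMeasurable (fun ω => maxAngle (fun i => P i ω) n) Pr := by
    unfold maxAngle
    exact AEMeasurable.iSup fun s => (hang _ _ _).max ((hang _ _ _).max (hang _ _ _))
  unfold scaledDeficit
  exact (h.const_sub _).const_mul _

theorem aemeasurable_of_isUniformSample {d : ℕ} {Ω : Type*} [MeasurableSpace Ω] {Pr : Measure Ω}
    {P : ℕ → Ω → EuclideanSpace ℝ (Fin d)} {K : Set (EuclideanSpace ℝ (Fin d))}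
    (hKb : Bornology.IsBounded K) (hKi : (interior K).Nonempty)
    (hP : IsUniformSample P K Pr) (i : ℕ) : AEMeasurable (P i) Pr :=
  (hP.uniform i).aemeasurable (fun h => (isOpen_interior.measure_pos volume hKi).ne'
    (measure_mono_null interior_subset h)) hKb.measure_lt_top.ne

/-- Convergence of the survival function of the rescaled deficit: it is at least `y` exactly when no
triangle has an angle larger than `π - y * n ^ (-3 / m)`. -/
theorem tendsto_measureReal_le_scaledDeficit {m : ℕ} (hm : m ≠ 0)
    {K : Set (EuclideanSpace ℝ (Fin (m + 1)))} (hKb : Bornology.IsBounded K) (hKc : Convex ℝ K)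
    (hKi : (interior K).Nonempty) {Ω : Type*} [MeasurableSpace Ω]
    {Pr : Measure Ω} [IsProbabilityMeasure Pr] {P : ℕ → Ω → EuclideanSpace ℝ (Fin (m + 1))}
    (hP : IsUniformSample P K Pr) {y : ℝ} (hy : 0 < y) :
    Tendsto (fun n : ℕ => Pr.real {ω | y ≤ scaledDeficit P n ω}) atTop
      (𝓝 (Real.exp (-(deficitRate (interior K) * y ^ m)))) := by
  set U := interior K with hU
  have hae := aemeasurable_of_isUniformSample hKb hKi hP
  -- A convex set differs from its interior by a null set.
  have hKU : K =ᵐ[volume] U := by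
    refine (LE.le.eventuallyLE interior_subset).antisymm ?_ |>.symm
    rw [ae_le_set]
    exact measure_mono_null (Set.sdiff_subset_sdiff_left subset_closure)
      (hKc.addHaar_frontier volume)
  have hlaw : ∀ i, Pr.map (P i) = uniformLaw U := fun i => by
    have := hP.uniform i
    rw [pdf.IsUniform, ProbabilityTheory.cond] at this
    rw [this, uniformLaw, measure_congr hKU, Measure.restrict_congr_set hKU]
  -- The points are only almost everywhere measurable.
  set P' : ℕ → Ω → EuclideanSpace ℝ (Fin (m + 1)) := fun i => (hae i).mk (P i) with hP'
  have hP'm : ∀ i, Measurable (P' i) := fun i => (hae i).measurable_mk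
  have hPP' : ∀ i, P i =ᵐ[Pr] P' i := fun i => (hae i).ae_eq_mk
  have hlaw' : ∀ i, Pr.map (P' i) = uniformLaw U := fun i => by
    rw [← hlaw i, Measure.map_congr (hPP' i)]
  have hind' : iIndepFun P' Pr := (iIndepFun_congr hPP').1 hP.indep
  have hmem : ∀ i, ∀ᵐ ω ∂Pr, P' i ω ∈ U := fun i => by
    refine ae_of_ae_map (hP'm i).aemeasurable (p := fun x => x ∈ U) ?_
    rw [hlaw' i, uniformLaw]
    exact Measure.ae_smul_measure (ae_restrict_mem isOpen_interior.measurableSet) _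
  have hmpos : (0 : ℝ) < m := by exact_mod_cast Nat.pos_of_ne_zero hm
  refine (tendsto_measureReal_no_flatTriples hm isOpen_interior hKc.interior
    (hKb.subset interior_subset) hKi hP'm hind' hlaw' hy).congr' ?_
  filter_upwards [eventually_ge_atTop 3] with n hn
  refine measureReal_congr ?_
  have hn0 : (0 : ℝ) < n := by exact_mod_cast (by omega : 0 < n)
  filter_upwards [ae_all_iff.2 hPP', ae_all_iff.2 hmem] with ω h1 h2
  refine propext (?_ : ω ∈ (⋂ s ∈ triplesFinset n, (tripleEvent P' (flatTriples U _) s)ᶜ) ↔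
    y ≤ scaledDeficit P n ω)
  have e1 : y ≤ scaledDeficit P n ω ↔
      maxAngle (fun i => P i ω) n ≤ Real.pi - y * (n : ℝ) ^ (-(3 / m : ℝ)) := by
    rw [scaledDeficit, Nat.cast_add, Nat.cast_one, add_sub_cancel_right,
      Real.rpow_neg hn0.le, ← div_eq_mul_inv, le_sub_comm, div_le_iff₀ (by positivity), mul_comm]
  rw [e1, maxAngle_le_iff _ hn]
  simp only [Set.mem_iInter, tripleEvent, flatTriples, Set.mem_compl_iff, Set.mem_ofPred_eq,
    not_and, not_lt, h1]
  exact ⟨fun h s hs => h s hs ⟨h2 _, h2 _, h2 _⟩, fun h s hs _ => h s hs⟩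

/-! ### Bounds for the distance moment -/

theorem lintegral_Ioi_inv_pow (n : ℕ) {a : ℝ} (ha : 0 < a) :
    ∫⁻ t in Set.Ioi a, ENNReal.ofReal ((n + 1) * (t ^ (n + 2))⁻¹) =
      ENNReal.ofReal ((a ^ (n + 1))⁻¹) := by
  have hlt : -((n : ℝ) + 2) < -1 := by
    have : (0 : ℝ) ≤ n := Nat.cast_nonneg n
    linarith
  have hint := (integrableOn_Ioi_rpow_of_lt hlt ha).const_mul ((n : ℝ) + 1)
  have heq : ∀ t ∈ Set.Ioi a, ((n : ℝ) + 1) * (t ^ (n + 2))⁻¹ =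
      ((n : ℝ) + 1) * t ^ (-((n : ℝ) + 2)) := fun t ht => by
    rw [Real.rpow_neg (ha.trans ht).le]
    norm_cast
  rw [setLIntegral_congr_fun measurableSet_Ioi fun t ht => by rw [heq t ht],
    ← ofReal_integral_eq_lintegral_ofReal hint, integral_const_mul, integral_Ioi_rpow_of_lt hlt ha]
  · congr 1
    have h1 : (n : ℝ) + 1 ≠ 0 := by positivity
    rw [show -((n : ℝ) + 2) + 1 = -(n + 1 : ℕ) by push_cast; ring, Real.rpow_neg ha.le,
      Real.rpow_natCast]
    push_cast
    field_simp
  · filter_upwards [ae_restrict_mem measurableSet_Ioi] with t ht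
    have : 0 < t := ha.trans ht
    positivity

/-- The truncated power `max (R, ‖z‖) ^ (-(d + 1))` has integral `(d + 1) κ / R`, with `κ` the
volume of the unit ball. -/
theorem lintegral_inv_max_norm_pow {d : ℕ} {R : ℝ} (hR : 0 < R) :
    ∫⁻ z : EuclideanSpace ℝ (Fin d), ENNReal.ofReal ((max R ‖z‖ ^ (d + 1))⁻¹) =
      ENNReal.ofReal ((d + 1) / R) *
        volume (Metric.ball (0 : EuclideanSpace ℝ (Fin d)) 1) := by
  set κ := volume (Metric.ball (0 : EuclideanSpace ℝ (Fin d)) 1)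
  -- Layer-cake representation of the power: `a ^ (-(d + 1))` is the integral of `g` over `(a, ∞)`.
  set g : ℝ → ENNReal := fun t => ENNReal.ofReal ((d + 1) * (t ^ (d + 2))⁻¹) with hg
  have hgm : Measurable g := by fun_prop
  have hS : MeasurableSet {p : EuclideanSpace ℝ (Fin d) × ℝ | ‖p.1‖ < p.2} :=
    measurableSet_lt (by fun_prop) (by fun_prop)
  calc ∫⁻ z : EuclideanSpace ℝ (Fin d), ENNReal.ofReal ((max R ‖z‖ ^ (d + 1))⁻¹)
      = ∫⁻ z : EuclideanSpace ℝ (Fin d), ∫⁻ t in Set.Ioi R,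
          {p : EuclideanSpace ℝ (Fin d) × ℝ | ‖p.1‖ < p.2}.indicator (fun p => g p.2) (z, t) := by
        refine lintegral_congr fun z => ?_
        rw [← lintegral_Ioi_inv_pow d (lt_max_of_lt_left hR)]
        have : ∀ t, {p : EuclideanSpace ℝ (Fin d) × ℝ | ‖p.1‖ < p.2}.indicator
            (fun p => g p.2) (z, t) = (Set.Ioi ‖z‖).indicator g t := fun t => rfl
        simp only [this]
        rw [lintegral_indicator measurableSet_Ioi, Measure.restrict_restrict measurableSet_Ioi,
          Set.Ioi_inter_Ioi, sup_comm]
    _ = ∫⁻ t in Set.Ioi R, ∫⁻ z : EuclideanSpace ℝ (Fin d),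
          {p : EuclideanSpace ℝ (Fin d) × ℝ | ‖p.1‖ < p.2}.indicator (fun p => g p.2) (z, t) :=
        lintegral_lintegral_swap ((hgm.comp measurable_snd).indicator hS).aemeasurable
    _ = ∫⁻ t in Set.Ioi R, ENNReal.ofReal (d + 1) * κ *
          ENNReal.ofReal (((0 : ℕ) + 1) * (t ^ (0 + 2))⁻¹) := by
        refine setLIntegral_congr_fun measurableSet_Ioi fun t ht => ?_
        have ht0 : 0 < t := hR.trans ht
        have : ∀ z, {p : EuclideanSpace ℝ (Fin d) × ℝ | ‖p.1‖ < p.2}.indicator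
            (fun p => g p.2) (z, t) = (Metric.ball 0 t).indicator (fun _ => g t) z := fun z => by
          by_cases h : ‖z‖ < t <;> simp [Set.indicator, h]
        simp only [this]
        rw [lintegral_indicator measurableSet_ball, setLIntegral_const,
          Measure.addHaar_ball_of_pos _ _ ht0, finrank_euclideanSpace, Fintype.card_fin, hg]
        rw [← mul_assoc, ← ENNReal.ofReal_mul (by positivity), mul_right_comm _ κ,
          ← ENNReal.ofReal_mul (by positivity)]
        congr 2
        push_cast
        field_simp
        ring
    _ = _ := by
        rw [lintegral_const_mul _ (by fun_prop), lintegral_Ioi_inv_pow 0 hR, mul_right_comm,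
          ← ENNReal.ofReal_mul (by positivity)]
        simp [div_eq_mul_inv]

/-- The sharp reverse Young inequality for the indicator functions of `U` and `-U`. -/
theorem reverse_young_indicator {d : ℕ} {U : Set (EuclideanSpace ℝ (Fin d))}
    (hU : MeasurableSet U) (hUf : volume U ≠ ⊤) {k : EuclideanSpace ℝ (Fin d) → ENNReal}
    (hk : Measurable k) (hk0 : ∀ x, k x ≠ 0) :
    ENNReal.ofReal (8 / (3 * √3)) ^ d * volume U ^ 3 / (∫⁻ z, k z) ≤
      ∫⁻ p in U ×ˢ U, (k (p.1 - p.2))⁻¹ := by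
  set T : (Fin d → ℝ) → EuclideanSpace ℝ (Fin d) := WithLp.toLp 2 with hT
  have hTm : Measurable T := WithLp.measurable_toLp 2 _
  have hvp : MeasurePreserving T := PiLp.volume_preserving_toLp (Fin d)
  have hind : Measurable (U.indicator (1 : EuclideanSpace ℝ (Fin d) → ENNReal)) :=
    measurable_one.indicator hU
  have hUi : ∫⁻ x, U.indicator (1 : EuclideanSpace ℝ (Fin d) → ENNReal) (T x) = volume U := by
    rw [hvp.lintegral_comp hind, lintegral_indicator_one hU]
  have hUn : ∫⁻ x, U.indicator (1 : EuclideanSpace ℝ (Fin d) → ENNReal) (T (-x)) = volume U := by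
    rw [← hUi]
    exact lintegral_neg_eq_self
      (fun x => U.indicator (1 : EuclideanSpace ℝ (Fin d) → ENNReal) (T x))
  have h := reverse_young d (u := fun x => U.indicator 1 (T x))
    (v := fun x => U.indicator 1 (T (-x))) (k := fun x => k (T x))
    (hind.comp hTm) (hind.comp (hTm.comp measurable_neg)) (hk.comp hTm)
    (by rwa [hUi]) (by rwa [hUn]) (fun x => hk0 _)
  rw [hUi, hUn, hvp.lintegral_comp hk, mul_assoc, ← ENNReal.rpow_add_of_nonneg _ _ (by norm_num)
    (by norm_num), show (3 / 2 + 3 / 2 : ℝ) = (3 : ℕ) by norm_num, ENNReal.rpow_natCast] at h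
  refine h.trans_eq ?_
  have hF : Measurable fun p : EuclideanSpace ℝ (Fin d) × EuclideanSpace ℝ (Fin d) =>
      (U ×ˢ U).indicator (fun p => (k (p.1 - p.2))⁻¹) p :=
    (hk.comp (measurable_fst.sub measurable_snd)).inv.indicator (hU.prod hU)
  rw [← lintegral_indicator (hU.prod hU), Measure.volume_eq_prod, lintegral_prod _ hF.aemeasurable,
    ← hvp.lintegral_comp hF.lintegral_prod_right']
  refine lintegral_congr fun x => ?_
  have hFx : Measurable fun y : EuclideanSpace ℝ (Fin d) =>
      (U ×ˢ U).indicator (fun p => (k (p.1 - p.2))⁻¹) (T x, y) := hF.comp measurable_prodMk_left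
  rw [← hvp.lintegral_comp hFx, ← lintegral_neg_eq_self]
  refine lintegral_congr fun y => ?_
  simp only [hT, neg_neg, WithLp.toLp_add,
    WithLp.toLp_neg, sub_eq_add_neg]
  by_cases h1 : WithLp.toLp 2 x ∈ U <;> by_cases h2 : WithLp.toLp 2 y ∈ U <;> simp [h1, h2]

theorem reverseYoungConst_le_two : 8 / (3 * √3) ≤ (2 : ℝ) := by
  have h : (3 / 2 : ℝ) ≤ √3 := Real.le_sqrt_of_sq_le (by norm_num)
  rw [div_le_iff₀ (by positivity)]
  linarith

/-- Lower bound for the distance moment of a set of given volume, sharp up to a factor polynomial in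
the dimension. The reverse Young inequality is applied with the weight `max (R, ‖z‖) ^ (d + 1)`,
where `R` is the radius of the ball with the volume of `U`; compared with `‖z‖ ^ d` it is cut off at
`R` and has an additional power which makes its reciprocal integrable at infinity. -/
theorem le_distanceMoment {d : ℕ} (hd : d ≠ 0) {U : Set (EuclideanSpace ℝ (Fin d))}
    (hU : MeasurableSet U) (h0 : volume U ≠ 0) (hf : volume U ≠ ⊤) :
    ENNReal.ofReal (8 / (3 * √3)) ^ d * volume U ^ 3 ≤ ENNReal.ofReal (32 * (d + 1)) *
      (volume (Metric.ball (0 : EuclideanSpace ℝ (Fin d)) 1) * distanceMoment U +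
        volume U ^ 3) := by
  set κ := volume (Metric.ball (0 : EuclideanSpace ℝ (Fin d)) 1) with hκ
  set C : ENNReal := ENNReal.ofReal (8 / (3 * √3)) with hC
  have hκ0 : κ ≠ 0 := (Metric.measure_ball_pos volume _ one_pos).ne'
  have hκf : κ ≠ ⊤ := measure_ball_lt_top.ne
  obtain ⟨R, hR, hV⟩ : ∃ R : ℝ, 0 < R ∧ κ * ENNReal.ofReal R ^ d = volume U := by
    have hq0 : 0 < (volume U / κ).toReal := ENNReal.toReal_pos
      (ENNReal.div_ne_zero.2 ⟨h0, hκf⟩) (ENNReal.div_ne_top hf hκ0)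
    refine ⟨(volume U / κ).toReal ^ (d : ℝ)⁻¹, by positivity, ?_⟩
    rw [← ENNReal.ofReal_pow (by positivity), Real.rpow_inv_natCast_pow hq0.le hd,
      ENNReal.ofReal_toReal (ENNReal.div_ne_top hf hκ0), ENNReal.mul_div_cancel hκ0 hκf]
  -- Either half of `U` lies in a ball of radius `2 * R`, where the additional power costs only a
  -- factor `4 * R`, or at least half of `U` is at distance `2 * R` from any given point, which
  -- is more than enough since `8 / (3 * √3) ≤ 2`.
  by_cases hcase : ∃ x, volume U ≤ 2 * volume (U ∩ Metric.ball x (2 * R))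
  · obtain ⟨x, hx⟩ := hcase
    set U' := U ∩ Metric.ball x (2 * R) with hU'
    have hU'm : MeasurableSet U' := hU.inter measurableSet_ball
    have hry := reverse_young_indicator hU'm (measure_ne_top_of_subset Set.inter_subset_left hf)
      (k := fun z => ENNReal.ofReal ((max R ‖z‖ ^ (d + 1))⁻¹)) (by fun_prop) (fun z => by
        have : 0 < max R ‖z‖ := lt_max_of_lt_left hR
        have h2 : 0 < (max R ‖z‖ ^ (d + 1))⁻¹ := by positivity
        simpa using h2)
    rw [lintegral_inv_max_norm_pow hR, ← hκ] at hry
    have hup : ∫⁻ p in U' ×ˢ U', (ENNReal.ofReal ((max R ‖p.1 - p.2‖ ^ (d + 1))⁻¹))⁻¹ ≤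
        ENNReal.ofReal (4 * R) * (ENNReal.ofReal R ^ d * volume U ^ 2 + distanceMoment U) := by
      calc _ ≤ ∫⁻ p in U' ×ˢ U', ENNReal.ofReal (4 * R) *
            (ENNReal.ofReal R ^ d + edist p.1 p.2 ^ d) := by
            refine setLIntegral_mono' (hU'm.prod hU'm) fun p hp => ?_
            have hmax : 0 < max R ‖p.1 - p.2‖ := lt_max_of_lt_left hR
            have h4 : max R ‖p.1 - p.2‖ ≤ 4 * R := by
              refine max_le (by linarith) ?_
              have h1 := hp.1.2
              have h2 := hp.2.2
              rw [Metric.mem_ball] at h1 h2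
              rw [← dist_eq_norm]
              linarith [dist_triangle_right p.1 p.2 x]
            rw [ENNReal.ofReal_inv_of_pos (by positivity), inv_inv, edist_dist, dist_eq_norm,
              ← ENNReal.ofReal_pow hR.le, ← ENNReal.ofReal_pow (norm_nonneg _),
              ← ENNReal.ofReal_add (by positivity) (by positivity),
              ← ENNReal.ofReal_mul (by positivity), pow_succ']
            refine ENNReal.ofReal_le_ofReal (mul_le_mul h4 ?_ (by positivity) (by positivity))
            rcases max_choice R ‖p.1 - p.2‖ with h | h <;> rw [h]
            · linarith [pow_nonneg (norm_nonneg (p.1 - p.2)) d]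
            · linarith [pow_nonneg hR.le d]
        _ ≤ ∫⁻ p in U ×ˢ U, ENNReal.ofReal (4 * R) *
            (ENNReal.ofReal R ^ d + edist p.1 p.2 ^ d) :=
            lintegral_mono_set (Set.prod_mono Set.inter_subset_left Set.inter_subset_left)
        _ = _ := by
            rw [lintegral_const_mul' _ _ ENNReal.ofReal_ne_top, lintegral_add_left
              measurable_const, setLIntegral_const, Measure.volume_eq_prod, Measure.prod_prod,
              sq, distanceMoment, Measure.volume_eq_prod]
    have h1 := hry.trans hup
    have hcR : 0 < ((d : ℝ) + 1) / R := by positivity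
    rw [ENNReal.div_le_iff (mul_ne_zero (by simpa using hcR) hκ0)
      (ENNReal.mul_ne_top ENNReal.ofReal_ne_top hκf)] at h1
    calc C ^ d * volume U ^ 3 ≤ C ^ d * (2 * volume U') ^ 3 := by gcongr
      _ = 8 * (C ^ d * volume U' ^ 3) := by ring
      _ ≤ 8 * (ENNReal.ofReal (4 * R) * (ENNReal.ofReal R ^ d * volume U ^ 2 + distanceMoment U) *
          (ENNReal.ofReal ((d + 1) / R) * κ)) := by gcongr
      _ = 8 * (ENNReal.ofReal (4 * R) * ENNReal.ofReal ((d + 1) / R)) *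
          (κ * distanceMoment U + (κ * ENNReal.ofReal R ^ d) * volume U ^ 2) := by ring
      _ = ENNReal.ofReal (32 * (d + 1)) * (κ * distanceMoment U + volume U ^ 3) := by
          have e8 : (8 : ENNReal) = ENNReal.ofReal 8 := by simp
          rw [hV, ← ENNReal.ofReal_mul (by positivity), e8, ← ENNReal.ofReal_mul (by norm_num)]
          congr 2
          · field_simp; ring
          · ring
  · push Not at hcase
    have hfar : ∀ x, volume U ≤ 2 * volume (U \ Metric.ball x (2 * R)) := fun x => by
      by_contra! hlt
      have h2 : 2 * volume U = 2 * volume (U ∩ Metric.ball x (2 * R)) +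
          2 * volume (U \ Metric.ball x (2 * R)) := by
        rw [← mul_add, measure_inter_add_sdiff U measurableSet_ball]
      have h3 := ENNReal.add_lt_add (hcase x) hlt
      rw [← h2, two_mul] at h3
      exact lt_irrefl _ h3
    have hI : ENNReal.ofReal (2 * R) ^ d * volume U ^ 2 ≤ 2 * distanceMoment U := by
      calc ENNReal.ofReal (2 * R) ^ d * volume U ^ 2
          = ∫⁻ _ in U, ENNReal.ofReal (2 * R) ^ d * volume U := by
            rw [setLIntegral_const]; ring
        _ ≤ ∫⁻ x in U, 2 * ∫⁻ y in U, edist x y ^ d := by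
            refine lintegral_mono fun x => ?_
            calc ENNReal.ofReal (2 * R) ^ d * volume U
                ≤ ENNReal.ofReal (2 * R) ^ d * (2 * volume (U \ Metric.ball x (2 * R))) := by
                  gcongr; exact hfar x
              _ = 2 * ∫⁻ _ in U \ Metric.ball x (2 * R), ENNReal.ofReal (2 * R) ^ d := by
                  rw [setLIntegral_const]; ring
              _ ≤ 2 * ∫⁻ y in U \ Metric.ball x (2 * R), edist x y ^ d := by
                  gcongr 2 * ?_
                  refine setLIntegral_mono' (hU.diff measurableSet_ball) fun y hy => ?_
                  have h2 := hy.2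
                  rw [Metric.mem_ball, not_lt] at h2
                  gcongr
                  rw [edist_dist, dist_comm]
                  exact ENNReal.ofReal_le_ofReal h2
              _ ≤ 2 * ∫⁻ y in U, edist x y ^ d := by
                  gcongr
                  exact Set.sdiff_subset
        _ = 2 * distanceMoment U := by
            rw [lintegral_const_mul' _ _ (by simp), distanceMoment, Measure.volume_eq_prod,
              setLIntegral_prod _ (by fun_prop)]
    calc C ^ d * volume U ^ 3 ≤ ENNReal.ofReal 2 ^ d * volume U ^ 3 := by
          gcongr
          exact ENNReal.ofReal_le_ofReal reverseYoungConst_le_two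
      _ = κ * (ENNReal.ofReal (2 * R) ^ d * volume U ^ 2) := by
          rw [ENNReal.ofReal_mul (by norm_num), pow_succ (volume U) 2]
          nth_rewrite 2 [← hV]
          ring
      _ ≤ κ * (2 * distanceMoment U) := by gcongr
      _ = 2 * (κ * distanceMoment U) := by ring
      _ ≤ ENNReal.ofReal (32 * (d + 1)) * (κ * distanceMoment U + volume U ^ 3) := by
          gcongr
          · rw [← ENNReal.ofReal_ofNat]
            exact ENNReal.ofReal_le_ofReal (by linarith [Nat.cast_nonneg (α := ℝ) d])
          · exact le_self_add

/-- Upper bound for the distance moment of the unit ball, matching the lower bound up to a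
polynomial factor. With `r = ‖z‖`, the overlap of the ball with its translate by `z` is at most
`(1 - r ^ 2 / 4) ^ (d / 2)` times the ball, and `r ^ 2 * √(1 - r ^ 2 / 4)` has maximum
`8 / (3 * √3)`, attained at `r ^ 2 = 8 / 3`. -/
theorem distanceMoment_ball_le (d : ℕ) :
    distanceMoment (Metric.ball (0 : EuclideanSpace ℝ (Fin d)) 1) ≤
      ENNReal.ofReal (2 * (d + 1) * (8 / (3 * √3)) ^ d) *
        volume (Metric.ball (0 : EuclideanSpace ℝ (Fin d)) 1) ^ 2 := by
  set κ := volume (Metric.ball (0 : EuclideanSpace ℝ (Fin d)) 1) with hκ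
  set B := Metric.ball (0 : EuclideanSpace ℝ (Fin d)) 1 with hB
  have hinter : ∀ z : EuclideanSpace ℝ (Fin d),
      ∫⁻ x, (B ×ˢ B).indicator (fun p => edist p.1 p.2 ^ d) (x, x + z) ≤
        ENNReal.ofReal (2 * (8 / (3 * √3)) ^ d * (max 1 ‖z‖ ^ (d + 1))⁻¹) * κ := by
    intro z
    have hC1 : (1 : ℝ) ≤ 8 / (3 * √3) := by
      have : √3 ≤ 8 / 3 := Real.sqrt_le_iff.2 (by norm_num)
      rw [le_div_iff₀ (by positivity)]
      linarith
    have hS : MeasurableSet {x | x ∈ B ∧ x + z ∈ B} :=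
      measurableSet_ball.inter (measurableSet_ball.preimage (by fun_prop))
    have hind : ∀ x, (B ×ˢ B).indicator (fun p => edist p.1 p.2 ^ d) (x, x + z) =
        {x | x ∈ B ∧ x + z ∈ B}.indicator (fun _ => ENNReal.ofReal ‖z‖ ^ d) x := fun x => by
      have he : edist x (x + z) = ENNReal.ofReal ‖z‖ := by
        rw [edist_dist, dist_self_add_right]
      by_cases h : x ∈ B ∧ x + z ∈ B <;> simp [Set.indicator, h, he]
    simp only [hind]
    rw [lintegral_indicator hS, setLIntegral_const]
    -- By the parallelogram law the lens lies in a ball centred at the midpoint of the centres.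
    have hmid : ∀ x, x ∈ B ∧ x + z ∈ B → ‖x - (-(2 : ℝ)⁻¹ • z)‖ ^ 2 < 1 - ‖z‖ ^ 2 / 4 := by
      rintro x ⟨h1, h2⟩
      rw [hB, mem_ball_zero_iff] at h1 h2
      have e1 : ‖x - (-(2 : ℝ)⁻¹ • z)‖ ^ 2 = (‖x‖ ^ 2 + ‖x + z‖ ^ 2) / 2 - ‖z‖ ^ 2 / 4 := by
        rw [neg_smul, sub_neg_eq_add, norm_add_sq_real, norm_add_sq_real, inner_smul_right,
          norm_smul, mul_pow]
        norm_num
        ring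
      have h3 : ‖x‖ ^ 2 < 1 := by nlinarith [norm_nonneg x]
      have h4 : ‖x + z‖ ^ 2 < 1 := by nlinarith [norm_nonneg (x + z)]
      rw [e1]
      linarith
    rcases le_or_gt 2 ‖z‖ with hz | hz
    · have : {x | x ∈ B ∧ x + z ∈ B} = ∅ := by
        refine Set.eq_empty_of_forall_notMem fun x hx => ?_
        have := hmid x hx
        nlinarith [sq_nonneg ‖x - (-(2 : ℝ)⁻¹ • z)‖]
      rw [this, measure_empty, mul_zero]
      exact zero_le
    · set r := ‖z‖ with hr
      have hr0 : 0 ≤ r := norm_nonneg z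
      have hρ0 : 0 < 1 - r ^ 2 / 4 := by nlinarith
      set ρ := √(1 - r ^ 2 / 4) with hρ
      have hρp : 0 < ρ := Real.sqrt_pos.2 hρ0
      have hρ2 : ρ ^ 2 = 1 - r ^ 2 / 4 := Real.sq_sqrt hρ0.le
      have hsub : {x | x ∈ B ∧ x + z ∈ B} ⊆ Metric.ball (-(2 : ℝ)⁻¹ • z) ρ := fun x hx => by
        rw [mem_ball_iff_norm]
        exact Real.lt_sqrt_of_sq_lt (hmid x hx)
      have hreal : (r * ρ) ^ d ≤ 2 * (8 / (3 * √3)) ^ d * (max 1 r ^ (d + 1))⁻¹ := by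
        rcases le_or_gt r 1 with h1 | h1
        · have h2 : r * ρ ≤ 1 := by
            rw [← abs_of_nonneg (by positivity : 0 ≤ r * ρ), ← sq_le_one_iff_abs_le_one, mul_pow,
              hρ2]
            nlinarith [sq_nonneg (1 - r ^ 2 / 2)]
          rw [max_eq_left h1, one_pow, inv_one, mul_one]
          have h3 := pow_le_one₀ (n := d) (by positivity) h2
          have h4 := one_le_pow₀ (n := d) hC1
          linarith
        · have h2 : r ^ 2 * ρ ≤ 8 / (3 * √3) := by
            refine (sq_le_sq₀ (by positivity) (by positivity)).1 ?_
            rw [mul_pow, hρ2, div_pow, mul_pow, Real.sq_sqrt (by norm_num)]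
            -- `64 / 27 - s ^ 2 * (1 - s / 4) = (s - 8 / 3) ^ 2 * (s + 4 / 3) / 4` for `s = r ^ 2`.
            nlinarith [mul_nonneg (sq_nonneg (r ^ 2 - 8 / 3))
              (by positivity : 0 ≤ r ^ 2 + 4 / 3)]
          rw [max_eq_right h1.le, ← div_eq_mul_inv, le_div_iff₀ (by positivity)]
          calc (r * ρ) ^ d * r ^ (d + 1) = r * (r ^ 2 * ρ) ^ d := by ring
            _ ≤ 2 * (8 / (3 * √3)) ^ d := by gcongr
      calc ENNReal.ofReal r ^ d * volume {x | x ∈ B ∧ x + z ∈ B}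
          ≤ ENNReal.ofReal r ^ d * volume (Metric.ball (-(2 : ℝ)⁻¹ • z) ρ) := by gcongr
        _ = ENNReal.ofReal ((r * ρ) ^ d) * κ := by
            rw [Measure.addHaar_ball_of_pos _ _ hρp, finrank_euclideanSpace, Fintype.card_fin,
              ← mul_assoc, ← ENNReal.ofReal_pow hr0, ← ENNReal.ofReal_mul (by positivity),
              mul_pow]
        _ ≤ _ := by gcongr
  have hF : Measurable fun p : EuclideanSpace ℝ (Fin d) × EuclideanSpace ℝ (Fin d) =>
      (B ×ˢ B).indicator (fun p => edist p.1 p.2 ^ d) p := by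
    refine Measurable.indicator ?_ (measurableSet_ball.prod measurableSet_ball)
    fun_prop
  have hF2 : Measurable fun p : EuclideanSpace ℝ (Fin d) × EuclideanSpace ℝ (Fin d) =>
      (B ×ˢ B).indicator (fun p => edist p.1 p.2 ^ d) (p.1, p.1 + p.2) :=
    hF.comp (measurable_fst.prodMk (measurable_fst.add measurable_snd))
  calc distanceMoment B
      = ∫⁻ x, ∫⁻ y, (B ×ˢ B).indicator (fun p => edist p.1 p.2 ^ d) (x, y) := by
        rw [distanceMoment, ← lintegral_indicator (measurableSet_ball.prod measurableSet_ball),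
          Measure.volume_eq_prod, lintegral_prod _ hF.aemeasurable]
    _ = ∫⁻ x, ∫⁻ z, (B ×ˢ B).indicator (fun p => edist p.1 p.2 ^ d) (x, x + z) := by
        refine lintegral_congr fun x => ?_
        exact (lintegral_add_left_eq_self
          (fun y => (B ×ˢ B).indicator (fun p => edist p.1 p.2 ^ d) (x, y)) x).symm
    _ = ∫⁻ z, ∫⁻ x, (B ×ˢ B).indicator (fun p => edist p.1 p.2 ^ d) (x, x + z) :=
        lintegral_lintegral_swap hF2.aemeasurable
    _ ≤ ∫⁻ z : EuclideanSpace ℝ (Fin d),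
          ENNReal.ofReal (2 * (8 / (3 * √3)) ^ d * (max 1 ‖z‖ ^ (d + 1))⁻¹) * κ :=
        lintegral_mono hinter
    _ = _ := by
        have hsplit : ∀ z : EuclideanSpace ℝ (Fin d),
            ENNReal.ofReal (2 * (8 / (3 * √3)) ^ d * (max 1 ‖z‖ ^ (d + 1))⁻¹) =
            ENNReal.ofReal (2 * (8 / (3 * √3)) ^ d) *
              ENNReal.ofReal ((max 1 ‖z‖ ^ (d + 1))⁻¹) := fun z =>
          ENNReal.ofReal_mul (by positivity)
        rw [lintegral_mul_const' _ _ measure_ball_lt_top.ne]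
        simp only [hsplit]
        rw [lintegral_const_mul' _ _ ENNReal.ofReal_ne_top, lintegral_inv_max_norm_pow one_pos,
          ← mul_assoc, ← ENNReal.ofReal_mul (by positivity), sq, mul_assoc]
        congr 2
        ring

/-! ### The rate in high dimension -/

/-- Cavalieri's principle along the first axis. -/
theorem volume_eq_lintegral_axisPoint {m : ℕ} {S : Set (EuclideanSpace ℝ (Fin (m + 1)))}
    (hS : MeasurableSet S) :
    volume S = ∫⁻ s : ℝ, volume {w : EuclideanSpace ℝ (Fin m) | axisPoint s w ∈ S} := by
  rw [← lintegral_indicator_one hS, lintegral_axisPoint (measurable_one.indicator hS)]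
  refine lintegral_congr fun s => ?_
  have hm : Measurable fun w : EuclideanSpace ℝ (Fin m) => axisPoint s w :=
    measurable_axisPoint.comp measurable_prodMk_left
  exact lintegral_indicator_one (hm hS)

theorem volume_ball_succ_le (m : ℕ) :
    volume (Metric.ball (0 : EuclideanSpace ℝ (Fin (m + 1))) 1) ≤
      2 * volume (Metric.ball (0 : EuclideanSpace ℝ (Fin m)) 1) := by
  rw [volume_eq_lintegral_axisPoint measurableSet_ball]
  calc _ ≤ ∫⁻ s : ℝ, (Set.Ioo (-1 : ℝ) 1).indicator
        (fun _ => volume (Metric.ball (0 : EuclideanSpace ℝ (Fin m)) 1)) s := by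
        refine lintegral_mono fun s => ?_
        have hb : ∀ w : EuclideanSpace ℝ (Fin m), axisPoint s w ∈ Metric.ball 0 1 →
            s ^ 2 + ‖w‖ ^ 2 < 1 := fun w hw => by
          rw [mem_ball_zero_iff] at hw
          rw [← norm_axisPoint_sq]
          nlinarith [norm_nonneg (axisPoint s w)]
        by_cases hs : s ∈ Set.Ioo (-1 : ℝ) 1
        · rw [Set.indicator_of_mem hs]
          refine measure_mono fun w hw => ?_
          have := hb w hw
          rw [mem_ball_zero_iff]
          nlinarith [sq_nonneg s, norm_nonneg w]
        · rw [Set.indicator_of_notMem hs, nonpos_iff_eq_zero]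
          convert measure_empty (μ := (volume : Measure (EuclideanSpace ℝ (Fin m))))
          refine Set.eq_empty_of_forall_notMem fun w hw => hs ?_
          have := hb w hw
          exact abs_lt.1 ((sq_lt_one_iff_abs_lt_one s).1 (by nlinarith [sq_nonneg ‖w‖]))
    _ = _ := by
        rw [lintegral_indicator measurableSet_Ioo, setLIntegral_const, Real.volume_Ioo, mul_comm]
        norm_num

theorem half_le_one_sub_inv_sq_pow (m : ℕ) : 1 / 2 ≤ (1 - (1 / ((m : ℝ) + 1)) ^ 2) ^ m := by
  have hm : (0 : ℝ) ≤ m := Nat.cast_nonneg m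
  have ha : (1 / ((m : ℝ) + 1)) ^ 2 ≤ 1 := pow_le_one₀ (by positivity)
    ((div_le_one (by positivity)).2 (by linarith))
  have h := one_add_mul_le_pow (a := -(1 / ((m : ℝ) + 1)) ^ 2) (by linarith) m
  have h2 : (m : ℝ) * (1 / ((m : ℝ) + 1)) ^ 2 ≤ 1 / 2 := by
    rw [div_pow, one_pow, mul_one_div, div_le_div_iff₀ (by positivity) (by norm_num)]
    nlinarith [sq_nonneg (m : ℝ)]
  rw [← sub_eq_add_neg] at h
  linarith

/-- The unit ball contains a cylinder of height `2 / (m + 1)` over a slightly smaller ball of one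
dimension less. -/
theorem volume_ball_le_mul_succ {m : ℕ} (hm : m ≠ 0) :
    volume (Metric.ball (0 : EuclideanSpace ℝ (Fin m)) 1) ≤
      ENNReal.ofReal (m + 1) * volume (Metric.ball (0 : EuclideanSpace ℝ (Fin (m + 1))) 1) := by
  set κ := volume (Metric.ball (0 : EuclideanSpace ℝ (Fin m)) 1)
  have hm1 : (1 : ℝ) ≤ m := by exact_mod_cast Nat.one_le_iff_ne_zero.2 hm
  set a : ℝ := 1 / ((m : ℝ) + 1) with ha
  have ha0 : 0 < a := by positivity
  have ha1 : a < 1 := (div_lt_one (by positivity)).2 (by linarith)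
  have hρ0 : 0 < 1 - a ^ 2 := by nlinarith
  have hle : ENNReal.ofReal a * κ ≤
      volume (Metric.ball (0 : EuclideanSpace ℝ (Fin (m + 1))) 1) := by
    rw [volume_eq_lintegral_axisPoint measurableSet_ball]
    -- The cylinder has radius `1 - a ^ 2`, which fits since `a ^ 2 + (1 - a ^ 2) ^ 2 ≤ 1`.
    calc ENNReal.ofReal a * κ = ENNReal.ofReal (1 / 2) * κ * ENNReal.ofReal (a - -a) := by
          rw [mul_right_comm, ← ENNReal.ofReal_mul (by norm_num)]
          congr 2
          ring
      _ ≤ ENNReal.ofReal ((1 - a ^ 2) ^ m) * κ * ENNReal.ofReal (a - -a) := by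
          gcongr
          exact half_le_one_sub_inv_sq_pow m
      _ = ∫⁻ s : ℝ, (Set.Ioo (-a) a).indicator
          (fun _ => volume (Metric.ball (0 : EuclideanSpace ℝ (Fin m)) (1 - a ^ 2))) s := by
          rw [lintegral_indicator measurableSet_Ioo, setLIntegral_const, Real.volume_Ioo,
            Measure.addHaar_ball_of_pos _ _ hρ0, finrank_euclideanSpace, Fintype.card_fin]
      _ ≤ _ := by
          refine lintegral_mono fun s => ?_
          by_cases hs : s ∈ Set.Ioo (-a) a
          · rw [Set.indicator_of_mem hs]
            refine measure_mono fun w hw => ?_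
            rw [mem_ball_zero_iff] at hw
            rw [Set.mem_ofPred_eq, mem_ball_zero_iff, ← abs_of_nonneg (norm_nonneg _),
              ← sq_lt_one_iff_abs_lt_one, norm_axisPoint_sq]
            have h1 : s ^ 2 < a ^ 2 := sq_lt_sq' hs.1 hs.2
            nlinarith [norm_nonneg w]
          · rw [Set.indicator_of_notMem hs]
            exact zero_le
  calc κ = ENNReal.ofReal (m + 1) * (ENNReal.ofReal a * κ) := by
        rw [← mul_assoc, ← ENNReal.ofReal_mul (by positivity), ha,
          mul_one_div_cancel (by positivity), ENNReal.ofReal_one, one_mul]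
    _ ≤ _ := by gcongr

theorem lintegral_mul_one_sub_pow_le (m : ℕ) :
    ∫⁻ s in Set.Ioo (0 : ℝ) 1, ENNReal.ofReal ((s * (1 - s)) ^ m) ≤
      ENNReal.ofReal ((1 / 4) ^ m) := by
  calc _ ≤ ∫⁻ _ in Set.Ioo (0 : ℝ) 1, ENNReal.ofReal ((1 / 4) ^ m) := by
        refine setLIntegral_mono' measurableSet_Ioo fun s hs => ENNReal.ofReal_le_ofReal ?_
        have h0 : 0 ≤ s * (1 - s) := mul_nonneg hs.1.le (sub_nonneg.2 hs.2.le)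
        exact pow_le_pow_left₀ h0 (by nlinarith [sq_nonneg (s - 1 / 2)]) m
    _ = _ := by simp

theorem le_lintegral_mul_one_sub_pow (m : ℕ) :
    ENNReal.ofReal ((1 / 4) ^ m / (2 * (m + 1))) ≤
      ∫⁻ s in Set.Ioo (0 : ℝ) 1, ENNReal.ofReal ((s * (1 - s)) ^ m) := by
  have hm : (0 : ℝ) ≤ m := Nat.cast_nonneg m
  set a : ℝ := 1 / ((m : ℝ) + 1) with ha
  have ha0 : 0 < a := by positivity
  have ha1 : a ≤ 1 := (div_le_one (by positivity)).2 (by linarith)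
  calc ENNReal.ofReal ((1 / 4) ^ m / (2 * (m + 1)))
      = ∫⁻ _ in Set.Ioo (1 / 2 - a / 2) (1 / 2 + a / 2),
          ENNReal.ofReal ((1 / 4) ^ m * (1 / 2)) := by
        rw [setLIntegral_const, Real.volume_Ioo, ← ENNReal.ofReal_mul (by positivity)]
        congr 1
        rw [ha]
        field_simp
        ring
    _ ≤ ∫⁻ s in Set.Ioo (1 / 2 - a / 2) (1 / 2 + a / 2), ENNReal.ofReal ((s * (1 - s)) ^ m) := by
        refine setLIntegral_mono' measurableSet_Ioo fun s hs => ENNReal.ofReal_le_ofReal ?_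
        calc (1 / 4 : ℝ) ^ m * (1 / 2) ≤ (1 / 4) ^ m * (1 - a ^ 2) ^ m := by
              gcongr
              exact half_le_one_sub_inv_sq_pow m
          _ = (1 / 4 * (1 - a ^ 2)) ^ m := (mul_pow _ _ _).symm
          _ ≤ (s * (1 - s)) ^ m := by
              have h1 : (s - 1 / 2) ^ 2 < (a / 2) ^ 2 :=
                sq_lt_sq' (by linarith [hs.1]) (by linarith [hs.2])
              refine pow_le_pow_left₀ ?_ (by nlinarith) m
              nlinarith
    _ ≤ _ := lintegral_mono_set (Set.Ioo_subset_Ioo (by linarith) (by linarith))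

theorem distanceMoment_ne_zero {m : ℕ} {U : Set (EuclideanSpace ℝ (Fin (m + 1)))}
    (hU : IsOpen U) (hUne : U.Nonempty) : distanceMoment U ≠ 0 := by
  refine ((setLIntegral_pos_iff (by fun_prop)).2 ?_).ne'
  have hopen : IsOpen {p : EuclideanSpace ℝ (Fin (m + 1)) × EuclideanSpace ℝ (Fin (m + 1)) |
      p.1 ≠ p.2} := isOpen_ne_fun continuous_fst continuous_snd
  have hsub : {p : EuclideanSpace ℝ (Fin (m + 1)) × EuclideanSpace ℝ (Fin (m + 1)) | p.1 ≠ p.2} ∩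
      U ×ˢ U ⊆ Function.support (fun p : EuclideanSpace ℝ (Fin (m + 1)) ×
        EuclideanSpace ℝ (Fin (m + 1)) => edist p.1 p.2 ^ (m + 1)) ∩ U ×ˢ U :=
    fun p hp => ⟨by simpa [Function.mem_support] using hp.1, hp.2⟩
  refine lt_of_lt_of_le ?_ (measure_mono hsub)
  refine (hopen.inter (hU.prod hU)).measure_pos _ ?_
  obtain ⟨x, hx⟩ := hUne
  obtain ⟨y, hy, hyx⟩ := ((hU.mem_nhds hx |> infinite_of_mem_nhds x).exists_notMem_finset {x})
  exact ⟨(x, y), by simpa [eq_comm] using hyx, hx, hy⟩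

theorem deficitRate_pos {m : ℕ} {U : Set (EuclideanSpace ℝ (Fin (m + 1)))} (hU : IsOpen U)
    (hUb : Bornology.IsBounded U) (hUne : U.Nonempty) : 0 < deficitRate U := by
  have hV : 0 < volume.real U :=
    ENNReal.toReal_pos (hU.measure_pos volume hUne).ne' hUb.measure_lt_top.ne
  have hs : spindleConst m ≠ 0 := by
    refine mul_ne_zero (Metric.measure_ball_pos volume _ one_pos).ne' ?_
    refine (lt_of_lt_of_le ?_ (le_lintegral_mul_one_sub_pow m)).ne'
    rw [ENNReal.ofReal_pos]
    positivity
  refine div_pos (ENNReal.toReal_pos (mul_ne_zero (distanceMoment_ne_zero hU hUne) hs)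
    (ENNReal.mul_ne_top (distanceMoment_ne_top hU.measurableSet hUb) (spindleConst_ne_top m)))
    (by positivity)

theorem tendsto_pow_div_mul_atTop {q : ℝ} (hq : 1 < q) :
    Tendsto (fun m : ℕ => q ^ m / (((m : ℝ) + 1) * (m + 2))) atTop atTop := by
  have h : Tendsto (fun m : ℕ => (((m : ℝ) + 1) * (m + 2)) / q ^ m) atTop (𝓝 0) := by
    have := ((tendsto_pow_const_div_const_pow_of_one_lt 2 hq).add
      ((tendsto_pow_const_div_const_pow_of_one_lt 1 hq).const_mul 3)).add
      ((tendsto_pow_const_div_const_pow_of_one_lt 0 hq).const_mul 2)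
    simp only [mul_zero, add_zero] at this
    refine this.congr fun m => ?_
    ring
  have h2 : Tendsto (fun m : ℕ => (((m : ℝ) + 1) * (m + 2)) / q ^ m) atTop (𝓝[>] 0) :=
    tendsto_nhdsWithin_iff.2 ⟨h, Eventually.of_forall fun m => by
      have : 0 < q := one_pos.trans hq
      exact Set.mem_Ioi.2 (by positivity)⟩
  refine h2.inv_tendsto_nhdsGT_zero.congr fun m => ?_
  simp

theorem toReal_spindleConst (m : ℕ) :
    (spindleConst m).toReal = volume.real (Metric.ball (0 : EuclideanSpace ℝ (Fin m)) 1) *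
      (∫⁻ s in Set.Ioo (0 : ℝ) 1, ENNReal.ofReal ((s * (1 - s)) ^ m)).toReal := by
  rw [spindleConst, ENNReal.toReal_mul]
  rfl

/-- Together with `le_deficitRate`: up to polynomial factors in the dimension, the rate of the unit
ball is `(C / 4) ^ m` with `C = 8 / (3 * √3)`, and no convex body has a smaller one. -/
theorem deficitRate_ball_le {m : ℕ} (hm : m ≠ 0) :
    deficitRate (Metric.ball (0 : EuclideanSpace ℝ (Fin (m + 1))) 1) ≤
      (8 / (3 * √3)) * (((m : ℝ) + 1) * (m + 2)) * ((8 / (3 * √3)) * (1 / 4)) ^ m := by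
  set C : ℝ := 8 / (3 * √3) with hC
  have hC0 : 0 < C := by positivity
  set κ := volume.real (Metric.ball (0 : EuclideanSpace ℝ (Fin (m + 1))) 1) with hκ
  set κ' := volume.real (Metric.ball (0 : EuclideanSpace ℝ (Fin m)) 1) with hκ'
  set b := (∫⁻ s in Set.Ioo (0 : ℝ) 1, ENNReal.ofReal ((s * (1 - s)) ^ m)).toReal with hb
  have hκ0 : 0 < κ := ENNReal.toReal_pos (Metric.measure_ball_pos volume _ one_pos).ne'
    measure_ball_lt_top.ne
  have hI : (distanceMoment (Metric.ball (0 : EuclideanSpace ℝ (Fin (m + 1))) 1)).toReal ≤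
      2 * (m + 2) * C ^ (m + 1) * κ ^ 2 := by
    have h := ENNReal.toReal_mono (ENNReal.mul_ne_top ENNReal.ofReal_ne_top
      (ENNReal.pow_ne_top measure_ball_lt_top.ne)) (distanceMoment_ball_le (m + 1))
    rw [ENNReal.toReal_mul, ENNReal.toReal_ofReal (by positivity), ENNReal.toReal_pow] at h
    refine h.trans_eq ?_
    push_cast
    rw [hκ, measureReal_def]
    ring
  have hκκ : κ' ≤ (m + 1) * κ := by
    have h := ENNReal.toReal_mono (ENNReal.mul_ne_top ENNReal.ofReal_ne_top
      measure_ball_lt_top.ne) (volume_ball_le_mul_succ hm)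
    rwa [ENNReal.toReal_mul, ENNReal.toReal_ofReal (by positivity)] at h
  have hb1 : b ≤ (1 / 4) ^ m := by
    have h := ENNReal.toReal_mono ENNReal.ofReal_ne_top (lintegral_mul_one_sub_pow_le m)
    rwa [ENNReal.toReal_ofReal (by positivity)] at h
  rw [deficitRate, ENNReal.toReal_mul, toReal_spindleConst, div_le_iff₀ (by positivity)]
  calc _ ≤ (2 * (m + 2) * C ^ (m + 1) * κ ^ 2) * (((m + 1) * κ) * (1 / 4) ^ m) := by
        gcongr
    _ = _ := by rw [mul_pow]; ring

/-- For the unit ball the exponent of the limit law vanishes below the threshold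
`4 / C = 3 * √3 / 2`, where `C = 8 / (3 * √3)`. -/
theorem tendsto_deficitRate_ball_mul_pow {y : ℝ} (hy0 : 0 < y) (hy : y < 3 * √3 / 2) :
    Tendsto (fun m => deficitRate (Metric.ball (0 : EuclideanSpace ℝ (Fin (m + 1))) 1) * y ^ m)
      atTop (𝓝 0) := by
  set C : ℝ := 8 / (3 * √3) with hC
  set q : ℝ := C * (1 / 4) * y with hq
  have hq0 : 0 < q := by positivity
  have hq1 : q < 1 := by
    have : C * (1 / 4) * (3 * √3 / 2) = 1 := by rw [hC]; field_simp; norm_num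
    rw [← this, hq]
    gcongr
  have hlim := (tendsto_pow_div_mul_atTop (one_lt_inv₀ hq0 |>.2 hq1)).inv_tendsto_atTop.const_mul C
  rw [mul_zero] at hlim
  refine squeeze_zero' (Eventually.of_forall fun m => ?_) ?_ hlim
  · have := (deficitRate_pos (m := m) Metric.isOpen_ball Metric.isBounded_ball
      ⟨0, Metric.mem_ball_self one_pos⟩).le
    positivity
  · filter_upwards [eventually_ne_atTop 0] with m hm
    calc _ ≤ C * (((m : ℝ) + 1) * (m + 2)) * (C * (1 / 4)) ^ m * y ^ m := by
          gcongr
          exact deficitRate_ball_le hm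
      _ = _ := by
          rw [Pi.inv_apply, inv_div, inv_pow, div_inv_eq_mul, hq, mul_pow _ y]
          ring

/-- Lower bound for the rate of an arbitrary bounded open set, for large dimension. -/
theorem le_deficitRate {m : ℕ} {U : Set (EuclideanSpace ℝ (Fin (m + 1)))} (hU : IsOpen U)
    (hUb : Bornology.IsBounded U) (hUne : U.Nonempty)
    (h64 : 64 ≤ (8 / (3 * √3)) ^ (m + 1) / ((m : ℝ) + 2)) :
    (8 / (3 * √3)) / 512 * (((8 / (3 * √3)) * (1 / 4)) ^ m / (((m : ℝ) + 1) * (m + 2))) ≤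
      deficitRate U := by
  set C : ℝ := 8 / (3 * √3) with hC
  have hC0 : 0 < C := by positivity
  set κ := volume.real (Metric.ball (0 : EuclideanSpace ℝ (Fin (m + 1))) 1) with hκ
  set κ' := volume.real (Metric.ball (0 : EuclideanSpace ℝ (Fin m)) 1) with hκ'
  set b := (∫⁻ s in Set.Ioo (0 : ℝ) 1, ENNReal.ofReal ((s * (1 - s)) ^ m)).toReal with hb
  set V := volume.real U with hV
  set I := (distanceMoment U).toReal with hI
  have hκ0 : 0 < κ := ENNReal.toReal_pos (Metric.measure_ball_pos volume _ one_pos).ne'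
    measure_ball_lt_top.ne
  have hUf : volume U ≠ ⊤ := hUb.measure_lt_top.ne
  have hU0 : volume U ≠ 0 := (hU.measure_pos volume hUne).ne'
  have hV0 : 0 < V := ENNReal.toReal_pos hU0 hUf
  have hIf := distanceMoment_ne_top hU.measurableSet hUb
  have hlow : C ^ (m + 1) * V ^ 3 ≤ 32 * (m + 2) * (κ * I + V ^ 3) := by
    have hκI : volume (Metric.ball (0 : EuclideanSpace ℝ (Fin (m + 1))) 1) * distanceMoment U ≠ ⊤ :=
      ENNReal.mul_ne_top measure_ball_lt_top.ne hIf
    have h := ENNReal.toReal_mono (ENNReal.mul_ne_top ENNReal.ofReal_ne_top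
      (ENNReal.add_ne_top.2 ⟨hκI, ENNReal.pow_ne_top hUf⟩))
      (le_distanceMoment m.succ_ne_zero hU.measurableSet hU0 hUf)
    rw [ENNReal.toReal_mul, ENNReal.toReal_mul, ENNReal.toReal_add hκI (ENNReal.pow_ne_top hUf),
      ENNReal.toReal_mul, ENNReal.toReal_ofReal (by positivity), ENNReal.toReal_pow,
      ENNReal.toReal_pow, ENNReal.toReal_ofReal hC0.le] at h
    refine h.trans_eq ?_
    push_cast
    rw [hκ, hV, measureReal_def, measureReal_def]
    ring
  have hκκ : κ ≤ 2 * κ' := by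
    have h := ENNReal.toReal_mono (ENNReal.mul_ne_top (by simp)
      measure_ball_lt_top.ne) (volume_ball_succ_le m)
    rwa [ENNReal.toReal_mul, ENNReal.toReal_ofNat] at h
  have hbt : (∫⁻ s in Set.Ioo (0 : ℝ) 1, ENNReal.ofReal ((s * (1 - s)) ^ m)) ≠ ⊤ :=
    ne_top_of_le_ne_top ENNReal.ofReal_ne_top (lintegral_mul_one_sub_pow_le m)
  have hb1 : (1 / 4) ^ m / (2 * (m + 1)) ≤ b := by
    have h := ENNReal.toReal_mono hbt (le_lintegral_mul_one_sub_pow m)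
    rwa [ENNReal.toReal_ofReal (by positivity)] at h
  -- The error term `V ^ 3` is at most half of the left-hand side.
  have hIlow : C ^ (m + 1) / (64 * (m + 2)) * V ^ 3 ≤ κ * I := by
    rw [le_div_iff₀ (by positivity)] at h64
    rw [div_mul_eq_mul_div, div_le_iff₀ (by positivity)]
    have : 64 * ((m : ℝ) + 2) * V ^ 3 ≤ C ^ (m + 1) * V ^ 3 := by gcongr
    linarith
  rw [deficitRate, ENNReal.toReal_mul, toReal_spindleConst, le_div_iff₀ (by positivity)]
  calc _ = C ^ (m + 1) / (64 * (m + 2)) * V ^ 3 / 2 * ((1 / 4) ^ m / (2 * (m + 1))) := by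
        rw [mul_pow, ← hV]; field_simp; ring
    _ ≤ κ * I / 2 * b := by gcongr
    _ ≤ (2 * κ') * I / 2 * b := by gcongr
    _ = I * (κ' * b) := by ring

/-- For arbitrary bounded open sets the exponent of the limit law diverges above the threshold
`3 * √3 / 2`. -/
theorem tendsto_deficitRate_mul_pow_atTop {U : ∀ m : ℕ, Set (EuclideanSpace ℝ (Fin (m + 1)))}
    (hU : ∀ m, m ≠ 0 → IsOpen (U m) ∧ Bornology.IsBounded (U m) ∧ (U m).Nonempty)
    {y : ℝ} (hy : 3 * √3 / 2 < y) :
    Tendsto (fun m => deficitRate (U m) * y ^ m) atTop atTop := by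
  set C : ℝ := 8 / (3 * √3) with hC
  have hC0 : 0 < C := by positivity
  have hC1 : 1 < C := by
    have : √3 < 8 / 3 := (Real.sqrt_lt' (by norm_num)).2 (by norm_num)
    rw [hC, one_lt_div (by positivity)]
    linarith
  have hy0 : 0 < y := lt_of_le_of_lt (by positivity) hy
  set q : ℝ := C * (1 / 4) * y with hq
  have hq1 : 1 < q := by
    have : C * (1 / 4) * (3 * √3 / 2) = 1 := by rw [hC]; field_simp; norm_num
    rw [← this, hq]
    gcongr
  refine tendsto_atTop_mono' _ ?_
    ((tendsto_pow_div_mul_atTop hq1).const_mul_atTop (by positivity : 0 < C / 512))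
  filter_upwards [eventually_ne_atTop 0,
    (tendsto_pow_div_mul_atTop hC1).eventually_ge_atTop 64] with m hm h64
  obtain ⟨h1, h2, h3⟩ := hU m hm
  have h := le_deficitRate h1 h2 h3 (h64.trans ?_)
  · calc _ = C / 512 * ((C * (1 / 4)) ^ m / (((m : ℝ) + 1) * (m + 2))) * y ^ m := by
          rw [hq, mul_pow _ y]; ring
      _ ≤ _ := by gcongr
  · have hm0 : (0 : ℝ) ≤ m := Nat.cast_nonneg m
    have : (m : ℝ) + 2 ≤ ((m : ℝ) + 1) * (m + 2) := by nlinarith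
    have h5 : C ^ m ≤ C ^ (m + 1) := pow_le_pow_right₀ hC1.le (Nat.le_succ m)
    gcongr

/-! ### Convergence in distribution -/

/-- Weak convergence of probability measures on the line follows from convergence of the survival
functions on a dense set. -/
theorem tendsto_probabilityMeasure_of_tendsto_Ici {ι : Type*} {l : Filter ι}
    [l.IsCountablyGenerated] {ν : ι → ProbabilityMeasure ℝ} {μ : ProbabilityMeasure ℝ} {D : Set ℝ}
    (hD : Dense D) (h : ∀ y ∈ D, Tendsto (fun i => (ν i : Measure ℝ).real (Set.Ici y)) l
      (𝓝 ((μ : Measure ℝ).real (Set.Ici y)))) : Tendsto ν l (𝓝 μ) := by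
  refine (isPiSystem_Ico_mem D D).tendsto_probabilityMeasure_of_tendsto_of_mem ?_ ?_ ?_
  · rintro _ ⟨a, -, b, -, -, rfl⟩
    exact measurableSet_Ico
  · intro u hu x hx
    obtain ⟨a, b, hab, hsub⟩ := mem_nhds_iff_exists_Ioo_subset.1 (hu.mem_nhds hx)
    obtain ⟨a', ha', ha1, ha2⟩ := hD.exists_between hab.1
    obtain ⟨b', hb', hb1, hb2⟩ := hD.exists_between hab.2
    exact ⟨_, ⟨a', ha', b', hb', ha2.trans hb1, rfl⟩, Ico_mem_nhds ha2 hb1,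
      fun z hz => hsub ⟨ha1.trans_le hz.1, hz.2.trans hb2⟩⟩
  · rintro _ ⟨a, ha, b, hb, hab, rfl⟩
    have key : ∀ ρ : ProbabilityMeasure ℝ, ((ρ (Set.Ico a b) : NNReal) : ℝ) =
        (ρ : Measure ℝ).real (Set.Ici a) - (ρ : Measure ℝ).real (Set.Ici b) := fun ρ => by
      rw [← measureReal_sdiff (Set.Ici_subset_Ici.2 hab.le) measurableSet_Ici, Set.Ici_sdiff_Ici]
      rfl
    rw [← NNReal.tendsto_coe]
    simp only [key]
    exact (h a ha).sub (h b hb)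

/-- The law on the half-line with survival function `exp (-(c * y ^ m))`. -/
theorem exists_probabilityMeasure_Ici_eq {m : ℕ} (hm : m ≠ 0) {c : ℝ} (hc : 0 < c) :
    ∃ ν : ProbabilityMeasure ℝ, (∀ y ≤ 0, (ν : Measure ℝ).real (Set.Ici y) = 1) ∧
      ∀ y, 0 < y → (ν : Measure ℝ).real (Set.Ici y) = Real.exp (-(c * y ^ m)) := by
  have := isProbabilityMeasure_expMeasure hc
  have hf : Measurable fun x : ℝ => (max x 0) ^ ((m : ℝ)⁻¹) := by fun_prop
  -- The `m`-th root of an exponential variable of rate `c`.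
  refine ⟨⟨(expMeasure c).map fun x => (max x 0) ^ ((m : ℝ)⁻¹),
    Measure.isProbabilityMeasure_map hf.aemeasurable⟩, fun y hy => ?_, fun y hy => ?_⟩
  · change ((expMeasure c).map _).real _ = 1
    rw [map_measureReal_apply hf measurableSet_Ici]
    convert probReal_univ (μ := expMeasure c)
    exact Set.eq_univ_of_forall fun x => hy.trans (by positivity)
  · change ((expMeasure c).map _).real _ = _
    rw [map_measureReal_apply hf measurableSet_Ici]
    have hpre : (fun x : ℝ => (max x 0) ^ ((m : ℝ)⁻¹)) ⁻¹' Set.Ici y = (Set.Iio (y ^ m))ᶜ := by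
      ext x
      have hp : 0 < y ^ m := pow_pos hy m
      simp only [Set.mem_preimage, Set.mem_Ici, Set.mem_compl_iff, Set.mem_Iio, not_lt]
      rw [Real.le_rpow_inv_iff_of_pos hy.le (le_max_right _ _)
        (by exact_mod_cast Nat.pos_of_ne_zero hm), Real.rpow_natCast, le_max_iff]
      exact ⟨fun h => h.resolve_right hp.not_ge, Or.inl⟩
    have hat : (expMeasure c) {y ^ m} = 0 := by
      simp [expMeasure, gammaMeasure]
    have hIio : (expMeasure c).real (Set.Iio (y ^ m)) = cdf (expMeasure c) (y ^ m) := by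
      rw [cdf_eq_real]
      exact measureReal_congr (Iio_ae_eq_Iic' hat)
    rw [hpre, probReal_compl_eq_one_sub measurableSet_Iio, hIio, cdf_expMeasure_eq hc,
      if_pos (by positivity)]
    ring

theorem scaledDeficit_nonneg {d : ℕ} {Ω : Type*} [MeasurableSpace Ω]
    (P : ℕ → Ω → EuclideanSpace ℝ (Fin d)) (n : ℕ) (ω : Ω) :
    0 ≤ scaledDeficit P n ω := by
  have h : maxAngle (fun i => P i ω) n ≤ Real.pi :=
    Real.iSup_le (fun s => largestTriangleAngle_le_pi _ _ _) Real.pi_pos.le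
  exact mul_nonneg (by positivity) (sub_nonneg.2 h)

/-- Limit law of the rescaled deficit in a fixed dimension. -/
theorem tendstoInDistribution_scaledDeficit {m : ℕ} (hm : m ≠ 0)
    {K : Set (EuclideanSpace ℝ (Fin (m + 1)))} (hKb : Bornology.IsBounded K) (hKc : Convex ℝ K)
    (hKi : (interior K).Nonempty) {Ω : Type*} [MeasurableSpace Ω]
    {Pr : Measure Ω} [IsProbabilityMeasure Pr] {P : ℕ → Ω → EuclideanSpace ℝ (Fin (m + 1))}
    (hP : IsUniformSample P K Pr) {ν : ProbabilityMeasure ℝ}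
    (hν0 : ∀ y ≤ 0, (ν : Measure ℝ).real (Set.Ici y) = 1)
    (hν : ∀ y, 0 < y →
      (ν : Measure ℝ).real (Set.Ici y) = Real.exp (-(deficitRate (interior K) * y ^ m))) :
    TendstoInDistribution (fun n => scaledDeficit P n) atTop (id : ℝ → ℝ)
      (fun _ => Pr) (ν : Measure ℝ) := by
  have hae := fun n => aemeasurable_scaledDeficit (aemeasurable_of_isUniformSample hKb hKi hP) n
  refine ⟨hae, aemeasurable_id, ?_⟩
  refine tendsto_probabilityMeasure_of_tendsto_Ici dense_univ fun y _ => ?_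
  simp only [ProbabilityMeasure.coe_mk, Measure.map_id,
    map_measureReal_apply_of_aemeasurable (hae _) measurableSet_Ici]
  rcases le_or_gt y 0 with hy | hy
  · rw [hν0 y hy]
    refine tendsto_const_nhds.congr fun n => ?_
    convert (probReal_univ (μ := Pr)).symm
    exact Set.eq_univ_of_forall fun ω =>
      hy.trans (scaledDeficit_nonneg P n ω)
  · rw [hν y hy]
    exact tendsto_measureReal_le_scaledDeficit hm hKb hKc hKi hP hy

/-- The limit laws of the rescaled deficit in all dimensions at least two. -/
theorem exists_isDlimOverN {K : ∀ d : ℕ, Set (EuclideanSpace ℝ (Fin d))}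
    (hK : ∀ d, 2 ≤ d → Bornology.IsBounded (K d) ∧ Convex ℝ (K d) ∧ (interior (K d)).Nonempty)
    {Ω : ℕ → Type*} [∀ d, MeasurableSpace (Ω d)] {Pr : ∀ d, Measure (Ω d)}
    [∀ d, IsProbabilityMeasure (Pr d)] {P : ∀ d, ℕ → Ω d → EuclideanSpace ℝ (Fin d)}
    (hP : ∀ d, 2 ≤ d → IsUniformSample (P d) (K d) (Pr d)) :
    ∃ ν : ℕ → ProbabilityMeasure ℝ, IsDlimOverN Pr P ν ∧
      (∀ d, 2 ≤ d → ∀ y ≤ 0, (ν d : Measure ℝ).real (Set.Ici y) = 1) ∧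
      ∀ m, m ≠ 0 → ∀ y, 0 < y → (ν (m + 1) : Measure ℝ).real (Set.Ici y) =
        Real.exp (-(deficitRate (interior (K (m + 1))) * y ^ m)) := by
  have hex : ∀ m : ℕ, m ≠ 0 → ∃ ν : ProbabilityMeasure ℝ,
      (∀ y ≤ 0, (ν : Measure ℝ).real (Set.Ici y) = 1) ∧
      ∀ y, 0 < y → (ν : Measure ℝ).real (Set.Ici y) =
        Real.exp (-(deficitRate (interior (K (m + 1))) * y ^ m)) := fun m hm => by
    obtain ⟨h1, h2, h3⟩ := hK (m + 1) (by omega)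
    exact exists_probabilityMeasure_Ici_eq hm
      (deficitRate_pos isOpen_interior (h1.subset interior_subset) h3)
  choose! ν hν0 hν using hex
  -- Dimensions below two are unconstrained, and get an arbitrary law.
  refine ⟨fun d => ν (d - 1), fun d hd => ?_, fun d hd => hν0 _ (by omega), fun m hm => hν m hm⟩
  obtain ⟨m, rfl⟩ : ∃ m, d = m + 1 := ⟨d - 1, by omega⟩
  have hm : m ≠ 0 := by omega
  obtain ⟨h1, h2, h3⟩ := hK (m + 1) hd
  exact tendstoInDistribution_scaledDeficit hm h1 h2 h3 (hP _ hd) (hν0 m hm) (hν m hm)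

/-- Above `3√3/2` the limiting survival functions vanish as the dimension grows. -/
theorem tendsto_survival_zero {K : ∀ d : ℕ, Set (EuclideanSpace ℝ (Fin d))}
    (hK : ∀ d, 2 ≤ d → Bornology.IsBounded (K d) ∧ Convex ℝ (K d) ∧ (interior (K d)).Nonempty)
    {ν : ℕ → ProbabilityMeasure ℝ}
    (hν : ∀ m, m ≠ 0 → ∀ y, 0 < y → (ν (m + 1) : Measure ℝ).real (Set.Ici y) =
        Real.exp (-(deficitRate (interior (K (m + 1))) * y ^ m)))
    {y : ℝ} (hy : 3 * √3 / 2 < y) :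
    Tendsto (fun d => (ν d : Measure ℝ).real (Set.Ici y)) atTop (𝓝 0) := by
  have hy0 : 0 < y := lt_of_le_of_lt (by positivity) hy
  rw [← tendsto_add_atTop_iff_nat 1]
  have h := tendsto_deficitRate_mul_pow_atTop (U := fun m => interior (K (m + 1)))
    (fun m hm => ?_) hy
  · refine (Real.tendsto_exp_neg_atTop_nhds_zero.comp h).congr' ?_
    filter_upwards [eventually_ne_atTop 0] with m hm
    exact (hν m hm y hy0).symm
  · obtain ⟨h1, h2, h3⟩ := hK (m + 1) (by omega)
    exact ⟨isOpen_interior, h1.subset interior_subset, h3⟩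

theorem corollary1 :
    (∀ (Ω : ℕ → Type*) [∀ d, MeasurableSpace (Ω d)] (Pr : ∀ d, Measure (Ω d))
      [∀ d, IsProbabilityMeasure (Pr d)] (P : ∀ d, ℕ → Ω d → EuclideanSpace ℝ (Fin d)),
      (∀ d, 2 ≤ d → IsUniformSample (P d) (Metric.ball 0 1) (Pr d)) →
      ∃ ν : ℕ → ProbabilityMeasure ℝ, IsDlimOverN Pr P ν ∧
        Tendsto ν atTop (𝓝 (diracProba (3 * √3 / 2)))) ∧
    (∀ (K : ∀ d : ℕ, Set (EuclideanSpace ℝ (Fin d))),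
      (∀ d, 2 ≤ d → Bornology.IsBounded (K d) ∧ Convex ℝ (K d) ∧ (interior (K d)).Nonempty) →
      ∀ (Ω : ℕ → Type*) [∀ d, MeasurableSpace (Ω d)] (Pr : ∀ d, Measure (Ω d))
      [∀ d, IsProbabilityMeasure (Pr d)] (P : ∀ d, ℕ → Ω d → EuclideanSpace ℝ (Fin d)),
      (∀ d, 2 ≤ d → IsUniformSample (P d) (K d) (Pr d)) →
      ∃ ν : ℕ → ProbabilityMeasure ℝ, IsDlimOverN Pr P ν ∧
        DlimsupLE ν (diracProba (3 * √3 / 2))) := by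
  refine ⟨fun Ω _ Pr _ P hP => ?_, fun K hK Ω _ Pr _ P hP => ?_⟩
  · have hK : ∀ d, 2 ≤ d → Bornology.IsBounded (Metric.ball (0 : EuclideanSpace ℝ (Fin d)) 1) ∧
        Convex ℝ (Metric.ball (0 : EuclideanSpace ℝ (Fin d)) 1) ∧
        (interior (Metric.ball (0 : EuclideanSpace ℝ (Fin d)) 1)).Nonempty := fun d _ =>
      ⟨Metric.isBounded_ball, convex_ball _ _, by
        rw [Metric.isOpen_ball.interior_eq]; exact ⟨0, Metric.mem_ball_self one_pos⟩⟩
    obtain ⟨ν, hlim, h0, hν⟩ := exists_isDlimOverN hK hP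
    -- The threshold itself is an atom of the limit law and has to be avoided.
    refine ⟨ν, hlim, tendsto_probabilityMeasure_of_tendsto_Ici
      (dense_compl_singleton (3 * √3 / 2 : ℝ)) fun y hy => ?_⟩
    rcases lt_or_gt_of_ne hy with hlt | hgt
    · have e : ((diracProba (3 * √3 / 2 : ℝ)) : Measure ℝ).real (Set.Ici y) = 1 := by
        rw [measureReal_def, diracProba_toMeasure_apply_of_mem (Set.mem_Ici.2 hlt.le),
          ENNReal.toReal_one]
      rw [e]
      rcases le_or_gt y 0 with hy0 | hy0
      · refine tendsto_const_nhds.congr' ?_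
        filter_upwards [eventually_ge_atTop 2] with d hd using (h0 d hd y hy0).symm
      · rw [← tendsto_add_atTop_iff_nat 1]
        have h := (Real.continuous_exp.tendsto _).comp
          (tendsto_deficitRate_ball_mul_pow hy0 hlt).neg
        rw [neg_zero, Real.exp_zero] at h
        refine h.congr' ?_
        filter_upwards [eventually_ne_atTop 0] with m hm
        rw [hν m hm y hy0, Metric.isOpen_ball.interior_eq]
        rfl
    · have e : ((diracProba (3 * √3 / 2 : ℝ)) : Measure ℝ).real (Set.Ici y) = 0 := by
        rw [measureReal_def, diracProba_toMeasure_apply' _ measurableSet_Ici]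
        simp [hgt]
      rw [e]
      exact tendsto_survival_zero hK hν hgt
  · obtain ⟨ν, hlim, h0, hν⟩ := exists_isDlimOverN hK hP
    refine ⟨ν, hlim, fun y => ?_⟩
    rcases le_or_gt y (3 * √3 / 2) with hle | hgt
    · rw [diracProba_toMeasure_apply_of_mem (Set.mem_Ici.2 hle)]
      exact limsup_le_of_le (h := Eventually.of_forall fun d => prob_le_one)
    · have h := (ENNReal.tendsto_toReal_iff (fun d => measure_ne_top (ν d : Measure ℝ) _)
        ENNReal.zero_ne_top).1 (tendsto_survival_zero hK hν hgt)
      rw [h.limsup_eq]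
      exact zero_le
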